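/- **Setting.** Let $X$ be a topological space with a filtration $\emptyset=X_{-1}\subseteq X_0\subseteq\dots\subseteq X_n=X$ by closed subsets. Its *strata* are the connected components of the subspaces $X_i\setminus X_{i-1}$ (of codimension $n-i$); a stratum is *regular* if $i=n$ and *singular* otherwise. Let $\overline p$ be a *perversity*, i.e. a map from the set of strata to $\mathbb Z\cup\{\pm\infty\}$ that vanishes on the regular strata. Assume that the stratification is locally finite: every point of $X$ has a neighborhood that meets only finitely many strata. A singular simplex $\sigma\colon\Delta^\ell\to X$ is $\overline p$-*allowable* if, for each singular stratum $S$, $\sigma^{-1}(S)$ is contained in a compact polyhedron of dimension at most $\ell-\operatorname{codim}S+\overline p(S)$ (in particular $\sigma^{-1}(S)=\emptyset$ if this number is negative); it is $\overline p$-*full* if $\sigma$ and all its faces are $\overline p$-allowable. The $\overline p$-full simplexes form a simplicial set $\mathscr G_{\overline p}X$, the *Gajer space*. For a subspace $W\subseteq X$, let $\mathscr G_{\overline p}W\subseteq\mathscr G_{\overline p}X$ be the simplicial subset of the $\overline p$-full simplexes of $X$ with image in $W$; if $W$ is open and its induced stratification is locally finite, this is the Gajer space of $W$ with the induced filtration and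 perversity. Let $\mathcal E$ be a local coefficient system on $\mathscr G_{\overline p}X$, i.e. a contravariant functor from the fundamental groupoid of $\mathscr G_{\overline p}X$ to abelian groups. For a simplicial subset $K\subseteq\mathscr G_{\overline p}X$, let $H_*(K;\mathcal E)$ be the homology of the complex $C_*(K;\mathcal E)$ with $C_j(K;\mathcal E)=\bigoplus_{\sigma\in K_j}\mathcal E(\sigma(0))$ and $\partial(a\,\sigma)=\mathcal E(\sigma([0,1]))^{-1}(a)\,\partial_0\sigma+\sum_{i=1}^{j}(-1)^i a\,\partial_i\sigma$. For $L\subseteq K$, let $H_*(K,L;\mathcal E)$ be the homology of $C_*(K;\mathcal E)/C_*(L;\mathcal E)$. **Theorem.** 1. (Small chains.) For every open covering $\mathcal U$ of $X$, let $\mathscr G^{\mathcal U}_{\overline p}X$ be the simplicial subset of the $\overline p$-full simplexes with image in some element of $\mathcal U$. The inclusion $C_*(\mathscr G^{\mathcal U}_{\overline p}X;\mathcal E)\to C_*(\mathscr G_{\overline p}X;\mathcal E)$ induces an isomorphism in homology. 2. (Mayer–Vietoris.) For every open covering $\{U,V\}$ of $X$ there is a long exact sequence $$\dots\to H_{j}(\mathscr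 G_{\overline p}(U\cap V);\mathcal E)\to H_{j}(\mathscr G_{\overline p}U;\mathcal E)\oplus H_{j}(\mathscr G_{\overline p}V;\mathcal E)\to H_{j}(\mathscr G_{\overline p}X;\mathcal E)\xrightarrow{\ \delta\ }H_{j-1}(\mathscr G_{\overline p}(U\cap V);\mathcal E)\to\cdots$$ ending with $\dots\to H_0(\mathscr G_{\overline p}X;\mathcal E)\to 0$. Its first map is the pair of the maps induced by the inclusions, its second map is the difference of the maps induced by the inclusions, and $\delta[x-y]=[z]$ whenever $x\in C_j(\mathscr G_{\overline p}U;\mathcal E)$, $y\in C_j(\mathscr G_{\overline p}V;\mathcal E)$ and $\partial x=\partial y=z\in C_{j-1}(\mathscr G_{\overline p}(U\cap V);\mathcal E)$. 3. (Excision.) For all subspaces $Z\subset A\subset X$ such that the closure $\overline Z$ is contained in the interior of $A$, the inclusion induces isomorphisms in all degrees $$H_{*}(\mathscr G_{\overline p}(X\setminus Z),\mathscr G_{\overline p}(A\setminus Z);\mathcal E)\cong H_{*}(\mathscr G_{\overline p}X,\mathscr G_{\overline p}A;\mathcal E).$$ -/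

import Mathlib

open CategoryTheory Simplicial Opposite

universe u w

namespace PerverseSpace

/-! ### Polyhedral dimension -/

/-- The extended integers `ℤ ∪ {-∞, +∞}`. -/
abbrev ExtInt : Type := WithBot (WithTop ℤ)

/-- The inclusion of the integers in the extended integers. -/
def toExt (k : ℤ) : ExtInt := ((k : WithTop ℤ) : WithBot (WithTop ℤ))

/-- A compact convex cell in `ℝ^m`: a compact intersection of finitely many closed half-spaces. -/
def IsConvexCell {m : ℕ} (C : Set (Fin m → ℝ)) : Prop :=
  IsCompact C ∧ ∃ H : Set (((Fin m → ℝ) →ₗ[ℝ] ℝ) × ℝ), H.Finite ∧ C = {x | ∀ h ∈ H, h.1 x ≤ h.2}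

/-- `A` is contained in a polyhedron (a finite union of compact convex cells) of
dimension at most `d`, the dimension of a nonempty cell being that of its affine span.
For negative `d` only the empty set has this property. -/
def PolyDimLE {m : ℕ} (A : Set (Fin m → ℝ)) (d : ExtInt) : Prop :=
  ∃ 𝒞 : Set (Set (Fin m → ℝ)), 𝒞.Finite ∧
    (∀ C ∈ 𝒞, IsConvexCell C ∧ C.Nonempty ∧
      toExt (Module.finrank ℝ (vectorSpan ℝ C) : ℤ) ≤ d) ∧
    A ⊆ ⋃₀ 𝒞

lemma PolyDimLE.mono {m : ℕ} {A B : Set (Fin m → ℝ)} {d : ExtInt} (h : PolyDimLE B d)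
    (hAB : A ⊆ B) : PolyDimLE A d := by
  obtain ⟨𝒞, h1, h2, h3⟩ := h
  exact ⟨𝒞, h1, h2, hAB.trans h3⟩

lemma PolyDimLE.biUnion {m : ℕ} {ι : Type*} {s : Set ι} (hs : s.Finite)
    {A : ι → Set (Fin m → ℝ)} {d : ExtInt} (h : ∀ i ∈ s, PolyDimLE (A i) d) :
    PolyDimLE (⋃ i ∈ s, A i) d := by
  choose! 𝒞 h1 h2 h3 using h
  refine ⟨⋃ i ∈ s, 𝒞 i, hs.biUnion h1, ?_, ?_⟩
  · intro C hC
    simp only [Set.mem_iUnion] at hC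
    obtain ⟨i, hi, hC⟩ := hC
    exact h2 i hi C hC
  · intro x hx
    simp only [Set.mem_iUnion] at hx
    obtain ⟨i, hi, hx⟩ := hx
    obtain ⟨C, hC, hxC⟩ := h3 i hi hx
    exact ⟨C, by simp only [Set.mem_iUnion]; exact ⟨i, hi, hC⟩, hxC⟩

lemma finrank_comap_of_surjective {k m : ℕ} (f : (Fin k → ℝ) →ₗ[ℝ] (Fin m → ℝ))
    (hf : Function.Surjective f) (W : Submodule ℝ (Fin m → ℝ)) :
    Module.finrank ℝ (W.comap f) + m = Module.finrank ℝ W + k := by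
  have h1 := LinearMap.finrank_range_add_finrank_ker f
  rw [LinearMap.range_eq_top.2 hf, finrank_top] at h1
  have h2 := LinearMap.finrank_range_add_finrank_ker (f.domRestrict (W.comap f))
  have hr : LinearMap.range (f.domRestrict (W.comap f)) = W := by
    ext y
    constructor
    · rintro ⟨x, rfl⟩
      exact x.2
    · intro hy
      obtain ⟨x, rfl⟩ := hf y
      exact ⟨⟨x, hy⟩, rfl⟩
  have hk : Module.finrank ℝ (LinearMap.ker (f.domRestrict (W.comap f))) =
      Module.finrank ℝ (LinearMap.ker f) := by
    rw [LinearMap.ker_domRestrict]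
    have hle : LinearMap.ker f ≤ W.comap f := by
      intro x hx
      rw [LinearMap.mem_ker] at hx
      simp [hx]
    exact (Submodule.comapSubtypeEquivOfLe hle).finrank_eq
  rw [hr, hk] at h2
  simp only [Module.finrank_fin_fun] at h1
  omega

lemma isConvexCell_preimage {k m : ℕ} (f : (Fin k → ℝ) →ₗ[ℝ] (Fin m → ℝ))
    {C : Set (Fin m → ℝ)} (hC : IsConvexCell C) :
    IsConvexCell (stdSimplex ℝ (Fin k) ∩ f ⁻¹' C) := by
  obtain ⟨hc, H, hH, rfl⟩ := hC
  refine ⟨(isCompact_stdSimplex _ _).inter_right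
    (hc.isClosed.preimage f.continuous_of_finiteDimensional), ?_⟩
  refine ⟨(Set.range fun i : Fin k => (-(LinearMap.proj i : (Fin k → ℝ) →ₗ[ℝ] ℝ), (0 : ℝ))) ∪
    {(∑ i, (LinearMap.proj i : (Fin k → ℝ) →ₗ[ℝ] ℝ), 1),
      (-∑ i, (LinearMap.proj i : (Fin k → ℝ) →ₗ[ℝ] ℝ), -1)} ∪
    (fun h : ((Fin m → ℝ) →ₗ[ℝ] ℝ) × ℝ => (h.1.comp f, h.2)) '' H, ?_, ?_⟩
  · exact ((Set.finite_range _).union (by simp)).union (hH.image _)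
  · ext x
    simp only [Set.mem_inter_iff, Set.mem_preimage, Set.mem_ofPred_eq, Set.mem_union,
      Set.mem_range, Set.mem_image, Set.mem_insert_iff, Set.mem_singleton_iff, stdSimplex]
    constructor
    · rintro ⟨⟨h0, h1⟩, h2⟩ h ((⟨i, rfl⟩ | (rfl | rfl)) | ⟨g, hg, rfl⟩)
      · simpa using h0 i
      · simp [LinearMap.sum_apply, h1]
      · simp [LinearMap.sum_apply, h1]
      · exact h2 g hg
    · intro h
      refine ⟨⟨fun i => ?_, le_antisymm ?_ ?_⟩, fun g hg => ?_⟩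
      · simpa using h _ (Or.inl (Or.inl ⟨i, rfl⟩))
      · simpa [LinearMap.sum_apply] using h _ (Or.inl (Or.inr (Or.inl rfl)))
      · simpa [LinearMap.sum_apply] using h _ (Or.inl (Or.inr (Or.inr rfl)))
      · exact h _ (Or.inr ⟨g, hg, rfl⟩)

/-- The part of the preimage of `A` in the standard simplex, under a surjective linear map
with kernel of dimension `k - m`, has dimension at most `dim A + (k - m)`. -/
lemma PolyDimLE.preimage {k m : ℕ} (f : (Fin k → ℝ) →ₗ[ℝ] (Fin m → ℝ))
    (hf : Function.Surjective f) {A : Set (Fin m → ℝ)} {d : ExtInt} (h : PolyDimLE A d) :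
    PolyDimLE (stdSimplex ℝ (Fin k) ∩ f ⁻¹' A) (toExt ((k : ℤ) - m) + d) := by
  obtain ⟨𝒞, h1, h2, h3⟩ := h
  refine ⟨((fun C => stdSimplex ℝ (Fin k) ∩ f ⁻¹' C) '' 𝒞) ∩ {C | C.Nonempty},
    (h1.image _).inter_of_left _, ?_, ?_⟩
  · rintro _ ⟨⟨C, hC, rfl⟩, hne⟩
    obtain ⟨hcell, -, hd⟩ := h2 C hC
    refine ⟨isConvexCell_preimage f hcell, hne, ?_⟩
    have hle : vectorSpan ℝ (stdSimplex ℝ (Fin k) ∩ f ⁻¹' C) ≤ (vectorSpan ℝ C).comap f := by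
      rw [vectorSpan_def, Submodule.span_le]
      rintro _ ⟨x, hx, y, hy, rfl⟩
      simp only [vsub_eq_sub, Submodule.comap_coe, Set.mem_preimage, map_sub, SetLike.mem_coe]
      exact vsub_mem_vectorSpan ℝ hx.2 hy.2
    have hfr := Submodule.finrank_mono hle
    have hcm := finrank_comap_of_surjective f hf (vectorSpan ℝ C)
    calc toExt (Module.finrank ℝ (vectorSpan ℝ (stdSimplex ℝ (Fin k) ∩ f ⁻¹' C)) : ℤ)
        ≤ toExt (((k : ℤ) - m) + (Module.finrank ℝ (vectorSpan ℝ C) : ℤ)) := by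
          simp only [toExt, WithBot.coe_le_coe, WithTop.coe_le_coe]
          omega
      _ = toExt ((k : ℤ) - m) + toExt (Module.finrank ℝ (vectorSpan ℝ C) : ℤ) := rfl
      _ ≤ _ := by gcongr
  · rintro x ⟨hx, hxA⟩
    obtain ⟨C, hC, hxC⟩ := h3 hxA
    exact ⟨_, ⟨⟨C, hC, rfl⟩, ⟨x, hx, hxC⟩⟩, ⟨hx, hxC⟩⟩

/-! ### Local coefficient systems on simplicial sets -/

section LocalCoefficients

variable {K : SSet.{u}}

/-- The fundamental groupoid of a simplicial set: the free groupoid on the vertices and edges,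
modulo the relations given by the `2`-simplices and the degenerate edges. -/
abbrev FundGroupoid (K : SSet.{u}) : Type u :=
  FreeGroupoid ((SSet.truncation 2).obj K).HomotopyCategory

/-- A vertex of `K` as an object of the fundamental groupoid. -/
def FundGroupoid.vert (x : K _⦋0⦌) : FundGroupoid K :=
  FreeGroupoid.mk (SSet.Truncated.HomotopyCategory.mk (V := (SSet.truncation 2).obj K) x)

/-- The morphism of the fundamental groupoid given by an edge of `K`. -/
def FundGroupoid.edge {x y : K _⦋0⦌} (e : SSet.Edge x y) :
    FundGroupoid.vert x ⟶ FundGroupoid.vert y :=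
  FreeGroupoid.homMk (SSet.Truncated.HomotopyCategory.homMk e.toTruncated)

lemma FundGroupoid.edge_id (x : K _⦋0⦌) : FundGroupoid.edge (SSet.Edge.id x) = 𝟙 _ :=
  (congrArg (FreeGroupoid.of _).map
    (SSet.Truncated.HomotopyCategory.homMk_id (V := (SSet.truncation 2).obj K) x)).trans
      (CategoryTheory.Functor.map_id _ _)

lemma FundGroupoid.edge_comp {x y z : K _⦋0⦌} {e₀₁ : SSet.Edge x y} {e₁₂ : SSet.Edge y z}
    {e₀₂ : SSet.Edge x z} (h : SSet.Edge.CompStruct e₀₁ e₁₂ e₀₂) :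
    FundGroupoid.edge e₀₁ ≫ FundGroupoid.edge e₁₂ = FundGroupoid.edge e₀₂ := by
  unfold edge
  rw [← SSet.Truncated.HomotopyCategory.homMk_comp_homMk h.toTruncated]
  exact (CategoryTheory.Functor.map_comp _ _ _).symm

/-- A local coefficient system of abelian groups on `K`: a contravariant functor from the
fundamental groupoid of `K` to abelian groups. -/
abbrev LocalSystem (K : SSet.{u}) := (FundGroupoid K)ᵒᵖ ⥤ AddCommGrpCat.{w}

/-- The `i`-th vertex `σ(i)` of a simplex `σ`. -/
def vertex {l : SimplexCategoryᵒᵖ} (σ : K.obj l) (i : Fin (l.unop.len + 1)) : K _⦋0⦌ :=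
  K.map (SimplexCategory.const ⦋0⦌ l.unop i).op σ

lemma vertex_map {l k : SimplexCategoryᵒᵖ} (θ : l ⟶ k) (σ : K.obj l) (i : Fin (k.unop.len + 1)) :
    vertex (K.map θ σ) i = vertex σ (θ.unop i) := by
  simp only [vertex, ← Functor.map_comp_apply]
  rfl

lemma map_op_congr {l : SimplexCategoryᵒᵖ} (σ : K.obj l) {k : SimplexCategory} {f g : k ⟶ l.unop}
    (h : ∀ x, f x = g x) : K.map f.op σ = K.map g.op σ := by
  obtain rfl : f = g := by
    apply SimplexCategory.Hom.ext
    ext x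
    exact congrArg _ (h x)
  rfl

/-- The edge `σ([0 i])` of a simplex `σ`, as an edge from `σ(0)` to `σ(i) = y`. -/
def edgeTo {l : SimplexCategoryᵒᵖ} (σ : K.obj l) (i : Fin (l.unop.len + 1)) {y : K _⦋0⦌}
    (hy : y = vertex σ i) : SSet.Edge (vertex σ 0) y :=
  SSet.Edge.mk (K.map (SimplexCategory.mkOfLe (n := l.unop.len) 0 i (Fin.zero_le i)).op σ)
    (by
      simp only [SimplicialObject.δ, vertex, ← Functor.map_comp_apply, ← op_comp]
      exact map_op_congr σ fun x => by fin_cases x; rfl)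
    (by
      subst hy
      simp only [SimplicialObject.δ, vertex, ← Functor.map_comp_apply, ← op_comp]
      exact map_op_congr σ fun x => by fin_cases x; rfl)

lemma edge_edgeTo_zero {l : SimplexCategoryᵒᵖ} (σ : K.obj l) :
    FundGroupoid.edge (edgeTo σ 0 rfl) = 𝟙 _ := by
  rw [← FundGroupoid.edge_id]
  congr 1
  apply SSet.Edge.ext
  refine Eq.trans ?_ (Functor.map_comp_apply K _ _ σ)
  refine map_op_congr σ (f := SimplexCategory.mkOfLe 0 0 (Fin.zero_le 0))
    (g := SimplexCategory.σ 0 ≫ SimplexCategory.const ⦋0⦌ l.unop 0) fun x => ?_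
  fin_cases x <;> rfl

lemma edge_edgeTo_comp {l k : SimplexCategoryᵒᵖ} (θ : l ⟶ k) (σ : K.obj l)
    (j : Fin (k.unop.len + 1)) {y : K _⦋0⦌} (hy : y = vertex (K.map θ σ) j) :
    FundGroupoid.edge (edgeTo σ (θ.unop 0) (vertex_map θ σ 0)) ≫
      FundGroupoid.edge (edgeTo (K.map θ σ) j hy) =
    FundGroupoid.edge (edgeTo σ (θ.unop j) (hy.trans (vertex_map θ σ j))) := by
  have hle : θ.unop 0 ≤ θ.unop j := θ.unop.toOrderHom.monotone (Fin.zero_le j)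
  refine FundGroupoid.edge_comp (SSet.Edge.CompStruct.mk
    (K.map (SimplexCategory.mkOfLeComp (n := l.unop.len) 0 (θ.unop 0) (θ.unop j)
      (Fin.zero_le _) hle).op σ) ?_ ?_ ?_)
  · refine (Functor.map_comp_apply K _ _ σ).symm.trans ?_
    refine map_op_congr σ (f := SimplexCategory.δ 2 ≫ _) fun x => ?_
    fin_cases x <;> rfl
  · refine (Functor.map_comp_apply K _ _ σ).symm.trans
      (Eq.trans ?_ (Functor.map_comp_apply K _ _ σ))
    refine map_op_congr σ (f := SimplexCategory.δ 0 ≫ _)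
      (g := SimplexCategory.mkOfLe 0 j (Fin.zero_le j) ≫ θ.unop) fun x => ?_
    fin_cases x <;> rfl
  · refine (Functor.map_comp_apply K _ _ σ).symm.trans ?_
    refine map_op_congr σ (f := SimplexCategory.δ 1 ≫ _) fun x => ?_
    fin_cases x <;> rfl

/-- The value `E(x)` of a local system at a vertex. -/
abbrev LocalSystem.at (E : LocalSystem.{u, w} K) (x : K _⦋0⦌) : AddCommGrpCat.{w} :=
  E.obj (op (FundGroupoid.vert x))

/-- The inverse `E(σ([0 i]))⁻¹ : E(σ(0)) ⟶ E(σ(i))`, where `y = σ(i)`. -/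
noncomputable def LocalSystem.transport (E : LocalSystem.{u, w} K) {l : SimplexCategoryᵒᵖ}
    (σ : K.obj l) (i : Fin (l.unop.len + 1)) {y : K _⦋0⦌} (hy : y = vertex σ i) :
    E.at (vertex σ 0) ⟶ E.at y :=
  inv (E.map (FundGroupoid.edge (edgeTo σ i hy)).op)

lemma LocalSystem.transport_zero (E : LocalSystem.{u, w} K) {l : SimplexCategoryᵒᵖ}
    (σ : K.obj l) : E.transport σ 0 rfl = 𝟙 _ := by
  simp [transport, edge_edgeTo_zero]

lemma LocalSystem.transport_comp (E : LocalSystem.{u, w} K) {l k : SimplexCategoryᵒᵖ}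
    (θ : l ⟶ k) (σ : K.obj l) (j : Fin (k.unop.len + 1)) {y : K _⦋0⦌}
    (hy : y = vertex (K.map θ σ) j) :
    E.transport σ (θ.unop 0) (vertex_map θ σ 0) ≫ E.transport (K.map θ σ) j hy =
      E.transport σ (θ.unop j) (hy.trans (vertex_map θ σ j)) := by
  simp only [transport, ← edge_edgeTo_comp θ σ j hy, op_comp, Functor.map_comp, IsIso.inv_comp]

variable (E : LocalSystem.{u, w} K) (A : K.Subcomplex)

/-- The group `⨁_σ E(σ(0))` of chains `∑ a σ` with `σ` a simplex of `A` and `a ∈ E(σ(0))`. -/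
abbrev ChainGroup (l : SimplexCategoryᵒᵖ) : Type (max u w) :=
  DirectSum (A.obj l) fun σ => E.at (vertex σ.1 0)

open Classical in
/-- The chain `a σ`. -/
noncomputable def single {l : SimplexCategoryᵒᵖ} (σ : A.obj l) :
    E.at (vertex σ.1 0) →+ ChainGroup E A l :=
  DirectSum.of (fun σ : A.obj l => E.at (vertex σ.1 0)) σ

variable {E A} in
lemma chainGroup_hom_ext {l : SimplexCategoryᵒᵖ} {G : Type*} [AddCommGroup G]
    {f g : ChainGroup E A l →+ G} (h : ∀ σ a, f (single E A σ a) = g (single E A σ a)) : f = g := by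
  classical
  refine DirectSum.addHom_ext fun σ a => Eq.trans ?_ ((h σ a).trans ?_)
  · congr! 1
  · congr! 1

variable {E A} in
lemma single_transport_congr {l k : SimplexCategoryᵒᵖ} (σ : K.obj l) {i j : Fin (l.unop.len + 1)}
    (hij : i = j) {τ τ' : A.obj k} (h : τ = τ') (hi : vertex τ.1 0 = vertex σ i)
    (hj : vertex τ'.1 0 = vertex σ j) (a : E.at (vertex σ 0)) :
    single E A τ (E.transport σ i hi a) = single E A τ' (E.transport σ j hj a) := by
  subst h hij
  rfl

open Classical in
/-- The map `a σ ↦ E(σ([0 θ(0)]))⁻¹(a) θ^*σ` on chains induced by a simplicial operator `θ`. -/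
noncomputable def chainGroupMap {l k : SimplexCategoryᵒᵖ} (θ : l ⟶ k) :
    ChainGroup E A l →+ ChainGroup E A k :=
  DirectSum.toAddMonoid fun σ : A.obj l =>
    (single E A ⟨K.map θ σ.1, A.map θ σ.2⟩).comp
      (E.transport σ.1 (θ.unop 0) (vertex_map θ σ.1 0)).hom

lemma chainGroupMap_single {l k : SimplexCategoryᵒᵖ} (θ : l ⟶ k) (σ : A.obj l)
    (a : E.at (vertex σ.1 0)) :
    chainGroupMap E A θ (single E A σ a) = single E A ⟨K.map θ σ.1, A.map θ σ.2⟩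
      (E.transport σ.1 (θ.unop 0) (vertex_map θ σ.1 0) a) := by
  classical
  simp only [chainGroupMap, single]
  rw [DirectSum.toAddMonoid_of]
  rfl

/-- The simplicial abelian group of chains on `A` with coefficients in `E`. -/
noncomputable def simplicialChains : SimplicialObject AddCommGrpCat.{max u w} where
  obj l := AddCommGrpCat.of (ChainGroup E A l)
  map θ := AddCommGrpCat.ofHom (chainGroupMap E A θ)
  map_id l := by
    ext1
    refine chainGroup_hom_ext fun σ a => ?_
    refine (chainGroupMap_single E A (𝟙 l) σ a).trans ?_
    refine (single_transport_congr σ.1 (j := 0) rfl (τ' := σ)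
      (Subtype.ext (Functor.map_id_apply K l σ.1)) _ rfl a).trans ?_
    rw [E.transport_zero]
    rfl
  map_comp θ ψ := by
    ext1
    refine chainGroup_hom_ext fun σ a => ?_
    refine (chainGroupMap_single E A (θ ≫ ψ) σ a).trans ?_
    symm
    refine (congrArg (chainGroupMap E A ψ) (chainGroupMap_single E A θ σ a)).trans ?_
    rw [chainGroupMap_single]
    have h := E.transport_comp θ σ.1 (ψ.unop 0) (vertex_map ψ (K.map θ σ.1) 0)
    have h' := ConcreteCategory.congr_hom h a
    refine (congrArg _ h').trans ?_
    exact single_transport_congr σ.1 rfl (Subtype.ext (Functor.map_comp_apply _ _ _ _).symm) _ _ a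

/-- The chain complex `C_*(A; E)` of a subcomplex `A` of `K`, for a local system `E` on `K`.
Its differential is `∂(a σ) = ∑_{i ≥ 1} (-1)ⁱ a ∂ᵢσ + E(σ([0 1]))⁻¹(a) ∂₀σ`. -/
noncomputable def chains : ChainComplex AddCommGrpCat.{max u w} ℕ :=
  (AlgebraicTopology.alternatingFaceMapComplex _).obj (simplicialChains E A)

/-- The differential of `a σ`; in the summand for `i ≥ 1`, the transport is along the degenerate
edge at `σ(0)`, hence it is the identity by `transport_zero`. -/
lemma chains_d_single (j : ℕ) (σ : A.obj (op ⦋j + 1⦌)) (a : E.at (vertex σ.1 0)) :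
    ((chains E A).d (j + 1) j).hom (single E A σ a) =
      ∑ i : Fin (j + 2), (-1 : ℤ) ^ (i : ℕ) •
        single E A ⟨K.map (SimplexCategory.δ i).op σ.1, A.map _ σ.2⟩
          (E.transport σ.1 (SimplexCategory.δ i 0) (vertex_map (SimplexCategory.δ i).op σ.1 0)
            a) := by
  have hd : ((chains E A).d (j + 1) j).hom = ∑ i : Fin (j + 2), (-1 : ℤ) ^ (i : ℕ) •
      chainGroupMap E A (SimplexCategory.δ i).op := by
    simp only [chains, AlgebraicTopology.alternatingFaceMapComplex_obj_d,
      AlgebraicTopology.AlternatingFaceMapComplex.objD]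
    exact map_sum (AddCommGrpCat.homAddEquiv (M := AddCommGrpCat.of (ChainGroup E A (op ⦋j + 1⦌)))
      (N := AddCommGrpCat.of (ChainGroup E A (op ⦋j⦌)))) _ _
  refine (DFunLike.congr_fun hd _).trans ((AddMonoidHom.finsetSum_apply _ _ _).trans ?_)
  refine Finset.sum_congr rfl fun i _ => ?_
  exact congrArg (fun z => (-1 : ℤ) ^ (i : ℕ) • z)
    (chainGroupMap_single E A (SimplexCategory.δ i).op σ a)

variable {A} {B : K.Subcomplex}

open Classical in
/-- The inclusion of chain groups for `A ≤ B`. -/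
noncomputable def chainGroupIncl (h : A ≤ B) (l : SimplexCategoryᵒᵖ) :
    ChainGroup E A l →+ ChainGroup E B l :=
  DirectSum.toAddMonoid fun σ : A.obj l => single E B ⟨σ.1, h l σ.2⟩

lemma chainGroupIncl_single (h : A ≤ B) {l : SimplexCategoryᵒᵖ} (σ : A.obj l)
    (a : E.at (vertex σ.1 0)) :
    chainGroupIncl E h l (single E A σ a) = single E B ⟨σ.1, h l σ.2⟩ a := by
  classical
  simp only [chainGroupIncl, single]
  rw [DirectSum.toAddMonoid_of]

/-- The inclusion of the simplicial abelian groups of chains for `A ≤ B`. -/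
noncomputable def simplicialChainsMap (h : A ≤ B) :
    simplicialChains E A ⟶ simplicialChains E B where
  app l := AddCommGrpCat.ofHom (chainGroupIncl E h l)
  naturality l k θ := by
    ext1
    refine chainGroup_hom_ext fun σ a => ?_
    refine (congrArg (chainGroupIncl E h k) (chainGroupMap_single E A θ σ a)).trans ?_
    rw [chainGroupIncl_single]
    symm
    refine (congrArg (chainGroupMap E B θ) (chainGroupIncl_single E h σ a)).trans ?_
    rw [chainGroupMap_single]

/-- The chain map `C_*(A; E) ⟶ C_*(B; E)` induced by an inclusion `A ≤ B`. -/
noncomputable def chainsMap (h : A ≤ B) : chains E A ⟶ chains E B :=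
  (AlgebraicTopology.alternatingFaceMapComplex _).map (simplicialChainsMap E h)

lemma chainsMap_single (h : A ≤ B) (j : ℕ) (σ : A.obj (op ⦋j⦌)) (a : E.at (vertex σ.1 0)) :
    ((chainsMap E h).f j).hom (single E A σ a) = single E B ⟨σ.1, h _ σ.2⟩ a :=
  chainGroupIncl_single E h σ a

lemma chainsMap_comp {C : K.Subcomplex} (h : A ≤ B) (h' : B ≤ C) :
    chainsMap E h ≫ chainsMap E h' = chainsMap E (h.trans h') := by
  have hc : simplicialChainsMap E h ≫ simplicialChainsMap E h' =
      simplicialChainsMap E (h.trans h') := by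
    refine NatTrans.ext (funext fun l => ?_)
    ext1
    refine chainGroup_hom_ext fun σ a => ?_
    refine (congrArg (chainGroupIncl E h' l) (chainGroupIncl_single E h σ a)).trans ?_
    exact (chainGroupIncl_single E h' ⟨σ.1, h l σ.2⟩ a).trans (chainGroupIncl_single E (h.trans h') σ a).symm
  rw [chainsMap, chainsMap, chainsMap, ← hc]
  exact (Functor.map_comp _ _ _).symm

/-- The complex `C_*(B; E) / C_*(A; E)` of relative chains of a pair `A ≤ B`. -/
noncomputable def relChains (h : A ≤ B) : ChainComplex AddCommGrpCat.{max u w} ℕ :=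
  Limits.cokernel (chainsMap E h)

/-- The map on relative chains induced by an inclusion of pairs `(B, A) ≤ (B', A')`. -/
noncomputable def relChainsMap {A' B' : K.Subcomplex} (h : A ≤ B) (h' : A' ≤ B')
    (hA : A ≤ A') (hB : B ≤ B') : relChains E h ⟶ relChains E h' :=
  Limits.cokernel.map _ _ (chainsMap E hA) (chainsMap E hB)
    ((chainsMap_comp E h hB).trans (chainsMap_comp E hA h').symm)

/-- `c` is the homology class of the cycle `z`. -/
def IsClassOf (C : ChainComplex AddCommGrpCat.{w} ℕ) {j : ℕ} (c : C.homology j) (z : C.X j) :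
    Prop :=
  ∃ y : C.cycles j, (C.iCycles j).hom y = z ∧ (C.homologyπ j).hom y = c

end LocalCoefficients
/-! ### Filtered spaces and perversities -/

/-- A filtration of formal dimension `n` of a topological space by closed subsets
`X₀ ⊆ X₁ ⊆ ⋯ ⊆ Xₙ = X`. That the regular part `X \ Xₙ₋₁` is nonempty is not required, so that
every open subset carries an induced filtration. -/
structure Filtration (X : Type u) [TopologicalSpace X] (n : ℕ) where
  /-- the skeleta -/
  skel : Fin (n + 1) → Set X
  isClosed_skel : ∀ i, IsClosed (skel i)
  monotone_skel : Monotone skel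
  skel_last : skel (Fin.last n) = Set.univ

variable {X : Type u} [TopologicalSpace X] {n : ℕ}

namespace Filtration

/-- The difference `Xⁱ = Xᵢ \ Xᵢ₋₁` of consecutive skeleta (with `X₋₁ = ∅`). -/
def part (F : Filtration X n) (i : Fin (n + 1)) : Set X := F.skel i \ ⋃ j < i, F.skel j

/-- The strata: the pairs of a dimension `i` and a connected component of the subspace `Xⁱ`. -/
def Stratum (F : Filtration X n) : Type u := Σ i : Fin (n + 1), ConnectedComponents (F.part i)

namespace Stratum

variable {F : Filtration X n}

/-- The subset of `X` underlying a stratum. -/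
def carrier (S : F.Stratum) : Set X :=
  (Subtype.val : F.part S.1 → X) '' (ConnectedComponents.mk ⁻¹' {S.2})

/-- The formal codimension of a stratum. -/
def codim (S : F.Stratum) : ℤ := (n : ℤ) - (S.1 : ℕ)

/-- The regular strata are those contained in `Xₙ \ Xₙ₋₁`. -/
def IsRegular (S : F.Stratum) : Prop := S.1 = Fin.last n

end Stratum

/-- Locally finite stratification: every point has a neighborhood
that meets only finitely many strata. -/
def LocallyFiniteStratification (F : Filtration X n) : Prop :=
  LocallyFinite (Stratum.carrier (F := F))

/-- The filtration induced on a subspace. -/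
def restrict (F : Filtration X n) (W : Set X) : Filtration W n where
  skel i := Subtype.val ⁻¹' F.skel i
  isClosed_skel i := (F.isClosed_skel i).preimage continuous_subtype_val
  monotone_skel _ _ h := Set.preimage_mono (F.monotone_skel h)
  skel_last := by rw [F.skel_last, Set.preimage_univ]

lemma restrict_part (F : Filtration X n) (W : Set X) (i : Fin (n + 1)) :
    (F.restrict W).part i = Subtype.val ⁻¹' F.part i := by
  simp [part, restrict, Set.preimage_iUnion]

/-- The stratum of `X` that contains a given stratum of the subspace `W`. -/
def ambientStratum (F : Filtration X n) (W : Set X) (T : (F.restrict W).Stratum) : F.Stratum :=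
  ⟨T.1, Continuous.connectedComponentsMap
    (f := fun x : (F.restrict W).part T.1 =>
      (⟨x.1.1, (F.restrict_part W T.1 ▸ x.2 : x.1 ∈ Subtype.val ⁻¹' F.part T.1)⟩ : F.part T.1))
    (by fun_prop) T.2⟩

lemma exists_mem_carrier (F : Filtration X n) (x : X) : ∃ S : F.Stratum, x ∈ S.carrier := by
  have hne : ∃ k, ∃ h : k < n + 1, x ∈ F.skel ⟨k, h⟩ :=
    ⟨n, Nat.lt_succ_self n, by
      have h := F.skel_last
      exact h ▸ Set.mem_univ x⟩
  classical
  obtain ⟨hk, hx⟩ := Nat.find_spec hne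
  have hp : x ∈ F.part ⟨Nat.find hne, hk⟩ := by
    refine ⟨hx, ?_⟩
    simp only [Set.mem_iUnion, not_exists]
    intro j hj hxj
    exact Nat.find_min hne (Fin.lt_def.1 hj) ⟨j.2, hxj⟩
  exact ⟨⟨_, ConnectedComponents.mk ⟨x, hp⟩⟩, ⟨x, hp⟩, rfl, rfl⟩

lemma stratum_eq_of_mem (F : Filtration X n) {S T : F.Stratum} {x : X} (hS : x ∈ S.carrier)
    (hT : x ∈ T.carrier) : S = T := by
  obtain ⟨i, c⟩ := S
  obtain ⟨j, d⟩ := T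
  obtain ⟨⟨x, hx⟩, hc, rfl⟩ := hS
  obtain ⟨⟨y, hy⟩, hd, hyx⟩ := hT
  obtain rfl : y = x := hyx
  have hij : i = j := by
    rcases lt_trichotomy i j with h | h | h
    · exact absurd (Set.mem_iUnion₂.2 ⟨i, h, hx.1⟩) hy.2
    · exact h
    · exact absurd (Set.mem_iUnion₂.2 ⟨j, h, hy.1⟩) hx.2
  subst hij
  have hcd : c = d := hc.symm.trans hd
  rw [hcd]

lemma mem_ambientStratum (F : Filtration X n) {W : Set X} {T : (F.restrict W).Stratum} {x : W}
    (hx : x ∈ T.carrier) : x.1 ∈ (F.ambientStratum W T).carrier := by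
  obtain ⟨⟨x, hx⟩, hc, rfl⟩ := hx
  refine ⟨⟨x.1, (F.restrict_part W T.1 ▸ hx : x ∈ Subtype.val ⁻¹' F.part T.1)⟩, ?_, rfl⟩
  have hc' : ConnectedComponents.mk ⟨x, hx⟩ = T.2 := hc
  simp only [ambientStratum, ← hc']
  rfl

end Filtration

/-- A perversity: a map from the set of strata to `ℤ ∪ {±∞}` that vanishes on regular strata. -/
structure Perversity (F : Filtration X n) where
  /-- the underlying map -/
  toFun : F.Stratum → ExtInt
  map_regular : ∀ S : F.Stratum, S.IsRegular → toFun S = 0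

namespace Perversity

variable {F : Filtration X n} (p : Perversity F)

/-- The perversity induced on a subspace with the induced filtration. -/
def restrict (W : Set X) : Perversity (F.restrict W) where
  toFun T := p.toFun (F.ambientStratum W T)
  map_regular _ hT := p.map_regular _ hT

/-- A singular simplex `σ : Δˡ → X` is allowable if `dim σ⁻¹S ≤ l - codim S + p(S)` for every
singular stratum `S`. -/
def Allowable {l : ℕ} (σ : C(stdSimplex ℝ (Fin (l + 1)), X)) : Prop :=
  ∀ S : F.Stratum, ¬ S.IsRegular →
    PolyDimLE (Subtype.val '' (σ ⁻¹' S.carrier)) (toExt ((l : ℤ) - S.codim) + p.toFun S)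

/-- The singular simplex `Δˡ → X` (a continuous map) underlying an `l`-simplex of `Sing X`. -/
noncomputable def singMap {l : SimplexCategoryᵒᵖ} (σ : (TopCat.toSSet.obj (TopCat.of X)).obj l) :
    C(stdSimplex ℝ (Fin (l.unop.len + 1)), X) :=
  TopCat.toSSetObjEquiv (TopCat.of X) l σ

lemma singMap_map {k l : SimplexCategoryᵒᵖ} (θ : k ⟶ l)
    (σ : (TopCat.toSSet.obj (TopCat.of X)).obj k) (x : stdSimplex ℝ (Fin (l.unop.len + 1))) :
    singMap ((TopCat.toSSet.obj (TopCat.of X)).map θ σ) x =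
      singMap σ (stdSimplex.map θ.unop x) := rfl

/-- A singular simplex is full if all its faces (itself included) are allowable. -/
def Full {l : SimplexCategoryᵒᵖ} (σ : (TopCat.toSSet.obj (TopCat.of X)).obj l) : Prop :=
  ∀ (k : SimplexCategory) (θ : k ⟶ l.unop), Mono θ →
    p.Allowable (singMap ((TopCat.toSSet.obj (TopCat.of X)).map θ.op σ))

lemma allowable_of_epi {k l : SimplexCategory} (θ : k ⟶ l) (hθ : Epi θ)
    (σ : (TopCat.toSSet.obj (TopCat.of X)).obj (op l)) (hσ : p.Allowable (singMap σ)) :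
    p.Allowable (singMap ((TopCat.toSSet.obj (TopCat.of X)).map θ.op σ)) := by
  intro S hS
  have hsurj : Function.Surjective
      (FunOnFinite.linearMap ℝ ℝ (θ : Fin (k.len + 1) → Fin (l.len + 1))) := by
    have hθ' : Function.Surjective (θ : Fin (k.len + 1) → Fin (l.len + 1)) :=
      SimplexCategory.epi_iff_surjective.1 hθ
    obtain ⟨r, hr⟩ := hθ'.hasRightInverse
    intro y
    refine ⟨FunOnFinite.linearMap ℝ ℝ r y, ?_⟩
    have h := congrArg (fun g => g y) (FunOnFinite.linearMap_comp ℝ ℝ r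
      (θ : Fin (k.len + 1) → Fin (l.len + 1)))
    have h' : (θ : Fin (k.len + 1) → Fin (l.len + 1)) ∘ r = id := funext hr
    rw [h'] at h
    simpa using h.symm
  have := (hσ S hS).preimage _ hsurj
  rw [← add_assoc] at this
  have e : toExt (((k.len + 1 : ℕ) : ℤ) - ((l.len + 1 : ℕ) : ℤ)) +
      toExt ((((op l).unop.len : ℕ) : ℤ) - S.codim) = toExt ((k.len : ℤ) - S.codim) := by
    change toExt (_ + _) = _
    congr 1
    push_cast
    ring
  rw [e] at this
  refine this.mono ?_
  rintro _ ⟨x, hx, rfl⟩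
  exact ⟨x.2, ⟨stdSimplex.map θ x, hx, rfl⟩⟩

/-- The Gajer space of a perverse space: the simplicial set of its full singular simplices. -/
noncomputable def gajer : (TopCat.toSSet.obj (TopCat.of X)).Subcomplex where
  obj l := {σ | p.Full σ}
  map {l l'} θ σ hσ := by
    intro k ι hι
    obtain ⟨q, e, μ, he, hμ, hfac⟩ : ∃ (q : SimplexCategory) (e : k ⟶ q) (μ : q ⟶ l.unop),
        Epi e ∧ Mono μ ∧ e ≫ μ = ι ≫ θ.unop :=
      ⟨_, Limits.factorThruImage _, Limits.image.ι _, inferInstance, inferInstance,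
        Limits.image.fac _⟩
    have h := p.allowable_of_epi e he _ (hσ q μ hμ)
    have e1 : (TopCat.toSSet.obj (TopCat.of X)).map e.op
        ((TopCat.toSSet.obj (TopCat.of X)).map μ.op σ) =
        (TopCat.toSSet.obj (TopCat.of X)).map ι.op
          ((TopCat.toSSet.obj (TopCat.of X)).map θ σ) := by
      rw [← Functor.map_comp_apply, ← Functor.map_comp_apply, ← op_comp, hfac, op_comp,
        Quiver.Hom.op_unop]
    rw [e1] at h
    exact h

/-- The simplicial subset of the Gajer space of `X` of the full simplices with image in a
subspace `W`. For `W` open (with locally finite induced stratification) it is the Gajer space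
of `W` with the induced filtration and perversity, by `full_restrict_iff` below. -/
noncomputable def gajerIn (W : Set X) : (p.gajer : SSet.{u}).Subcomplex where
  obj _ := {σ | ∀ x, singMap σ.1 x ∈ W}
  map θ _ hσ := fun x => hσ (stdSimplex.map θ.unop x)

lemma gajerIn_univ : p.gajerIn Set.univ = ⊤ :=
  le_antisymm le_top fun _ _ _ _ => Set.mem_univ _

lemma gajerIn_mono {W W' : Set X} (h : W ⊆ W') : p.gajerIn W ≤ p.gajerIn W' :=
  fun _ _ hσ x => h (hσ x)

/-- The full simplices whose image is contained in some member of a family of subspaces. -/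
noncomputable def gajerSmall (𝒰 : Set (Set X)) : (p.gajer : SSet.{u}).Subcomplex where
  obj _ := {σ | ∃ U ∈ 𝒰, ∀ x, singMap σ.1 x ∈ U}
  map θ _ hσ := by
    obtain ⟨U, hU, h⟩ := hσ
    exact ⟨U, hU, fun x => h (stdSimplex.map θ.unop x)⟩

lemma gajerSmall_le (𝒰 : Set (Set X)) : p.gajerSmall 𝒰 ≤ p.gajerIn Set.univ :=
  fun _ _ _ _ => Set.mem_univ _

lemma allowable_restrict_iff (W : Set X) (hW : (F.restrict W).LocallyFiniteStratification)
    {l : ℕ} (σ : C(stdSimplex ℝ (Fin (l + 1)), W)) :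
    (p.restrict W).Allowable σ ↔
      p.Allowable ((⟨Subtype.val, continuous_subtype_val⟩ : C(W, X)).comp σ) := by
  constructor
  · intro h S hS
    have hfin : Set.Finite {T | (T.carrier ∩ Set.range σ).Nonempty ∧ F.ambientStratum W T = S} :=
      (hW.finite_nonempty_inter_compact (isCompact_range σ.continuous)).subset fun _ hT => hT.1
    refine (PolyDimLE.biUnion hfin
      (A := fun T => Subtype.val '' (σ ⁻¹' T.carrier)) (fun T hT => ?_)).mono ?_
    · obtain ⟨-, rfl⟩ := hT
      exact h T hS
    · rintro _ ⟨x, hx, rfl⟩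
      obtain ⟨T, hT⟩ := (F.restrict W).exists_mem_carrier (σ x)
      exact Set.mem_biUnion (x := T)
        ⟨⟨_, hT, x, rfl⟩, F.stratum_eq_of_mem (F.mem_ambientStratum hT) hx⟩ ⟨x, hT, rfl⟩
  · intro h T hT
    refine (h (F.ambientStratum W T) hT).mono ?_
    rintro _ ⟨x, hx, rfl⟩
    exact ⟨x, F.mem_ambientStratum hx, rfl⟩

/-- For an open subset (or any subspace) whose induced stratification is locally finite, `gajerIn`
consists of the simplices of the Gajer space of the subspace with its induced filtration and perversity. -/
lemma full_restrict_iff (W : Set X) (hW : (F.restrict W).LocallyFiniteStratification)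
    {l : SimplexCategoryᵒᵖ} (τ : (TopCat.toSSet.obj (TopCat.of W)).obj l) :
    (p.restrict W).Full τ ↔
      p.Full ((TopCat.toSSet.map (TopCat.ofHom ⟨Subtype.val, continuous_subtype_val⟩)).app l τ) :=
  forall_congr' fun _ => forall_congr' fun _ => forall_congr' fun _ =>
    p.allowable_restrict_iff W hW _

/-! ### Homology of Gajer spaces with local coefficients -/

variable (E : LocalSystem.{u, w} (p.gajer : SSet.{u}))

/-- The complex of chains on the Gajer space of a subspace `W`, with coefficients in (the
restriction of) a local system `E` on the Gajer space of `X`. -/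
noncomputable abbrev gajerChains (W : Set X) : ChainComplex AddCommGrpCat.{max u w} ℕ :=
  chains E (p.gajerIn W)

/-- The chain map induced by an inclusion of subspaces. -/
noncomputable abbrev gajerChainsMap {W W' : Set X} (h : W ⊆ W') :
    p.gajerChains E W ⟶ p.gajerChains E W' :=
  chainsMap E (p.gajerIn_mono h)

/-- The homology `H_j(𝒢_p W; E)`. -/
noncomputable abbrev gajerHomology (W : Set X) (j : ℕ) : AddCommGrpCat.{max u w} :=
  (p.gajerChains E W).homology j

/-- The homomorphism `H_j(𝒢_p W; E) ⟶ H_j(𝒢_p W'; E)` induced by an inclusion. -/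
noncomputable abbrev gajerHomologyMap {W W' : Set X} (h : W ⊆ W') (j : ℕ) :
    p.gajerHomology E W j ⟶ p.gajerHomology E W' j :=
  HomologicalComplex.homologyMap (p.gajerChainsMap E h) j

/-- The relative homology `H_j(𝒢_p W, 𝒢_p A; E)` of a pair `A ⊆ W` of subspaces. -/
noncomputable abbrev gajerRelHomology {A W : Set X} (h : A ⊆ W) (j : ℕ) :
    AddCommGrpCat.{max u w} :=
  (relChains E (p.gajerIn_mono h)).homology j

/-- The homomorphism `H_j(𝒢_p W, 𝒢_p A; E) ⟶ H_j(𝒢_p W', 𝒢_p A'; E)` induced by an inclusion of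
pairs. -/
noncomputable abbrev gajerRelHomologyMap {A W A' W' : Set X} (h : A ⊆ W) (h' : A' ⊆ W')
    (hA : A ⊆ A') (hW : W ⊆ W') (j : ℕ) :
    p.gajerRelHomology E h j ⟶ p.gajerRelHomology E h' j :=
  HomologicalComplex.homologyMap
    (relChainsMap E (p.gajerIn_mono h) (p.gajerIn_mono h') (p.gajerIn_mono hA)
      (p.gajerIn_mono hW)) j

end Perversity
end PerverseSpace

namespace PerverseSpace

/-! ### Generic points and cones -/

/-! The classical argument subdivides chains until they are small, but barycentric subdivision does
not preserve fullness: a barycenter, or a simplex spanned by barycenters, may meet the preimage of a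
singular stratum in too large a dimension. The remedy is to cone off points in general position
instead of barycenters.

General position. For a full simplex `σ`, local finiteness and compactness leave finitely many
strata that meet its image, and the preimage of each singular one lies in finitely many convex
cells. Given finitely many full affine simplices of `σ`, a point `b` that avoids finitely many
proper linear subspaces (sums of the span of a cell and the span of some of the vertices) makes all
the cones with apex `b` full. A cell is either transverse to the cone, so that the dimension of its
preimage is the expected one, or it meets the cone only in the base. This is `PolyDimLE.cone` and
`exists_cone_point`. Since only a null set is excluded, all barycentric coordinates of `b` can also
be kept above a constant that depends only on the dimension.

Coefficients. A coefficient at `σ(0)` must be moved to the first vertex of each simplex of the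
subdivision, although the straight segment between the two points need not be full. The canonical
path `affPath` goes through a generic point, and coning once more shows that the choice of this
point is irrelevant (`pathVia_eq`). These paths compose, agree with full affine edges, and are
compatible with restriction to full affine subsimplices. Hence formal identities between tuples of
points carry over to chains with local coefficients (`boundary_affChains`, `affChains_face`).

Subdivision. By induction on the dimension, the subdivision of `σ` is the cone on the subdivided
boundary, and the homotopy from the identity is the cone on `σ` minus the homotopy of the boundary.
The point is chosen separately for each `σ`; the faces of `σ` keep the subdivisions already chosen
for them, which is what makes the operator a chain map. The lower bound on the coordinates of `b`
makes each subdivision shrink distances by a fixed factor smaller than 1 (`subdivision_contract`),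
so iterates become small by the Lebesgue number lemma.

Conclusion. Every chain with small boundary is homologous to a small chain
(`exists_small_homologous`), where it suffices that the interiors of the members of the covering
cover the space. The three statements follow by homological algebra: an injective chain map with
this property (`isIso_homologyMap_of_injective`), a square of complexes (`ExcisiveSquare`), and a
map of quotient complexes (`isIso_homologyMap_cokernel_map`). -/

lemma exists_generic_mem_stdSimplex {n : ℕ} (hn : 0 < n) {𝒲 : Set (Submodule ℝ (Fin n → ℝ))}
    (h𝒲 : 𝒲.Finite) (htop : ∀ W ∈ 𝒲, W ≠ ⊤) :
    ∃ b ∈ stdSimplex ℝ (Fin n), (∀ i, 1 / ((n : ℝ) + 1) ≤ b i) ∧ ∀ W ∈ 𝒲, b ∉ W := by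
  -- The simplex itself is null in `ℝⁿ`, so the measure argument takes place in the open cone over
  -- the part of the simplex with all coordinates above `1 / (n + 1)`. This part contains the
  -- barycenter, whose coordinates are `1 / n`. Rescaling at the end is harmless because the
  -- subspaces to avoid are linear.
  let O : Set (Fin n → ℝ) := {v | ∀ i, (∑ j, v j) / ((n : ℝ) + 1) < v i}
  have hO : IsOpen O := by
    simp only [O, Set.ofPred_forall]
    exact isOpen_iInter_of_finite fun i => isOpen_lt (by fun_prop) (by fun_prop)
  have hn1 : (0 : ℝ) < (n : ℝ) + 1 := by positivity
  have hne : O.Nonempty := by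
    refine ⟨fun _ => 1, fun i => ?_⟩
    simp [div_lt_one hn1]
  have hnull : MeasureTheory.volume (⋃ W ∈ 𝒲, (W : Set (Fin n → ℝ))) = 0 := by
    rw [MeasureTheory.measure_biUnion_null_iff h𝒲.countable]
    exact fun W hW => MeasureTheory.Measure.addHaar_submodule _ W (htop W hW)
  have hpos := hO.measure_pos MeasureTheory.volume hne
  obtain ⟨v, hvO, hv⟩ : ∃ v ∈ O, v ∉ ⋃ W ∈ 𝒲, (W : Set (Fin n → ℝ)) := by
    by_contra! hcon
    exact hpos.ne' (MeasureTheory.measure_mono_null (fun v hv => hcon v hv) hnull)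
  have hs : 0 < ∑ j, v j := by
    have : ∑ i : Fin n, (∑ j, v j) / ((n : ℝ) + 1) < ∑ i, v i :=
      Finset.sum_lt_sum_of_nonempty ⟨⟨0, hn⟩, Finset.mem_univ _⟩ fun i _ => hvO i
    rw [Finset.sum_const, Finset.card_univ, Fintype.card_fin, nsmul_eq_mul, ← mul_div_assoc,
      div_lt_iff₀ hn1] at this
    linarith
  refine ⟨(∑ j, v j)⁻¹ • v, ⟨fun i => ?_, ?_⟩, fun i => ?_, fun W hW hbW => hv ?_⟩
  · have h1 : 0 < v i := (by positivity : 0 < (∑ j, v j) / ((n : ℝ) + 1)).trans (hvO i)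
    simp only [Pi.smul_apply, smul_eq_mul]
    positivity
  · simp only [Pi.smul_apply, smul_eq_mul, ← Finset.mul_sum]
    exact inv_mul_cancel₀ hs.ne'
  · have h1 := hvO i
    simp only [Pi.smul_apply, smul_eq_mul]
    rw [div_lt_iff₀ hn1] at h1
    rw [div_le_iff₀ hn1, mul_assoc, ← div_eq_inv_mul, le_div_iff₀ hs]
    linarith
  · simp only [Set.mem_iUnion, SetLike.mem_coe]
    refine ⟨W, hW, ?_⟩
    have := W.smul_mem (∑ j, v j) hbW
    rwa [smul_smul, mul_inv_cancel₀ hs.ne', one_smul] at this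

lemma PolyDimLE.empty {m : ℕ} (d : ExtInt) : PolyDimLE (∅ : Set (Fin m → ℝ)) d :=
  ⟨∅, Set.finite_empty, by simp, by simp⟩

lemma PolyDimLE.union {m : ℕ} {A B : Set (Fin m → ℝ)} {d : ExtInt} (hA : PolyDimLE A d)
    (hB : PolyDimLE B d) : PolyDimLE (A ∪ B) d := by
  refine (PolyDimLE.biUnion (s := (Set.univ : Set Bool)) Set.finite_univ
    (A := fun i => bif i then A else B) (d := d) ?_).mono ?_
  · rintro (_ | _) -
    · exact hB
    · exact hA
  · rintro x (hx | hx)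
    · exact Set.mem_biUnion (Set.mem_univ true) hx
    · exact Set.mem_biUnion (Set.mem_univ false) hx

lemma PolyDimLE.of_isConvexCell {m : ℕ} {C : Set (Fin m → ℝ)} {d : ExtInt} (hC : IsConvexCell C)
    (hd : C.Nonempty → toExt (Module.finrank ℝ (vectorSpan ℝ C) : ℤ) ≤ d) : PolyDimLE C d := by
  rcases C.eq_empty_or_nonempty with rfl | hne
  · exact PolyDimLE.empty d
  · exact ⟨{C}, Set.finite_singleton C, by simpa using ⟨hC, hne, hd hne⟩, by simp⟩

lemma toExt_mono {a b : ℤ} (h : a ≤ b) : toExt a ≤ toExt b := by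
  simpa only [toExt, WithBot.coe_le_coe, WithTop.coe_le_coe] using h

/-- The perversity value `d` may be infinite and cannot be subtracted; translating by the integer `e
- b` keeps the arithmetic away from it. -/
lemma toExt_le_shift {a b c e : ℤ} {d : ExtInt} (h : toExt a ≤ toExt b + d)
    (hac : c + b ≤ a + e) : toExt c ≤ toExt e + d := by
  calc toExt c ≤ toExt ((e - b) + a) := toExt_mono (by omega)
    _ = toExt (e - b) + toExt a := rfl
    _ ≤ toExt (e - b) + (toExt b + d) := by gcongr
    _ = toExt ((e - b) + b) + d := by rw [← add_assoc]; rfl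
    _ = toExt e + d := by rw [sub_add_cancel]

lemma finrank_span_le_vectorSpan {m : ℕ} (C : Set (Fin m → ℝ)) :
    Module.finrank ℝ (Submodule.span ℝ C) ≤ Module.finrank ℝ (vectorSpan ℝ C) + 1 := by
  rcases C.eq_empty_or_nonempty with rfl | ⟨c, hc⟩
  · rw [Submodule.span_empty, finrank_bot]
    exact Nat.zero_le _
  · have hle : Submodule.span ℝ C ≤ vectorSpan ℝ C ⊔ Submodule.span ℝ {c} := by
      rw [Submodule.span_le]
      intro x hx
      have h1 : x - c ∈ vectorSpan ℝ C := vsub_mem_vectorSpan ℝ hx hc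
      have h2 := Submodule.add_mem_sup h1 (Submodule.mem_span_singleton_self (R := ℝ) c)
      simpa using h2
    calc _ ≤ _ := Submodule.finrank_mono hle
      _ ≤ _ := Submodule.finrank_add_le_finrank_add_finrank _ _
      _ ≤ _ := by gcongr; simpa using finrank_span_le_card (R := ℝ) ({c} : Set (Fin m → ℝ))

/-- Differences of points of the simplex have coordinate sum 0, whereas the points themselves have
coordinate sum 1. This recovers the dimension lost in replacing a cell by its linear span. -/
lemma finrank_vectorSpan_lt_of_subset_stdSimplex {m : ℕ} {D : Set (Fin m → ℝ)}
    (hD : D ⊆ stdSimplex ℝ (Fin m)) (hne : D.Nonempty) {V : Submodule ℝ (Fin m → ℝ)}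
    (hV : D ⊆ V) : Module.finrank ℝ (vectorSpan ℝ D) < Module.finrank ℝ V := by
  refine Submodule.finrank_lt_finrank_of_lt (lt_of_le_of_ne ?_ ?_)
  · rw [vectorSpan_def, Submodule.span_le]
    rintro _ ⟨x, hx, y, hy, rfl⟩
    exact V.sub_mem (hV hx) (hV hy)
  · intro h
    obtain ⟨x, hx⟩ := hne
    have hx' : x ∈ vectorSpan ℝ D := h ▸ hV hx
    have hk : vectorSpan ℝ D ≤
        LinearMap.ker (∑ i, (LinearMap.proj i : (Fin m → ℝ) →ₗ[ℝ] ℝ)) := by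
      rw [vectorSpan_def, Submodule.span_le]
      rintro _ ⟨x, hx, y, hy, rfl⟩
      simp [LinearMap.sum_apply, (hD hx).2, (hD hy).2]
    have := hk hx'
    simp [LinearMap.sum_apply, (hD hx).2] at this

/-- Transversality: the composite of `f` with the projection to the quotient by `W` is surjective
with kernel the preimage of `W`, so preimage preserves codimension. -/
lemma finrank_comap_of_sup_range {k m : ℕ} (f : (Fin k → ℝ) →ₗ[ℝ] (Fin m → ℝ))
    (W : Submodule ℝ (Fin m → ℝ)) (hf : W ⊔ LinearMap.range f = ⊤) :
    Module.finrank ℝ (W.comap f) + m = Module.finrank ℝ W + k := by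
  have h1 := LinearMap.finrank_range_add_finrank_ker (W.mkQ.comp f)
  have h2 := W.finrank_quotient_add_finrank
  have hk : LinearMap.ker (W.mkQ.comp f) = W.comap f := by
    rw [LinearMap.ker_comp, Submodule.ker_mkQ]
  have hr : LinearMap.range (W.mkQ.comp f) = ⊤ := by
    rw [LinearMap.range_comp, Submodule.map_mkQ_eq_top, hf]
  rw [hk, hr, finrank_top] at h1
  simp only [Module.finrank_fin_fun] at h1 h2
  omega

/-- Requiring both `x` and its tail to lie in standard simplices forces `x 0 = 0`, so the face is
cut out by two uses of `isConvexCell_preimage`. The tail map is injective on the resulting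
directions, hence does not change the dimension. -/
lemma PolyDimLE.face_zero {q : ℕ} {A : Set (Fin q → ℝ)} {d : ExtInt} (h : PolyDimLE A d) :
    PolyDimLE {x | x ∈ stdSimplex ℝ (Fin (q + 1)) ∧ x 0 = 0 ∧ Fin.tail x ∈ A}
      d := by
  obtain ⟨𝒞, hfin, hC, hA⟩ := h
  let t : (Fin (q + 1) → ℝ) →ₗ[ℝ] (Fin q → ℝ) := LinearMap.funLeft ℝ ℝ Fin.succ
  let D : Set (Fin q → ℝ) → Set (Fin (q + 1) → ℝ) := fun C =>
    stdSimplex ℝ (Fin (q + 1)) ∩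
      t ⁻¹' (stdSimplex ℝ (Fin q) ∩ (LinearMap.id : (Fin q → ℝ) →ₗ[ℝ] _) ⁻¹' C)
  have hD0 : ∀ C, ∀ x ∈ D C, x 0 = 0 := by
    intro C x hx
    have h1 := hx.1.2
    have h2 : ∑ i, x (Fin.succ i) = 1 := hx.2.1.2
    rw [Fin.sum_univ_succ, h2] at h1
    linarith
  refine (PolyDimLE.biUnion hfin (A := D) (d := d) fun C hCC => ?_).mono ?_
  · obtain ⟨hcell, -, hd⟩ := hC C hCC
    refine PolyDimLE.of_isConvexCell
      (isConvexCell_preimage t (isConvexCell_preimage LinearMap.id hcell)) fun _ => ?_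
    refine (toExt_mono ?_).trans hd
    have h0 : vectorSpan ℝ (D C) ≤ LinearMap.ker
        (LinearMap.proj 0 : (Fin (q + 1) → ℝ) →ₗ[ℝ] ℝ) := by
      rw [vectorSpan_def, Submodule.span_le]
      rintro _ ⟨x, hx, y, hy, rfl⟩
      simp [hD0 C x hx, hD0 C y hy]
    have ht : (vectorSpan ℝ (D C)).map t ≤ vectorSpan ℝ C := by
      rw [vectorSpan_def, Submodule.map_span_le]
      rintro _ ⟨x, hx, y, hy, rfl⟩
      exact vsub_mem_vectorSpan ℝ hx.2.2 hy.2.2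
    have hinj : Function.Injective (t.domRestrict (vectorSpan ℝ (D C))) := by
      rw [← LinearMap.ker_eq_bot, LinearMap.ker_eq_bot']
      rintro ⟨x, hx⟩ hx0
      ext i
      refine Fin.cases (h0 hx) (fun j => congrFun hx0 j) i
    have h1 := LinearMap.finrank_range_of_inj hinj
    rw [LinearMap.range_domRestrict] at h1
    have h2 := Submodule.finrank_mono ht
    omega
  · rintro x ⟨hx, hx0, hxA⟩
    obtain ⟨C, hCC, hxC⟩ := hA hxA
    refine Set.mem_biUnion hCC ⟨hx, ⟨fun i => hx.1 _, ?_⟩, hxC⟩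
    have := hx.2
    rw [Fin.sum_univ_succ, hx0, zero_add] at this
    exact this

lemma linearCombination_cons {m q : ℕ} (b : Fin m → ℝ) (g : Fin q → Fin m → ℝ)
    (x : Fin (q + 1) → ℝ) :
    Fintype.linearCombination ℝ (Fin.cons b g : Fin (q + 1) → Fin m → ℝ) x =
      x 0 • b + Fintype.linearCombination ℝ g (Fin.tail x) := by
  simp [Fintype.linearCombination_apply, Fin.sum_univ_succ, Fin.tail]

/-- Coning an affine simplex `g` off a point `b` in general position adds at most one to the
dimension of the preimage of a polyhedron. -/
lemma PolyDimLE.cone {m q : ℕ} {𝒞 : Set (Set (Fin m → ℝ))} (hfin : 𝒞.Finite) {c : ℤ}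
    {d : ExtInt}
    (h𝒞 : ∀ C ∈ 𝒞, IsConvexCell C ∧ C.Nonempty ∧
      toExt (Module.finrank ℝ (vectorSpan ℝ C) : ℤ) ≤ toExt ((m : ℤ) - c) + d)
    {A : Set (Fin m → ℝ)} (hA : A ⊆ ⋃₀ 𝒞) {b : Fin m → ℝ} {g : Fin q → Fin m → ℝ}
    (hg : PolyDimLE (stdSimplex ℝ (Fin q) ∩ Fintype.linearCombination ℝ g ⁻¹' A)
      (toExt ((q : ℤ) - c) + d))
    (hb : ∀ C ∈ 𝒞, Submodule.span ℝ C ⊔ Submodule.span ℝ (Set.range g) ≠ ⊤ →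
      b ∉ Submodule.span ℝ C ⊔ Submodule.span ℝ (Set.range g)) :
    PolyDimLE (stdSimplex ℝ (Fin (q + 1)) ∩
      Fintype.linearCombination ℝ (Fin.cons b g : Fin (q + 1) → Fin m → ℝ) ⁻¹' A)
      (toExt (((q + 1 : ℕ) : ℤ) - c) + d) := by
  set f := Fintype.linearCombination ℝ (Fin.cons b g : Fin (q + 1) → Fin m → ℝ) with hf
  have hmono : toExt ((q : ℤ) - c) + d ≤ toExt (((q + 1 : ℕ) : ℤ) - c) + d := by
    gcongr
    exact toExt_mono (by push_cast; omega)
  have hg' : PolyDimLE {x | x ∈ stdSimplex ℝ (Fin (q + 1)) ∧ x 0 = 0 ∧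
      Fin.tail x ∈ stdSimplex ℝ (Fin q) ∩ Fintype.linearCombination ℝ g ⁻¹' A}
      (toExt (((q + 1 : ℕ) : ℤ) - c) + d) := by
    obtain ⟨𝒟, h1, h2, h3⟩ := hg.face_zero
    exact ⟨𝒟, h1, fun C hC => ⟨(h2 C hC).1, (h2 C hC).2.1, (h2 C hC).2.2.trans hmono⟩, h3⟩
  -- For the cells in `𝒞'` the cone is transverse to the span already because of its base; for the
  -- others the generic apex confines the preimage to the base, where `hg'` applies.
  let 𝒞' := {C | C ∈ 𝒞 ∧ Submodule.span ℝ C ⊔ Submodule.span ℝ (Set.range g) = ⊤}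
  refine ((PolyDimLE.biUnion (hfin.subset fun _ h => h.1 : 𝒞'.Finite)
    (A := fun C => stdSimplex ℝ (Fin (q + 1)) ∩ f ⁻¹' C) (fun C hC => ?_)).union hg').mono ?_
  · obtain ⟨hCC, htop⟩ := hC
    obtain ⟨hcell, -, hd⟩ := h𝒞 C hCC
    refine PolyDimLE.of_isConvexCell (isConvexCell_preimage f hcell) fun hne => ?_
    have hr : Submodule.span ℝ (Set.range g) ≤ LinearMap.range f := by
      rw [hf, Fintype.range_linearCombination]
      refine Submodule.span_mono ?_
      rintro _ ⟨i, rfl⟩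
      exact ⟨i.succ, by simp⟩
    have h1 := finrank_comap_of_sup_range f (Submodule.span ℝ C)
      (top_le_iff.1 (htop.symm.le.trans (sup_le_sup_left hr _)))
    have h2 := finrank_span_le_vectorSpan C
    -- The linear span of `C` costs at most one dimension over its affine span, and intersecting
    -- with the simplex gains one back, so the bound on the dimension of the preimage is the
    -- expected one.
    have h3 := finrank_vectorSpan_lt_of_subset_stdSimplex (Set.inter_subset_left) hne
      (V := (Submodule.span ℝ C).comap f) (fun x hx => Submodule.subset_span hx.2)
    refine toExt_le_shift hd ?_
    push_cast
    omega
  · rintro x ⟨hx, hxA⟩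
    obtain ⟨C, hCC, hxC⟩ := hA hxA
    by_cases htop : Submodule.span ℝ C ⊔ Submodule.span ℝ (Set.range g) = ⊤
    · exact Or.inl (Set.mem_biUnion (x := C) ⟨hCC, htop⟩ ⟨hx, hxC⟩)
    · right
      have hb' := hb C hCC htop
      have hfx := linearCombination_cons b g x
      rw [← hf] at hfx
      -- If the weight of the apex were nonzero, the apex would be a linear combination of a point
      -- of the cell and the vertices of the base, contrary to general position.
      have hx0 : x 0 = 0 := by
        by_contra hne
        refine hb' ?_
        have h1 : x 0 • b ∈ Submodule.span ℝ C ⊔ Submodule.span ℝ (Set.range g) := by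
          rw [eq_sub_of_add_eq hfx.symm]
          refine Submodule.sub_mem _ (Submodule.mem_sup_left (Submodule.subset_span hxC))
            (Submodule.mem_sup_right ?_)
          rw [← Fintype.range_linearCombination]
          exact LinearMap.mem_range_self _ _
        exact (Submodule.smul_mem_iff _ hne).1 h1
      rw [hx0, zero_smul, zero_add] at hfx
      refine ⟨hx, hx0, ⟨fun i => hx.1 _, ?_⟩, ?_⟩
      · have := hx.2
        rw [Fin.sum_univ_succ, hx0, zero_add] at this
        exact this
      · rw [Set.mem_preimage, ← hfx]
        exact hxA

end PerverseSpace

namespace PerverseSpace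

/-! ### Affine simplices -/

/-- The topological standard simplex of dimension `k`. -/
abbrev TopSimplex (k : ℕ) : Type := stdSimplex ℝ (Fin (k + 1))

lemma linearCombination_mem_stdSimplex {k l : ℕ} (v : Fin (k + 1) → TopSimplex l)
    (x : TopSimplex k) :
    Fintype.linearCombination ℝ (fun i => (v i).1) x.1 ∈ stdSimplex ℝ (Fin (l + 1)) := by
  rw [Fintype.linearCombination_apply]
  exact (convex_stdSimplex ℝ _).sum_mem (fun i _ => x.2.1 i) x.2.2 fun i _ => (v i).2

/-- The affine simplex with given vertices. -/
noncomputable def affMap {k l : ℕ} (v : Fin (k + 1) → TopSimplex l) :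
    C(TopSimplex k, TopSimplex l) where
  toFun x := ⟨Fintype.linearCombination ℝ (fun i => (v i).1) x.1,
    linearCombination_mem_stdSimplex v x⟩
  continuous_toFun := Continuous.subtype_mk
    ((LinearMap.continuous_of_finiteDimensional _).comp continuous_subtype_val) _

lemma affMap_apply_apply {k l : ℕ} (v : Fin (k + 1) → TopSimplex l) (x : TopSimplex k)
    (j : Fin (l + 1)) : affMap v x j = ∑ i, x i * v i j := by
  change Fintype.linearCombination ℝ (fun i => (v i).1) x.1 j = _
  rw [Fintype.linearCombination_apply, Finset.sum_apply]
  rfl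

lemma affMap_affMap {k l m : ℕ} (w : Fin (l + 1) → TopSimplex m) (v : Fin (k + 1) → TopSimplex l)
    (x : TopSimplex k) : affMap w (affMap v x) = affMap (fun i => affMap w (v i)) x := by
  ext j
  simp only [affMap_apply_apply, Finset.sum_mul, Finset.mul_sum]
  rw [Finset.sum_comm]
  simp only [mul_assoc]

lemma affMap_vertex {k l : ℕ} (v : Fin (k + 1) → TopSimplex l) (i : Fin (k + 1)) :
    affMap v (stdSimplex.vertex i) = v i := by
  ext j
  rw [affMap_apply_apply, Finset.sum_eq_single i]
  · simp
  · intro b _ hb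
    simp [hb]
  · simp

lemma stdSimplex_map_eq_affMap {k l : ℕ} (θ : Fin (k + 1) → Fin (l + 1)) (x : TopSimplex k) :
    stdSimplex.map θ x = affMap (fun i => stdSimplex.vertex (θ i)) x := by
  ext j
  rw [affMap_apply_apply, stdSimplex.map_coe, FunOnFinite.linearMap_apply_apply, Finset.sum_filter]
  refine Finset.sum_congr rfl fun i _ => ?_
  simp [Pi.single_apply, eq_comm]

lemma affMap_map {k l m : ℕ} (v : Fin (l + 1) → TopSimplex m) (θ : Fin (k + 1) → Fin (l + 1))
    (x : TopSimplex k) : affMap v (stdSimplex.map θ x) = affMap (v ∘ θ) x := by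
  rw [stdSimplex_map_eq_affMap, affMap_affMap]
  simp only [affMap_vertex]
  rfl

lemma map_affMap {k l m : ℕ} (θ : Fin (l + 1) → Fin (m + 1)) (v : Fin (k + 1) → TopSimplex l)
    (x : TopSimplex k) :
    stdSimplex.map θ (affMap v x) = affMap (fun i => stdSimplex.map θ (v i)) x := by
  simp only [stdSimplex_map_eq_affMap, affMap_affMap]

lemma affMap_id {k : ℕ} (x : TopSimplex k) : affMap (fun i => stdSimplex.vertex i) x = x := by
  rw [← stdSimplex_map_eq_affMap (fun i => i) x]
  exact stdSimplex.map_id_apply x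

variable {X : Type u} [TopologicalSpace X]

namespace Perversity

/-- The restriction of a singular simplex `σ` to the affine simplex with vertices `v`. -/
noncomputable def sub {l : SimplexCategoryᵒᵖ} (σ : (TopCat.toSSet.obj (TopCat.of X)).obj l)
    (k : SimplexCategoryᵒᵖ) (v : Fin (k.unop.len + 1) → TopSimplex l.unop.len) :
    (TopCat.toSSet.obj (TopCat.of X)).obj k :=
  (TopCat.toSSetObjEquiv (TopCat.of X) k).symm ((singMap σ).comp (affMap v))

lemma singMap_sub {l : SimplexCategoryᵒᵖ} (σ : (TopCat.toSSet.obj (TopCat.of X)).obj l)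
    (k : SimplexCategoryᵒᵖ) (v : Fin (k.unop.len + 1) → TopSimplex l.unop.len) :
    singMap (sub σ k v) = (singMap σ).comp (affMap v) :=
  (TopCat.toSSetObjEquiv (TopCat.of X) k).apply_symm_apply _

lemma singMap_sub_apply {l : SimplexCategoryᵒᵖ} (σ : (TopCat.toSSet.obj (TopCat.of X)).obj l)
    (k : SimplexCategoryᵒᵖ) (v : Fin (k.unop.len + 1) → TopSimplex l.unop.len)
    (x : TopSimplex k.unop.len) : singMap (sub σ k v) x = singMap σ (affMap v x) := by
  rw [singMap_sub]
  rfl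

lemma singMap_ext {l : SimplexCategoryᵒᵖ} {σ τ : (TopCat.toSSet.obj (TopCat.of X)).obj l}
    (h : ∀ x, singMap σ x = singMap τ x) : σ = τ :=
  (TopCat.toSSetObjEquiv (TopCat.of X) l).injective (ContinuousMap.ext h)

lemma toSSet_map_sub {l k m : SimplexCategoryᵒᵖ} (σ : (TopCat.toSSet.obj (TopCat.of X)).obj l)
    (v : Fin (k.unop.len + 1) → TopSimplex l.unop.len) (θ : k ⟶ m) :
    (TopCat.toSSet.obj (TopCat.of X)).map θ (sub σ k v) = sub σ m (v ∘ θ.unop) := by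
  refine singMap_ext fun x => ?_
  rw [singMap_map, singMap_sub_apply, singMap_sub_apply, affMap_map]

lemma sub_map {l k m : SimplexCategoryᵒᵖ} (σ : (TopCat.toSSet.obj (TopCat.of X)).obj l)
    (θ : l ⟶ m) (v : Fin (k.unop.len + 1) → TopSimplex m.unop.len) :
    sub ((TopCat.toSSet.obj (TopCat.of X)).map θ σ) k v =
      sub σ k (fun i => stdSimplex.map θ.unop (v i)) := by
  refine singMap_ext fun x => ?_
  rw [singMap_sub_apply, singMap_sub_apply, singMap_map, map_affMap]

lemma sub_sub {l k m : SimplexCategoryᵒᵖ} (σ : (TopCat.toSSet.obj (TopCat.of X)).obj l)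
    (w : Fin (m.unop.len + 1) → TopSimplex l.unop.len)
    (v : Fin (k.unop.len + 1) → TopSimplex m.unop.len) :
    sub (sub σ m w) k v = sub σ k (fun i => affMap w (v i)) := by
  refine singMap_ext fun x => ?_
  rw [singMap_sub_apply, singMap_sub_apply, singMap_sub_apply, affMap_affMap]

lemma sub_vertex {l : SimplexCategoryᵒᵖ} (σ : (TopCat.toSSet.obj (TopCat.of X)).obj l) :
    sub σ l (fun i => stdSimplex.vertex i) = σ := by
  refine singMap_ext fun x => ?_
  rw [singMap_sub_apply, affMap_id]

lemma map_eq_sub {l m : SimplexCategoryᵒᵖ} (σ : (TopCat.toSSet.obj (TopCat.of X)).obj l)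
    (θ : l ⟶ m) : (TopCat.toSSet.obj (TopCat.of X)).map θ σ =
      sub σ m (fun i => stdSimplex.vertex (θ.unop i)) := by
  conv_lhs => rw [← sub_vertex σ]
  rw [toSSet_map_sub]
  rfl

/-- Turns allowability of an affine subsimplex into a statement about a linear preimage of a
polyhedron, the form in which `PolyDimLE.cone` applies. -/
lemma preimage_sub {l : SimplexCategoryᵒᵖ} (σ : (TopCat.toSSet.obj (TopCat.of X)).obj l)
    (k : SimplexCategoryᵒᵖ) (v : Fin (k.unop.len + 1) → TopSimplex l.unop.len) (A : Set X) :
    Subtype.val '' (singMap (sub σ k v) ⁻¹' A) = stdSimplex ℝ (Fin (k.unop.len + 1)) ∩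
      Fintype.linearCombination ℝ (fun i => (v i).1) ⁻¹' (Subtype.val '' (singMap σ ⁻¹' A)) := by
  ext x
  constructor
  · rintro ⟨y, hy, rfl⟩
    refine ⟨y.2, affMap v y, ?_, rfl⟩
    rwa [Set.mem_preimage, singMap_sub_apply] at hy
  · rintro ⟨hx, y, hy, hxy⟩
    refine ⟨⟨x, hx⟩, ?_, rfl⟩
    rw [Set.mem_preimage, singMap_sub_apply]
    have : y = affMap v ⟨x, hx⟩ := Subtype.ext hxy
    rwa [← this]

/-! ### Full affine simplices and generic cones on them -/

variable {n : ℕ} {F : Filtration X n} (p : Perversity F)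

lemma Full.allowable {p : Perversity F} {l : SimplexCategoryᵒᵖ}
    {σ : (TopCat.toSSet.obj (TopCat.of X)).obj l} (h : p.Full σ) : p.Allowable (singMap σ) := by
  have := h l.unop (𝟙 _) inferInstance
  rwa [op_id, Functor.map_id_apply] at this

lemma Full.map {p : Perversity F} {l k : SimplexCategoryᵒᵖ}
    {σ : (TopCat.toSSet.obj (TopCat.of X)).obj l} (h : p.Full σ) (θ : l ⟶ k) :
    p.Full ((TopCat.toSSet.obj (TopCat.of X)).map θ σ) :=
  p.gajer.map θ h

lemma Full.sub_comp {p : Perversity F} {l k m : SimplexCategoryᵒᵖ}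
    {σ : (TopCat.toSSet.obj (TopCat.of X)).obj l}
    {v : Fin (k.unop.len + 1) → TopSimplex l.unop.len} (h : p.Full (sub σ k v)) (θ : k ⟶ m) :
    p.Full (sub σ m (v ∘ θ.unop)) :=
  toSSet_map_sub σ v θ ▸ h.map θ

/-- A point in general position with respect to finitely many full affine simplices of a full
simplex `σ`: the cones on them are full. -/
theorem exists_cone_point (hF : F.LocallyFiniteStratification) {l : SimplexCategoryᵒᵖ}
    {σ : (TopCat.toSSet.obj (TopCat.of X)).obj l} (hσ : p.Full σ)
    {Z : Set (Σ k : ℕ, Fin (k + 1) → TopSimplex l.unop.len)} (hZ : Z.Finite)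
    (hfull : ∀ z ∈ Z, p.Full (sub σ (op ⦋z.1⦌) z.2)) :
    ∃ b : TopSimplex l.unop.len, (∀ i, 1 / ((l.unop.len : ℝ) + 2) ≤ b i) ∧
      ∀ z ∈ Z, p.Full (sub σ (op ⦋z.1 + 1⦌) (Fin.cons b z.2)) := by
  have hallow := hσ.allowable
  choose! 𝒞 h𝒞fin h𝒞 hA using hallow
  let 𝒮 : Set F.Stratum := {S | ¬ S.IsRegular ∧ (S.carrier ∩ Set.range (singMap σ)).Nonempty}
  have h𝒮 : 𝒮.Finite := (hF.finite_nonempty_inter_compact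
    (isCompact_range (singMap σ).continuous)).subset fun S hS => hS.2
  -- All subsets `I` of the vertices are needed because every face of the cone has to be allowable,
  -- not only the cone itself.
  let 𝒲 : Set (Submodule ℝ (Fin (l.unop.len + 1) → ℝ)) :=
    ⋃ S ∈ 𝒮, ⋃ C ∈ 𝒞 S, ⋃ z ∈ Z, Set.range fun I : Set (Fin (z.1 + 1)) =>
      Submodule.span ℝ C ⊔ Submodule.span ℝ ((fun i => (z.2 i).1) '' I)
  have h𝒲 : 𝒲.Finite := h𝒮.biUnion fun S hS => (h𝒞fin S hS.1).biUnion fun C _ =>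
    hZ.biUnion fun z _ => Set.finite_range _
  obtain ⟨b, hbΔ, hb, hb𝒲⟩ := exists_generic_mem_stdSimplex (Nat.succ_pos l.unop.len)
    (h𝒲.subset (fun W h => h.1 : {W | W ∈ 𝒲 ∧ W ≠ ⊤} ⊆ 𝒲)) (fun W hW => hW.2)
  refine ⟨⟨b, hbΔ⟩, fun i => ?_, fun z hz m μ hμ S hS => ?_⟩
  · refine le_trans (le_of_eq ?_) (hb i)
    push_cast
    ring
  obtain ⟨k, f⟩ := z
  rw [toSSet_map_sub]
  by_cases hSr : (S.carrier ∩ Set.range (singMap σ)).Nonempty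
  swap
  · refine (PolyDimLE.empty _).mono ?_
    rintro _ ⟨x, hx, rfl⟩
    rw [Set.mem_preimage, singMap_sub_apply] at hx
    exact hSr ⟨_, hx, _, rfl⟩
  -- By monotonicity, a face contains the apex exactly if `μ 0 = 0`. A face without the apex is a
  -- face of the base, which is full by assumption.
  by_cases hμ0 : μ 0 = 0
  swap
  · obtain ⟨ν, rfl⟩ := SimplexCategory.eq_comp_δ_of_not_surjective' μ 0 fun x hx => hμ0 <|
      le_antisymm (hx ▸ μ.toOrderHom.monotone (Fin.zero_le x)) (Fin.zero_le _)
    have : Mono ν := mono_of_mono ν (SimplexCategory.δ 0)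
    have h := hfull ⟨k, f⟩ hz m ν this S hS
    rw [toSSet_map_sub] at h
    exact h
  · induction m using SimplexCategory.rec with | _ q =>
    let g : Fin q → TopSimplex l.unop.len := fun i =>
      Fin.cons (α := fun _ => TopSimplex l.unop.len) ⟨b, hbΔ⟩ f (μ i.succ)
    have hμi : Function.Injective μ := SimplexCategory.mono_iff_injective.1 hμ
    have hne : ∀ i : Fin q, μ i.succ ≠ 0 := fun i hi =>
      (Fin.succ_ne_zero i) (hμi (hi.trans hμ0.symm))
    have hcons : (fun i => ((Fin.cons (α := fun _ => TopSimplex l.unop.len) ⟨b, hbΔ⟩ f ∘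
        μ) i).1) = (Fin.cons b (fun i => (g i).1) : Fin (q + 1) → Fin (l.unop.len + 1) → ℝ) := by
      funext i
      refine Fin.cases ?_ (fun i => ?_) i
      · rw [Function.comp_apply, hμ0]
        rfl
      · rfl
    rw [preimage_sub]
    have hrange : Set.range (fun i => (g i).1) = (fun i => (f i).1) ''
        {i | ∃ j : Fin q, μ j.succ = i.succ} := by
      ext x
      constructor
      · rintro ⟨j, rfl⟩
        obtain ⟨i, hi⟩ := Fin.exists_succ_eq_of_ne_zero (hne j)
        refine ⟨i, ⟨j, hi.symm⟩, ?_⟩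
        simp only [g, ← hi, Fin.cons_succ]
      · rintro ⟨i, ⟨j, hj⟩, rfl⟩
        refine ⟨j, ?_⟩
        simp only [g, hj, Fin.cons_succ]
    -- `PolyDimLE.cone` counts barycentric coordinates, one more than the dimension of the simplex;
    -- the extra 1 in `c` compensates for this.
    have key := PolyDimLE.cone (q := q) (b := b) (g := fun i => (g i).1) (h𝒞fin S hS)
      (c := S.codim + 1) (d := p.toFun S) (fun C hC => ?_) (hA S hS) ?_ fun C hC htop hbm => ?_
    · rw [← hcons] at key
      have e : (((q + 1 : ℕ) : ℤ) - (S.codim + 1)) = (q : ℤ) - S.codim := by push_cast; ring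
      rw [e] at key
      exact key
    · obtain ⟨h1, h2, h3⟩ := h𝒞 S hS C hC
      refine ⟨h1, h2, ?_⟩
      have e : (((l.unop.len + 1 : ℕ) : ℤ) - (S.codim + 1)) = (l.unop.len : ℤ) - S.codim := by
        push_cast; ring
      rwa [e]
    -- The base of the cone, opposite to the apex, must be allowable. For `q = 0` the face is the
    -- apex alone and the base is empty; otherwise the base is a face of the full simplex `f`.
    · cases q with
      | zero =>
        refine (PolyDimLE.empty _).mono ?_
        rw [stdSimplex_of_isEmpty_index, Set.empty_inter]
      | succ q =>
        obtain ⟨ν, hν⟩ := SimplexCategory.eq_comp_δ_of_not_surjective'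
          (SimplexCategory.δ (n := q) 0 ≫ μ) 0 fun x hx => hne x hx
        have : Mono ν := by
          have : Mono (ν ≫ SimplexCategory.δ 0) := by rw [← hν]; infer_instance
          exact mono_of_mono ν (SimplexCategory.δ 0)
        have h := hfull ⟨k, f⟩ hz ⦋q⦌ ν this S hS
        rw [toSSet_map_sub, preimage_sub] at h
        have e : (((q + 1 : ℕ) : ℤ) - (S.codim + 1)) = (q : ℤ) - S.codim := by push_cast; ring
        rw [e]
        have hfg : (fun i => ((f ∘ ν) i).1) = fun i => (g i).1 := by
          funext i
          have hi : μ i.succ = (ν i).succ := DFunLike.congr_fun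
            (congrArg SimplexCategory.Hom.toOrderHom hν) i
          simp only [g, hi, Fin.cons_succ]
          rfl
        simp only [Quiver.Hom.unop_op] at h
        rw [← hfg]
        exact h
    · refine hb𝒲 _ ⟨?_, htop⟩ hbm
      simp only [𝒲, Set.mem_iUnion]
      exact ⟨S, ⟨hS, hSr⟩, C, hC, ⟨k, f⟩, hz, _, by rw [hrange]⟩

end Perversity
end PerverseSpace

namespace PerverseSpace

/-! ### Chains of tuples -/

/-- Integral chains of `(k + 1)`-tuples of elements of `V`. -/
abbrev TupleChains (V : Type*) (k : ℕ) : Type _ := (Fin (k + 1) → V) →₀ ℤ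

namespace TupleChains

variable {V W U : Type*} {k : ℕ}

/-- The boundary of a chain of tuples. -/
noncomputable def d (k : ℕ) : TupleChains V (k + 1) →ₗ[ℤ] TupleChains V k :=
  Finsupp.linearCombination ℤ fun v => ∑ i : Fin (k + 2),
    (-1 : ℤ) ^ (i : ℕ) • Finsupp.single (v ∘ i.succAbove) 1

/-- The cone on a chain of tuples. -/
noncomputable def cone (b : V) : TupleChains V k →ₗ[ℤ] TupleChains V (k + 1) :=
  Finsupp.lmapDomain ℤ ℤ fun v => Fin.cons b v

/-- The map on chains of tuples induced by a map. -/
noncomputable def push (f : V → W) : TupleChains V k →ₗ[ℤ] TupleChains W k :=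
  Finsupp.lmapDomain ℤ ℤ fun v => f ∘ v

/-- The augmentation. -/
noncomputable def aug : TupleChains V k →ₗ[ℤ] ℤ := Finsupp.linearCombination ℤ fun _ => 1

lemma d_single (v : Fin (k + 2) → V) :
    d k (Finsupp.single v 1) =
      ∑ i : Fin (k + 2), (-1 : ℤ) ^ (i : ℕ) • Finsupp.single (v ∘ i.succAbove) 1 := by
  simp only [d, Finsupp.linearCombination_single, one_smul]

lemma cone_single (b : V) (v : Fin (k + 1) → V) :
    cone b (Finsupp.single v 1) = Finsupp.single (Fin.cons b v) 1 := by
  simp [cone, Finsupp.mapDomain_single]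

lemma push_single (f : V → W) (v : Fin (k + 1) → V) :
    push f (Finsupp.single v 1) = Finsupp.single (f ∘ v) 1 := by
  simp [push, Finsupp.mapDomain_single]

lemma hom_ext {M : Type*} [AddCommGroup M] {f g : TupleChains V k →ₗ[ℤ] M}
    (h : ∀ v, f (Finsupp.single v 1) = g (Finsupp.single v 1)) : f = g :=
  Finsupp.lhom_ext' fun v => LinearMap.ext_ring (h v)

lemma d_push (f : V → W) (c : TupleChains V (k + 1)) : d k (push f c) = push f (d k c) := by
  revert c
  refine DFunLike.congr_fun (f := (d k).comp (push f)) (g := (push f).comp (d k))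
    (hom_ext fun v => ?_)
  simp only [LinearMap.comp_apply, push_single, d_single, map_sum, map_smul]
  rfl

lemma push_push (g : W → U) (f : V → W) (c : TupleChains V k) :
    push g (push f c) = push (g ∘ f) c := by
  revert c
  refine DFunLike.congr_fun (f := (push g).comp (push f)) (g := push (g ∘ f)) (hom_ext fun v => ?_)
  simp only [LinearMap.comp_apply, push_single]
  rfl

lemma aug_push (f : V → W) (c : TupleChains V k) : aug (push f c) = aug c := by
  revert c
  refine DFunLike.congr_fun (f := aug.comp (push f)) (g := aug) (hom_ext fun v => ?_)
  simp only [LinearMap.comp_apply, push_single, aug, Finsupp.linearCombination_single]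

lemma d_cone (b : V) (c : TupleChains V (k + 1)) :
    d (k + 1) (cone b c) = c - cone b (d k c) := by
  revert c
  refine DFunLike.congr_fun (f := (d (k + 1)).comp (cone b))
    (g := LinearMap.id - (cone b).comp (d k)) (hom_ext fun v => ?_)
  simp only [LinearMap.comp_apply, cone_single, d_single, map_sum, map_smul, LinearMap.sub_apply,
    LinearMap.id_apply]
  rw [Fin.sum_univ_succ, sub_eq_add_neg, ← Finset.sum_neg_distrib]
  congr 1
  · simp only [Fin.val_zero, pow_zero, one_smul]
    congr 1
  · refine Finset.sum_congr rfl fun i _ => ?_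
    rw [Fin.val_succ, pow_succ, mul_neg_one, neg_smul]
    congr 3
    funext j
    refine Fin.cases ?_ (fun j => ?_) j <;> simp

/-- The bottom case of the cone formula has the apex as an additional term, weighted by the
augmentation; it disappears on the boundary of an edge. -/
lemma d_cone_zero (b : V) (c : TupleChains V 0) :
    d 0 (cone b c) = c - aug c • Finsupp.single (fun _ => b) 1 := by
  revert c
  refine DFunLike.congr_fun (f := (d 0).comp (cone b))
    (g := LinearMap.id - aug.smulRight (Finsupp.single (fun _ => b) 1)) (hom_ext fun v => ?_)
  simp only [LinearMap.comp_apply, cone_single, d_single, LinearMap.sub_apply,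
    LinearMap.id_apply, LinearMap.smulRight_apply, aug,
    Finsupp.linearCombination_single, one_smul]
  rw [sub_eq_add_neg, Fin.sum_univ_succ, Fin.sum_univ_succ, Finset.univ_eq_empty,
    Finset.sum_empty, add_zero]
  congr 1
  · simp only [Fin.val_zero, pow_zero, one_smul]
    congr 1
  · rw [Fin.val_succ, Fin.val_zero, pow_succ, pow_zero, one_mul, neg_one_smul]
    congr 2
    funext j
    fin_cases j
    rfl

lemma cone_mem_supported {b : V} {S : Set (Fin (k + 1) → V)} {S' : Set (Fin (k + 2) → V)}
    (h : ∀ v ∈ S, (Fin.cons b v : Fin (k + 2) → V) ∈ S') {c : TupleChains V k}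
    (hc : c ∈ Finsupp.supported ℤ ℤ S) : cone b c ∈ Finsupp.supported ℤ ℤ S' := by
  have h1 := Submodule.mem_map_of_mem (f := Finsupp.lmapDomain ℤ ℤ
    (fun v : Fin (k + 1) → V => (Fin.cons b v : Fin (k + 2) → V))) hc
  rw [Finsupp.lmapDomain_supported] at h1
  refine Finsupp.supported_mono ?_ h1
  rintro _ ⟨v, hv, rfl⟩
  exact h v hv

lemma push_mem_supported {f : V → W} {S : Set (Fin (k + 1) → V)} {S' : Set (Fin (k + 1) → W)}
    (h : ∀ v ∈ S, f ∘ v ∈ S') {c : TupleChains V k}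
    (hc : c ∈ Finsupp.supported ℤ ℤ S) : push f c ∈ Finsupp.supported ℤ ℤ S' := by
  have h1 := Submodule.mem_map_of_mem (f := Finsupp.lmapDomain ℤ ℤ
    (fun v : Fin (k + 1) → V => f ∘ v)) hc
  rw [Finsupp.lmapDomain_supported] at h1
  refine Finsupp.supported_mono ?_ h1
  rintro _ ⟨v, hv, rfl⟩
  exact h v hv

end TupleChains

/-- The cancellation behind `d ∘ d = 0`, for an arbitrary function of the composite face operator.
In this form it applies to `faceSum`, whose terms are not the values of a simplicial group. -/
lemma sum_sum_face_comp_eq_zero {M : Type*} [AddCommGroup M] {m : ℕ} (H : (⦋m⦌ ⟶ ⦋m + 2⦌) → M) :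
    ∑ i : Fin (m + 3), (-1 : ℤ) ^ (i : ℕ) • ∑ j : Fin (m + 2), (-1 : ℤ) ^ (j : ℕ) •
      H (SimplexCategory.δ j ≫ SimplexCategory.δ i) = 0 := by
  simp only [Finset.smul_sum, smul_smul]
  rw [Finset.sum_comm]
  simp only [← Finset.sum_product']
  let P := Fin (m + 2) × Fin (m + 3)
  let S : Finset P := {ij | (ij.2 : ℕ) ≤ (ij.1 : ℕ)}
  rw [Finset.univ_product_univ, ← Finset.sum_add_sum_compl S, ← eq_neg_iff_add_eq_zero,
    ← Finset.sum_neg_distrib]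
  -- The pair `(j, i)` with `i ≤ j` cancels against `(i, j + 1)`: the composite face is the same and
  -- the exponent of the sign changes by one.
  let φ : ∀ ij : P, ij ∈ S → P := fun ij hij =>
    (Fin.castLT ij.2 (lt_of_le_of_lt (Finset.mem_filter.mp hij).right (Fin.is_lt ij.1)),
      ij.1.succ)
  apply Finset.sum_bij φ
  · intro ij hij
    simp_rw [S, φ, Finset.compl_filter, Finset.mem_filter_univ, Fin.val_succ,
      Fin.val_castLT] at hij ⊢
    lia
  · rintro ⟨i, j⟩ hij ⟨i', j'⟩ hij' h
    rw [Prod.mk_inj]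
    exact ⟨by simpa [φ] using! congr_arg Prod.snd h,
      by simpa [φ, Fin.castSucc_castLT] using! congr_arg Fin.castSucc (congr_arg Prod.fst h)⟩
  · rintro ⟨i', j'⟩ hij'
    simp_rw [S, Finset.compl_filter, Finset.mem_filter_univ, not_le] at hij'
    refine ⟨(j'.pred <| ?_, Fin.castSucc i'), ?_, ?_⟩
    · rintro rfl
      simp only [Fin.val_zero, not_lt_zero] at hij'
    · simpa [S] using! Nat.le_sub_one_of_lt hij'
    · simp only [φ, Fin.castLT_castSucc, Fin.succ_pred]
  · rintro ⟨i, j⟩ hij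
    dsimp only [φ]
    rw [← neg_smul]
    congr 1
    · simp only [Fin.val_succ, Fin.val_castLT, pow_succ]
      ring
    · rw [SimplexCategory.δ_comp_δ'']
      simpa [S] using! hij

end PerverseSpace

namespace PerverseSpace
namespace Perversity

variable {X : Type u} [TopologicalSpace X] {n : ℕ} {F : Filtration X n} (p : Perversity F)

/-! ### Transport along affine paths -/

lemma exists_cone_point_list (hF : F.LocallyFiniteStratification) {l : SimplexCategoryᵒᵖ}
    {σ : (TopCat.toSSet.obj (TopCat.of X)).obj l} (hσ : p.Full σ)
    (Z : List (Σ k : ℕ, Fin (k + 1) → TopSimplex l.unop.len))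
    (hfull : ∀ z ∈ Z, p.Full (sub σ (op ⦋z.1⦌) z.2)) :
    ∃ b : TopSimplex l.unop.len, ∀ z ∈ Z, p.Full (sub σ (op ⦋z.1 + 1⦌) (Fin.cons b z.2)) := by
  classical
  obtain ⟨b, -, hb⟩ := p.exists_cone_point hF hσ (Z := {z | z ∈ Z})
    (Z.toFinset.finite_toSet.subset fun z hz => by simpa using hz) hfull
  exact ⟨b, hb⟩

variable {p} in
lemma Full.sub_congr {l : SimplexCategoryᵒᵖ} {σ : (TopCat.toSSet.obj (TopCat.of X)).obj l}
    {k m : SimplexCategoryᵒᵖ} {v : Fin (k.unop.len + 1) → TopSimplex l.unop.len}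
    (h : p.Full (sub σ k v)) (θ : k ⟶ m)
    {w : Fin (m.unop.len + 1) → TopSimplex l.unop.len} (hw : ∀ i, v (θ.unop i) = w i) :
    p.Full (sub σ m w) := by
  obtain rfl : v ∘ θ.unop = w := funext hw
  exact h.sub_comp θ

variable {p}

lemma Full.left {l : SimplexCategoryᵒᵖ} {σ : (TopCat.toSSet.obj (TopCat.of X)).obj l}
    {x y : TopSimplex l.unop.len} (h : p.Full (sub σ (op ⦋1⦌) ![x, y])) :
    p.Full (sub σ (op ⦋0⦌) ![x]) :=
  h.sub_congr (SimplexCategory.δ 1).op fun i => by fin_cases i; rfl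

lemma Full.right {l : SimplexCategoryᵒᵖ} {σ : (TopCat.toSSet.obj (TopCat.of X)).obj l}
    {x y : TopSimplex l.unop.len} (h : p.Full (sub σ (op ⦋1⦌) ![x, y])) :
    p.Full (sub σ (op ⦋0⦌) ![y]) :=
  h.sub_congr (SimplexCategory.δ 0).op fun i => by fin_cases i; rfl

/-- The target is any simplex `Q` with the right underlying singular simplex. Thus edges and paths
can have prescribed vertices of the Gajer space as endpoints, and composites typecheck without
casts. -/
lemma gajer_map_sub {l k m : SimplexCategoryᵒᵖ} (σ : (TopCat.toSSet.obj (TopCat.of X)).obj l)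
    {v : Fin (k.unop.len + 1) → TopSimplex l.unop.len} (h : p.Full (sub σ k v)) (θ : k ⟶ m)
    {w : Fin (m.unop.len + 1) → TopSimplex l.unop.len} {Q : (p.gajer : SSet.{u}).obj m}
    (hQ : Q.1 = sub σ m w) (hw : ∀ i, v (θ.unop i) = w i) :
    (p.gajer : SSet.{u}).map θ ⟨sub σ k v, h⟩ = Q := by
  obtain rfl : v ∘ θ.unop = w := funext hw
  exact Subtype.ext ((toSSet_map_sub σ v θ).trans hQ.symm)

/-- An edge of the Gajer space given by an affine `1`-simplex of `σ`. -/
noncomputable def affEdge {l : SimplexCategoryᵒᵖ} (σ : (TopCat.toSSet.obj (TopCat.of X)).obj l)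
    (x y : TopSimplex l.unop.len) {P Q : (p.gajer : SSet.{u}) _⦋0⦌}
    (hP : P.1 = sub σ (op ⦋0⦌) ![x]) (hQ : Q.1 = sub σ (op ⦋0⦌) ![y])
    (h : p.Full (sub σ (op ⦋1⦌) ![x, y])) : SSet.Edge P Q :=
  SSet.Edge.mk (⟨sub σ (op ⦋1⦌) ![x, y], h⟩ : (p.gajer : SSet.{u}).obj (op ⦋1⦌))
    (gajer_map_sub σ h (SimplexCategory.δ 1).op hP fun i => by fin_cases i; rfl)
    (gajer_map_sub σ h (SimplexCategory.δ 0).op hQ fun i => by fin_cases i; rfl)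

lemma affEdge_comp {l : SimplexCategoryᵒᵖ} (σ : (TopCat.toSSet.obj (TopCat.of X)).obj l)
    (x y z : TopSimplex l.unop.len) {P Q R : (p.gajer : SSet.{u}) _⦋0⦌}
    (hP : P.1 = sub σ (op ⦋0⦌) ![x]) (hQ : Q.1 = sub σ (op ⦋0⦌) ![y])
    (hR : R.1 = sub σ (op ⦋0⦌) ![z])
    (h : p.Full (sub σ (op ⦋2⦌) ![x, y, z])) (hxy : p.Full (sub σ (op ⦋1⦌) ![x, y]))
    (hyz : p.Full (sub σ (op ⦋1⦌) ![y, z])) (hxz : p.Full (sub σ (op ⦋1⦌) ![x, z])) :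
    FundGroupoid.edge (affEdge σ x y hP hQ hxy) ≫ FundGroupoid.edge (affEdge σ y z hQ hR hyz) =
      FundGroupoid.edge (affEdge σ x z hP hR hxz) :=
  FundGroupoid.edge_comp (SSet.Edge.CompStruct.mk
    (⟨sub σ (op ⦋2⦌) ![x, y, z], h⟩ : (p.gajer : SSet.{u}).obj (op ⦋2⦌))
    (gajer_map_sub σ h (SimplexCategory.δ 2).op rfl fun i => by fin_cases i <;> rfl)
    (gajer_map_sub σ h (SimplexCategory.δ 0).op rfl fun i => by fin_cases i <;> rfl)
    (gajer_map_sub σ h (SimplexCategory.δ 1).op rfl fun i => by fin_cases i <;> rfl))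

lemma exists_common_cone_point (hF : F.LocallyFiniteStratification) {l : SimplexCategoryᵒᵖ}
    {σ : (TopCat.toSSet.obj (TopCat.of X)).obj l} (hσ : p.Full σ) {x y : TopSimplex l.unop.len}
    (hx : p.Full (sub σ (op ⦋0⦌) ![x])) (hy : p.Full (sub σ (op ⦋0⦌) ![y])) :
    ∃ b, p.Full (sub σ (op ⦋1⦌) ![b, x]) ∧ p.Full (sub σ (op ⦋1⦌) ![b, y]) := by
  obtain ⟨b, hb⟩ := p.exists_cone_point_list hF hσ [⟨0, ![x]⟩, ⟨0, ![y]⟩] (by simp [hx, hy])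
  exact ⟨b, hb ⟨0, ![x]⟩ (by simp), hb ⟨0, ![y]⟩ (by simp)⟩

/-- The path through a cone point `b` between two points of a full simplex. -/
noncomputable def pathVia {l : SimplexCategoryᵒᵖ} (σ : (TopCat.toSSet.obj (TopCat.of X)).obj l)
    (b x y : TopSimplex l.unop.len) {B P Q : (p.gajer : SSet.{u}) _⦋0⦌}
    (hB : B.1 = sub σ (op ⦋0⦌) ![b])
    (hP : P.1 = sub σ (op ⦋0⦌) ![x]) (hQ : Q.1 = sub σ (op ⦋0⦌) ![y])
    (hx : p.Full (sub σ (op ⦋1⦌) ![b, x])) (hy : p.Full (sub σ (op ⦋1⦌) ![b, y])) :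
    FundGroupoid.vert P ⟶ FundGroupoid.vert Q :=
  inv (FundGroupoid.edge (affEdge σ b x hB hP hx)) ≫
    FundGroupoid.edge (affEdge σ b y hB hQ hy)

/-- The two triangles share the edge from `c` to `b`, and this edge cancels. -/
lemma pathVia_eq_of_triangles {l : SimplexCategoryᵒᵖ}
    (σ : (TopCat.toSSet.obj (TopCat.of X)).obj l)
    (c b x y : TopSimplex l.unop.len) {C B P Q : (p.gajer : SSet.{u}) _⦋0⦌}
    (hC : C.1 = sub σ (op ⦋0⦌) ![c]) (hB : B.1 = sub σ (op ⦋0⦌) ![b])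
    (hP : P.1 = sub σ (op ⦋0⦌) ![x]) (hQ : Q.1 = sub σ (op ⦋0⦌) ![y])
    (hx : p.Full (sub σ (op ⦋1⦌) ![b, x])) (hy : p.Full (sub σ (op ⦋1⦌) ![b, y]))
    (hcx : p.Full (sub σ (op ⦋2⦌) ![c, b, x])) (hcy : p.Full (sub σ (op ⦋2⦌) ![c, b, y]))
    (hx' : p.Full (sub σ (op ⦋1⦌) ![c, x])) (hy' : p.Full (sub σ (op ⦋1⦌) ![c, y])) :
    pathVia σ b x y hB hP hQ hx hy = pathVia σ c x y hC hP hQ hx' hy' := by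
  have hcb : p.Full (sub σ (op ⦋1⦌) ![c, b]) :=
    hcx.sub_congr (SimplexCategory.δ 2).op fun i => by fin_cases i <;> rfl
  have h1 := affEdge_comp σ c b x hC hB hP hcx hcb hx hx'
  have h2 := affEdge_comp σ c b y hC hB hQ hcy hcb hy hy'
  simp only [pathVia, ← h1, ← h2, IsIso.inv_comp, Category.assoc, IsIso.inv_hom_id_assoc]

/-- A third point `c`, generic with respect to the four edges of the two paths, spans full triangles
with all of them; both paths are therefore equal to the path through `c`. -/
lemma pathVia_eq (hF : F.LocallyFiniteStratification) {l : SimplexCategoryᵒᵖ}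
    {σ : (TopCat.toSSet.obj (TopCat.of X)).obj l} (hσ : p.Full σ)
    (b b' x y : TopSimplex l.unop.len) {B B' P Q : (p.gajer : SSet.{u}) _⦋0⦌}
    (hB : B.1 = sub σ (op ⦋0⦌) ![b]) (hB' : B'.1 = sub σ (op ⦋0⦌) ![b'])
    (hP : P.1 = sub σ (op ⦋0⦌) ![x]) (hQ : Q.1 = sub σ (op ⦋0⦌) ![y])
    (hx : p.Full (sub σ (op ⦋1⦌) ![b, x])) (hy : p.Full (sub σ (op ⦋1⦌) ![b, y]))
    (hx' : p.Full (sub σ (op ⦋1⦌) ![b', x])) (hy' : p.Full (sub σ (op ⦋1⦌) ![b', y])) :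
    pathVia σ b x y hB hP hQ hx hy = pathVia σ b' x y hB' hP hQ hx' hy' := by
  obtain ⟨c, hc⟩ := p.exists_cone_point_list hF hσ
    [⟨1, ![b, x]⟩, ⟨1, ![b, y]⟩, ⟨1, ![b', x]⟩, ⟨1, ![b', y]⟩, ⟨0, ![x]⟩, ⟨0, ![y]⟩]
    (by simp [hx, hy, hx', hy', hx.right, hy.right])
  have h5 : p.Full (sub σ (op ⦋1⦌) ![c, x]) := hc ⟨0, ![x]⟩ (by simp)
  have h6 : p.Full (sub σ (op ⦋1⦌) ![c, y]) := hc ⟨0, ![y]⟩ (by simp)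
  exact (pathVia_eq_of_triangles σ c b x y (C := ⟨_, h5.left⟩) rfl hB hP hQ hx hy
    (hc ⟨1, ![b, x]⟩ (by simp))
    (hc ⟨1, ![b, y]⟩ (by simp)) h5 h6).trans
    (pathVia_eq_of_triangles σ c b' x y (C := ⟨_, h5.left⟩) rfl hB' hP hQ hx' hy'
      (hc ⟨1, ![b', x]⟩ (by simp))
    (hc ⟨1, ![b', y]⟩ (by simp)) h5 h6).symm

/-- The canonical path in the Gajer space between two points of a full simplex. -/
noncomputable def affPath (hF : F.LocallyFiniteStratification) {l : SimplexCategoryᵒᵖ}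
    {σ : (TopCat.toSSet.obj (TopCat.of X)).obj l} (hσ : p.Full σ)
    (x y : TopSimplex l.unop.len) {P Q : (p.gajer : SSet.{u}) _⦋0⦌}
    (hP : P.1 = sub σ (op ⦋0⦌) ![x]) (hQ : Q.1 = sub σ (op ⦋0⦌) ![y]) :
    FundGroupoid.vert P ⟶ FundGroupoid.vert Q :=
  have h := exists_common_cone_point hF hσ (hP ▸ P.2) (hQ ▸ Q.2)
  pathVia σ h.choose x y (B := ⟨_, h.choose_spec.1.left⟩) rfl hP hQ h.choose_spec.1 h.choose_spec.2

section

variable (hF : F.LocallyFiniteStratification) {l : SimplexCategoryᵒᵖ}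
    {σ : (TopCat.toSSet.obj (TopCat.of X)).obj l} (hσ : p.Full σ)

lemma affPath_eq_pathVia (b x y : TopSimplex l.unop.len) {B P Q : (p.gajer : SSet.{u}) _⦋0⦌}
    (hB : B.1 = sub σ (op ⦋0⦌) ![b])
    (hP : P.1 = sub σ (op ⦋0⦌) ![x]) (hQ : Q.1 = sub σ (op ⦋0⦌) ![y])
    (hx : p.Full (sub σ (op ⦋1⦌) ![b, x])) (hy : p.Full (sub σ (op ⦋1⦌) ![b, y])) :
    affPath hF hσ x y hP hQ = pathVia σ b x y hB hP hQ hx hy :=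
  pathVia_eq hF hσ _ _ x y _ _ hP hQ _ _ _ _

/-- One point that is generic for `x`, `y` and `z` computes all three paths at once, and the two
passages through `y` cancel. -/
lemma affPath_trans (x y z : TopSimplex l.unop.len) {P Q R : (p.gajer : SSet.{u}) _⦋0⦌}
    (hP : P.1 = sub σ (op ⦋0⦌) ![x]) (hQ : Q.1 = sub σ (op ⦋0⦌) ![y])
    (hR : R.1 = sub σ (op ⦋0⦌) ![z]) :
    affPath hF hσ x y hP hQ ≫ affPath hF hσ y z hQ hR = affPath hF hσ x z hP hR := by
  obtain ⟨b, hb⟩ := p.exists_cone_point_list hF hσ [⟨0, ![x]⟩, ⟨0, ![y]⟩, ⟨0, ![z]⟩] (by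
    simp [← hP, ← hQ, ← hR, show ∀ P : (p.gajer : SSet.{u}) _⦋0⦌, p.Full P.1
      from fun P => P.2])
  have hx : p.Full (sub σ (op ⦋1⦌) ![b, x]) := hb ⟨0, ![x]⟩ (by simp)
  have hy : p.Full (sub σ (op ⦋1⦌) ![b, y]) := hb ⟨0, ![y]⟩ (by simp)
  have hz : p.Full (sub σ (op ⦋1⦌) ![b, z]) := hb ⟨0, ![z]⟩ (by simp)
  rw [affPath_eq_pathVia hF hσ b x y (B := ⟨_, hx.left⟩) rfl hP hQ hx hy,
    affPath_eq_pathVia hF hσ b y z (B := ⟨_, hx.left⟩) rfl hQ hR hy hz,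
    affPath_eq_pathVia hF hσ b x z (B := ⟨_, hx.left⟩) rfl hP hR hx hz]
  simp [pathVia]

/-- The generic cone on the edge is a full triangle. This makes the canonical transport agree with
the transport in the differential of `chains`. -/
lemma affPath_eq_edge (x y : TopSimplex l.unop.len) {P Q : (p.gajer : SSet.{u}) _⦋0⦌}
    (hP : P.1 = sub σ (op ⦋0⦌) ![x]) (hQ : Q.1 = sub σ (op ⦋0⦌) ![y])
    (h : p.Full (sub σ (op ⦋1⦌) ![x, y])) :
    affPath hF hσ x y hP hQ = FundGroupoid.edge (affEdge σ x y hP hQ h) := by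
  obtain ⟨b, hb⟩ := p.exists_cone_point_list hF hσ [⟨0, ![x]⟩, ⟨0, ![y]⟩, ⟨1, ![x, y]⟩] (by
    simp [h, h.left, h.right])
  have hx : p.Full (sub σ (op ⦋1⦌) ![b, x]) := hb ⟨0, ![x]⟩ (by simp)
  have hy : p.Full (sub σ (op ⦋1⦌) ![b, y]) := hb ⟨0, ![y]⟩ (by simp)
  have hxy : p.Full (sub σ (op ⦋2⦌) ![b, x, y]) := hb ⟨1, ![x, y]⟩ (by simp)
  rw [affPath_eq_pathVia hF hσ b x y (B := ⟨_, hx.left⟩) rfl hP hQ hx hy]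
  exact (IsIso.inv_comp_eq _).2 (affEdge_comp σ b x y rfl hP hQ hxy hx h hy).symm

lemma affPath_self (x : TopSimplex l.unop.len) {P : (p.gajer : SSet.{u}) _⦋0⦌}
    (hP : P.1 = sub σ (op ⦋0⦌) ![x]) : affPath hF hσ x x hP hP = 𝟙 _ := by
  simp [affPath, pathVia]

lemma sub_sub_zero {m : SimplexCategoryᵒᵖ} (σ : (TopCat.toSSet.obj (TopCat.of X)).obj l)
    (w : Fin (m.unop.len + 1) → TopSimplex l.unop.len)
    (x : TopSimplex m.unop.len) :
    sub (sub σ m w) (op ⦋0⦌) ![x] = sub σ (op ⦋0⦌) ![affMap w x] := by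
  rw [sub_sub]
  congr 1
  funext i
  fin_cases i
  rfl

lemma sub_sub_one {m : SimplexCategoryᵒᵖ} (σ : (TopCat.toSSet.obj (TopCat.of X)).obj l)
    (w : Fin (m.unop.len + 1) → TopSimplex l.unop.len)
    (x y : TopSimplex m.unop.len) :
    sub (sub σ m w) (op ⦋1⦌) ![x, y] = sub σ (op ⦋1⦌) ![affMap w x, affMap w y] := by
  rw [sub_sub]
  congr 1
  funext i
  fin_cases i <;> rfl

lemma affEdge_sub {m : SimplexCategoryᵒᵖ} (w : Fin (m.unop.len + 1) → TopSimplex l.unop.len)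
    (x y : TopSimplex m.unop.len) {P Q : (p.gajer : SSet.{u}) _⦋0⦌}
    (hP : P.1 = sub (sub σ m w) (op ⦋0⦌) ![x]) (hQ : Q.1 = sub (sub σ m w) (op ⦋0⦌) ![y])
    (hP' : P.1 = sub σ (op ⦋0⦌) ![affMap w x]) (hQ' : Q.1 = sub σ (op ⦋0⦌) ![affMap w y])
    (h : p.Full (sub (sub σ m w) (op ⦋1⦌) ![x, y]))
    (h' : p.Full (sub σ (op ⦋1⦌) ![affMap w x, affMap w y])) :
    affEdge (sub σ m w) x y hP hQ h = affEdge σ _ _ hP' hQ' h' :=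
  SSet.Edge.ext (Subtype.ext (sub_sub_one σ w x y))

/-- A path through a generic point of the subsimplex is a path through the image of this point in
`σ`. That image need not be generic in `σ`; fullness of the two edges suffices, by independence of
the cone point. -/
lemma affPath_sub {m : SimplexCategoryᵒᵖ} (w : Fin (m.unop.len + 1) → TopSimplex l.unop.len)
    (hw : p.Full (sub σ m w)) (x y : TopSimplex m.unop.len) {P Q : (p.gajer : SSet.{u}) _⦋0⦌}
    (hP : P.1 = sub (sub σ m w) (op ⦋0⦌) ![x]) (hQ : Q.1 = sub (sub σ m w) (op ⦋0⦌) ![y])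
    (hP' : P.1 = sub σ (op ⦋0⦌) ![affMap w x]) (hQ' : Q.1 = sub σ (op ⦋0⦌) ![affMap w y]) :
    affPath hF hw x y hP hQ = affPath hF hσ (affMap w x) (affMap w y) hP' hQ' := by
  obtain ⟨b, hx, hy⟩ := exists_common_cone_point hF hw (hP ▸ P.2) (hQ ▸ Q.2)
  have hx' : p.Full (sub σ (op ⦋1⦌) ![affMap w b, affMap w x]) := sub_sub_one σ w b x ▸ hx
  have hy' : p.Full (sub σ (op ⦋1⦌) ![affMap w b, affMap w y]) := sub_sub_one σ w b y ▸ hy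
  have hB : (⟨_, hx.left⟩ : (p.gajer : SSet.{u}) _⦋0⦌).1 = sub σ (op ⦋0⦌) ![affMap w b] :=
    sub_sub_zero σ w b
  rw [affPath_eq_pathVia hF hw b x y (B := ⟨_, hx.left⟩) rfl hP hQ hx hy,
    affPath_eq_pathVia hF hσ (affMap w b) _ _ hB hP' hQ' hx' hy']
  simp only [pathVia, affEdge_sub w b x rfl hP hB hP' hx hx',
    affEdge_sub w b y rfl hQ hB hQ' hy hy']

end

end Perversity
end PerverseSpace

/-! ### Transport of coefficients inside a full simplex -/

namespace PerverseSpace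
namespace Perversity

variable {X : Type u} [TopologicalSpace X] {n : ℕ} {F : Filtration X n} {p : Perversity F}

/-- The affine simplex of `σ` with vertices `v`, if it is full. -/
noncomputable def subGajer {l : SimplexCategoryᵒᵖ} (σ : (TopCat.toSSet.obj (TopCat.of X)).obj l)
    (k : SimplexCategoryᵒᵖ) (v : Fin (k.unop.len + 1) → TopSimplex l.unop.len)
    (h : p.Full (sub σ k v)) : (p.gajer : SSet.{u}).obj k :=
  ⟨sub σ k v, h⟩

lemma gajer_map_val {l m : SimplexCategoryᵒᵖ} (θ : l ⟶ m) (σ : (p.gajer : SSet.{u}).obj l) :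
    ((p.gajer : SSet.{u}).map θ σ).1 = (TopCat.toSSet.obj (TopCat.of X)).map θ σ.1 := rfl

lemma gajer_map_subGajer_val {l k m : SimplexCategoryᵒᵖ}
    (σ : (TopCat.toSSet.obj (TopCat.of X)).obj l)
    {v : Fin (k.unop.len + 1) → TopSimplex l.unop.len} (h : p.Full (sub σ k v)) (θ : k ⟶ m)
    {w : Fin (m.unop.len + 1) → TopSimplex l.unop.len} (hw : ∀ i, v (θ.unop i) = w i) :
    ((p.gajer : SSet.{u}).map θ (subGajer σ k v h)).1 = sub σ m w :=
  congrArg Subtype.val (gajer_map_sub σ h θ (Q := subGajer σ m w (h.sub_congr θ hw)) rfl hw)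

lemma inv_map_op_comp {C D : Type*} [Groupoid C] [Category D] (E : Cᵒᵖ ⥤ D) {a b c : C}
    {f : a ⟶ b} {g : b ⟶ c} {h : a ⟶ c} (hfg : f ≫ g = h) :
    inv (E.map f.op) ≫ inv (E.map g.op) = inv (E.map h.op) := by
  subst hfg
  simp

lemma vertex_val {l : SimplexCategoryᵒᵖ} (τ : (p.gajer : SSet.{u}).obj l)
    (i : Fin (l.unop.len + 1)) :
    (vertex τ i).1 = sub τ.1 (op ⦋0⦌) ![stdSimplex.vertex i] := by
  refine (map_eq_sub τ.1 (SimplexCategory.const ⦋0⦌ l.unop i).op).trans ?_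
  congr 1
  funext j
  fin_cases j
  rfl

lemma vertex_sub_val {l k : SimplexCategoryᵒᵖ} {σ : (TopCat.toSSet.obj (TopCat.of X)).obj l}
    {v : Fin (k.unop.len + 1) → TopSimplex l.unop.len} (τ : (p.gajer : SSet.{u}).obj k)
    (hτ : τ.1 = sub σ k v) (i : Fin (k.unop.len + 1)) :
    (vertex τ i).1 = sub σ (op ⦋0⦌) ![v i] := by
  rw [vertex_val, hτ, sub_sub_zero, affMap_vertex]

/-- Transport along the canonical path between two points of a full simplex. -/
noncomputable def affTransport (hF : F.LocallyFiniteStratification)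
    (E : LocalSystem.{u, w} (p.gajer : SSet.{u})) {l : SimplexCategoryᵒᵖ}
    {σ : (TopCat.toSSet.obj (TopCat.of X)).obj l} (hσ : p.Full σ)
    (x y : TopSimplex l.unop.len) {P Q : (p.gajer : SSet.{u}) _⦋0⦌}
    (hP : P.1 = sub σ (op ⦋0⦌) ![x]) (hQ : Q.1 = sub σ (op ⦋0⦌) ![y]) : E.at P ⟶ E.at Q :=
  inv (E.map (affPath hF hσ x y hP hQ).op)

section

variable (hF : F.LocallyFiniteStratification) (E : LocalSystem.{u, w} (p.gajer : SSet.{u}))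
  {l : SimplexCategoryᵒᵖ} {σ : (TopCat.toSSet.obj (TopCat.of X)).obj l} (hσ : p.Full σ)

lemma affTransport_trans (x y z : TopSimplex l.unop.len) {P Q R : (p.gajer : SSet.{u}) _⦋0⦌}
    (hP : P.1 = sub σ (op ⦋0⦌) ![x]) (hQ : Q.1 = sub σ (op ⦋0⦌) ![y])
    (hR : R.1 = sub σ (op ⦋0⦌) ![z]) :
    affTransport hF E hσ x y hP hQ ≫ affTransport hF E hσ y z hQ hR =
      affTransport hF E hσ x z hP hR :=
  inv_map_op_comp E (affPath_trans hF hσ x y z hP hQ hR)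

lemma affTransport_self (x : TopSimplex l.unop.len) {P : (p.gajer : SSet.{u}) _⦋0⦌}
    (hP : P.1 = sub σ (op ⦋0⦌) ![x]) : affTransport hF E hσ x x hP hP = 𝟙 _ := by
  simp [affTransport, affPath_self]

lemma affTransport_sub {m : SimplexCategoryᵒᵖ}
    (w : Fin (m.unop.len + 1) → TopSimplex l.unop.len)
    {τ : (TopCat.toSSet.obj (TopCat.of X)).obj m} (hτ : p.Full τ) (hw : τ = sub σ m w)
    (x y : TopSimplex m.unop.len) {x' y' : TopSimplex l.unop.len} (hx : x' = affMap w x)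
    (hy : y' = affMap w y) {P Q : (p.gajer : SSet.{u}) _⦋0⦌}
    (hP : P.1 = sub τ (op ⦋0⦌) ![x]) (hQ : Q.1 = sub τ (op ⦋0⦌) ![y])
    (hP' : P.1 = sub σ (op ⦋0⦌) ![x']) (hQ' : Q.1 = sub σ (op ⦋0⦌) ![y']) :
    affTransport hF E hτ x y hP hQ = affTransport hF E hσ x' y' hP' hQ' := by
  subst hw hx hy
  simp only [affTransport, affPath_sub hF hσ w hτ x y hP hQ hP' hQ']

/-- The edge from vertex 0 to vertex `i` is a face or a degeneracy of a vertex of the full simplex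
`τ`, hence full, so `affPath_eq_edge` applies. -/
lemma transport_eq_affTransport (τ : (p.gajer : SSet.{u}).obj l) (i : Fin (l.unop.len + 1))
    {Q : (p.gajer : SSet.{u}) _⦋0⦌} (hQ : Q = vertex τ i)
    (hQ' : Q.1 = sub τ.1 (op ⦋0⦌) ![stdSimplex.vertex i]) :
    E.transport τ i hQ = affTransport hF E τ.2 (stdSimplex.vertex 0) (stdSimplex.vertex i)
      (vertex_val τ 0) hQ' := by
  have e : ((p.gajer : SSet.{u}).map (SimplexCategory.mkOfLe (n := l.unop.len) 0 i
      (Fin.zero_le i)).op τ).1 =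
      sub τ.1 (op ⦋1⦌) ![stdSimplex.vertex 0, stdSimplex.vertex i] := by
    refine (map_eq_sub τ.1 (SimplexCategory.mkOfLe (n := l.unop.len) 0 i
      (Fin.zero_le i)).op).trans ?_
    congr 1
    funext j
    fin_cases j <;> rfl
  have h : p.Full (sub τ.1 (op ⦋1⦌) ![stdSimplex.vertex 0, stdSimplex.vertex i]) :=
    e ▸ ((p.gajer : SSet.{u}).map (SimplexCategory.mkOfLe (n := l.unop.len) 0 i
      (Fin.zero_le i)).op τ).2
  have e' : edgeTo τ i hQ = affEdge τ.1 _ _ (vertex_val τ 0) hQ' h :=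
    SSet.Edge.ext (Subtype.ext e)
  simp only [LocalSystem.transport, affTransport, e', affPath_eq_edge hF τ.2 _ _ _ hQ' h]

lemma transport_sub_eq_affTransport {k : SimplexCategoryᵒᵖ} (τ : (p.gajer : SSet.{u}).obj k)
    {v : Fin (k.unop.len + 1) → TopSimplex l.unop.len} (hτ : τ.1 = sub σ k v)
    (i : Fin (k.unop.len + 1)) {Q : (p.gajer : SSet.{u}) _⦋0⦌} (hQ : Q = vertex τ i)
    (hP' : (vertex τ 0).1 = sub σ (op ⦋0⦌) ![v 0]) (hQ' : Q.1 = sub σ (op ⦋0⦌) ![v i]) :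
    E.transport τ i hQ = affTransport hF E hσ (v 0) (v i) hP' hQ' := by
  rw [transport_eq_affTransport hF E τ i hQ (hQ ▸ vertex_val τ i)]
  exact affTransport_sub hF E hσ v τ.2 hτ _ _ (affMap_vertex v 0).symm (affMap_vertex v i).symm
    _ _ _ _

end

/-! ### Chains of affine simplices -/

/-- A simplex of the Gajer space of `X`, as a simplex of its largest subcomplex. -/
def toUniv {l : SimplexCategoryᵒᵖ} (σ : (p.gajer : SSet.{u}).obj l) :
    (p.gajerIn Set.univ).obj l :=
  ⟨σ, fun _ => Set.mem_univ _⟩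

variable (hF : F.LocallyFiniteStratification) (E : LocalSystem.{u, w} (p.gajer : SSet.{u}))

/-- The group of chains of the Gajer space of `X`. -/
abbrev GajerChainGroup (k : ℕ) : Type (max u w) := ChainGroup E (p.gajerIn Set.univ) (op ⦋k⦌)

/-- The boundary of a chain of the Gajer space of `X`. -/
noncomputable def boundary (j : ℕ) : GajerChainGroup E (j + 1) →+ GajerChainGroup E j :=
  ((chains E (p.gajerIn Set.univ)).d (j + 1) j).hom

lemma boundary_single (j : ℕ) (σ : (p.gajer : SSet.{u}).obj (op ⦋j + 1⦌))
    (a : E.at (vertex σ 0)) :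
    boundary E j (single E _ (toUniv σ) a) = ∑ i : Fin (j + 2), (-1 : ℤ) ^ (i : ℕ) •
      single E _ (toUniv ((p.gajer : SSet.{u}).map (SimplexCategory.δ i).op σ))
        (E.transport σ (SimplexCategory.δ i 0) (vertex_map (SimplexCategory.δ i).op σ 0) a) :=
  chains_d_single E _ j (toUniv σ) a

section

variable {l : SimplexCategoryᵒᵖ} (σ : (p.gajer : SSet.{u}).obj l)

open Classical in
/-- The chain `a τ`, where `τ` is the affine simplex of `σ` with vertices `v` if this is full;
the coefficient `a` at the first vertex of `σ` is transported to the first vertex of `τ`. -/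
noncomputable def affChain (k : ℕ) (v : Fin (k + 1) → TopSimplex l.unop.len) :
    E.at (vertex σ 0) →+ GajerChainGroup E k :=
  if h : p.Full (sub σ.1 (op ⦋k⦌) v) then
    (single E _ (toUniv (subGajer σ.1 (op ⦋k⦌) v h))).comp
      (affTransport hF E σ.2 (stdSimplex.vertex 0) (v 0) (vertex_val σ 0)
        (vertex_sub_val (subGajer σ.1 (op ⦋k⦌) v h) rfl 0)).hom
  else 0

lemma single_affTransport_congr {k : SimplexCategoryᵒᵖ} {x y : TopSimplex l.unop.len}
    {τ τ' : (p.gajer : SSet.{u}).obj k} (h : τ = τ') {P : (p.gajer : SSet.{u}) _⦋0⦌}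
    (hP : P.1 = sub σ.1 (op ⦋0⦌) ![x]) (hQ : (vertex τ 0).1 = sub σ.1 (op ⦋0⦌) ![y])
    (hQ' : (vertex τ' 0).1 = sub σ.1 (op ⦋0⦌) ![y]) (a : E.at P) :
    single E _ (toUniv τ) (affTransport hF E σ.2 x y hP hQ a) =
      single E _ (toUniv τ') (affTransport hF E σ.2 x y hP hQ' a) := by
  subst h
  rfl

/-- Both the simplex `τ` and the endpoint `y` of the transport are free up to propositional
equality; this absorbs the dependence of the coefficient group on the first vertex. -/
lemma affChain_apply {k : ℕ} {v : Fin (k + 1) → TopSimplex l.unop.len}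
    {y : TopSimplex l.unop.len} (hy : v 0 = y) (τ : (p.gajer : SSet.{u}).obj (op ⦋k⦌))
    (hτ : τ.1 = sub σ.1 (op ⦋k⦌) v) (hQ : (vertex τ 0).1 = sub σ.1 (op ⦋0⦌) ![y])
    (a : E.at (vertex σ 0)) :
    affChain hF E σ k v a = single E _ (toUniv τ)
      (affTransport hF E σ.2 (stdSimplex.vertex 0) y (vertex_val σ 0) hQ a) := by
  subst hy
  have h : p.Full (sub σ.1 (op ⦋k⦌) v) := hτ ▸ τ.2
  rw [affChain, dif_pos h]
  exact single_affTransport_congr hF E σ (Subtype.ext hτ.symm) _ _ _ a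

/-- The map from chains of tuples to chains of affine simplices of `σ`. -/
noncomputable def affChains (k : ℕ) :
    TupleChains (TopSimplex l.unop.len) k →ₗ[ℤ] (E.at (vertex σ 0) →+ GajerChainGroup E k) :=
  Finsupp.linearCombination ℤ (affChain hF E σ k)

lemma affChains_single (k : ℕ) (v : Fin (k + 1) → TopSimplex l.unop.len) :
    affChains hF E σ k (Finsupp.single v 1) = affChain hF E σ k v := by
  simp [affChains]

/-- The tuples that are the vertices of a full affine simplex of `σ`. -/
def fullTuples (p : Perversity F) {l : SimplexCategoryᵒᵖ}
    (σ : (TopCat.toSSet.obj (TopCat.of X)).obj l) (k : ℕ) :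
    Set (Fin (k + 1) → TopSimplex l.unop.len) :=
  {v | p.Full (sub σ (op ⦋k⦌) v)}

/-- The transport to the first vertex of a simplex followed by that to the first vertex of a face is
the direct transport. The support condition is essential: a tuple that is not full is sent to 0,
while some of its faces may be full. -/
lemma boundary_affChains (k : ℕ) {c : TupleChains (TopSimplex l.unop.len) (k + 1)}
    (hc : c ∈ Finsupp.supported ℤ ℤ (fullTuples p σ.1 (k + 1))) (a : E.at (vertex σ 0)) :
    boundary E k (affChains hF E σ (k + 1) c a) =
      affChains hF E σ k (TupleChains.d k c) a := by
  rw [Finsupp.supported_eq_span_single] at hc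
  induction hc using Submodule.span_induction with
  | zero => simp
  | add x y _ _ hx hy => simp only [map_add, AddMonoidHom.add_apply, hx, hy]
  | smul r x _ hx => simp only [map_zsmul, AddMonoidHom.zsmul_apply, hx]
  | mem x hx =>
    obtain ⟨v, hv, rfl⟩ := hx
    have h0 : (vertex (subGajer σ.1 (op ⦋k + 1⦌) v hv) 0).1 =
      sub σ.1 (op ⦋0⦌) ![v 0] := vertex_sub_val _ rfl 0
    rw [affChains_single, TupleChains.d_single, map_sum, AddMonoidHom.finsetSum_apply,
      affChain_apply hF E σ rfl (subGajer σ.1 (op ⦋k + 1⦌) v hv) rfl h0, boundary_single]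
    refine Finset.sum_congr rfl fun i _ => ?_
    rw [map_zsmul, AddMonoidHom.zsmul_apply, affChains_single]
    congr 1
    have e : ((p.gajer : SSet.{u}).map (SimplexCategory.δ i).op
        (subGajer σ.1 (op ⦋k + 1⦌) v hv)).1 =
        sub σ.1 (op ⦋k⦌) (v ∘ i.succAbove) :=
      gajer_map_subGajer_val σ.1 hv (SimplexCategory.δ i).op fun _ => rfl
    have h1 := vertex_sub_val ((p.gajer : SSet.{u}).map (SimplexCategory.δ i).op
        (subGajer σ.1 (op ⦋k + 1⦌) v hv)) e 0
    rw [affChain_apply hF E σ rfl _ e h1]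
    have h2 := (congrArg (affTransport hF E σ.2 (stdSimplex.vertex 0) (v 0) (vertex_val σ 0) h0 ≫ ·)
      (transport_sub_eq_affTransport hF E σ.2 (subGajer σ.1 (op ⦋k + 1⦌) v hv) rfl
        (SimplexCategory.δ i 0) (vertex_map (SimplexCategory.δ i).op _ 0) h0 h1)).trans
      (affTransport_trans hF E σ.2 (stdSimplex.vertex 0) (v 0) _ (vertex_val σ 0) h0 h1)
    exact congrArg _ (ConcreteCategory.congr_hom h2 a)

/-- An affine simplex of `θ^*σ` is an affine simplex of `σ`, and the transport through the first
vertex of `θ^*σ` is the direct one. No support condition is needed because a tuple and its image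
under `θ` are full simultaneously. -/
lemma affChains_face {m : SimplexCategoryᵒᵖ} (θ : l ⟶ m) (k : ℕ)
    (c : TupleChains (TopSimplex m.unop.len) k) (a : E.at (vertex σ 0)) :
    affChains hF E ((p.gajer : SSet.{u}).map θ σ) k c
      (E.transport σ (θ.unop 0) (vertex_map θ σ 0) a) =
    affChains hF E σ k (TupleChains.push (stdSimplex.map θ.unop) c) a := by
  have key : ∀ v : Fin (k + 1) → TopSimplex m.unop.len,
      affChain hF E ((p.gajer : SSet.{u}).map θ σ) k v
        (E.transport σ (θ.unop 0) (vertex_map θ σ 0) a) =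
      affChain hF E σ k (stdSimplex.map θ.unop ∘ v) a := by
    intro v
    have e : sub ((p.gajer : SSet.{u}).map θ σ).1 (op ⦋k⦌) v =
        sub σ.1 (op ⦋k⦌) (stdSimplex.map θ.unop ∘ v) := by
      rw [gajer_map_val, sub_map]
      rfl
    by_cases h : p.Full (sub σ.1 (op ⦋k⦌) (stdSimplex.map θ.unop ∘ v))
    · have h0 := vertex_sub_val (subGajer σ.1 (op ⦋k⦌) _ h) rfl 0
      have h0' := vertex_sub_val (subGajer σ.1 (op ⦋k⦌) _ h) e.symm 0
      have h1 : (vertex ((p.gajer : SSet.{u}).map θ σ) 0).1 =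
          sub σ.1 (op ⦋0⦌) ![stdSimplex.vertex (θ.unop 0)] := by
        rw [vertex_map]
        exact vertex_val σ _
      rw [affChain_apply hF E σ rfl (subGajer σ.1 (op ⦋k⦌) _ h) rfl h0,
        affChain_apply hF E _ rfl (subGajer σ.1 (op ⦋k⦌) _ h) e.symm h0']
      have h2 := affTransport_sub hF E σ.2 (fun i => stdSimplex.vertex (θ.unop i))
        ((p.gajer : SSet.{u}).map θ σ).2 (map_eq_sub σ.1 θ) (stdSimplex.vertex 0) (v 0)
        (affMap_vertex (fun i => stdSimplex.vertex (θ.unop i)) 0).symm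
        (stdSimplex_map_eq_affMap θ.unop (v 0)) (vertex_val _ 0) h0' h1 h0
      have h3 := (congrArg₂ (· ≫ ·) (transport_eq_affTransport hF E σ (θ.unop 0)
        (vertex_map θ σ 0) h1) h2).trans
        (affTransport_trans hF E σ.2 _ _ _ (vertex_val σ 0) h1 h0)
      exact congrArg _ (ConcreteCategory.congr_hom h3 a)
    · rw [affChain, affChain, dif_neg h, dif_neg (e ▸ h)]
      rfl
  induction c using Finsupp.induction_linear with
  | zero => simp
  | add x y hx hy => simp only [map_add, AddMonoidHom.add_apply, hx, hy]
  | single v r =>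
    have hr : (Finsupp.single v r : TupleChains (TopSimplex m.unop.len) k) =
      r • Finsupp.single v 1 := by simp
    rw [hr]
    simp only [map_zsmul, AddMonoidHom.zsmul_apply, TupleChains.push_single, affChains_single, key]

lemma affChains_vertex {k : ℕ} (σ : (p.gajer : SSet.{u}).obj (op ⦋k⦌)) (a : E.at (vertex σ 0)) :
    affChains hF E σ k (Finsupp.single (fun i => stdSimplex.vertex i) 1) a =
      single E _ (toUniv σ) a := by
  rw [affChains_single, affChain_apply hF E σ rfl σ (sub_vertex σ.1).symm (vertex_val σ 0)]
  exact congrArg _ (ConcreteCategory.congr_hom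
    (affTransport_self hF E σ.2 (stdSimplex.vertex 0) (vertex_val σ 0)) a)

end

end Perversity
end PerverseSpace

namespace PerverseSpace

/-! ### Contraction estimates -/

/-- Closed balls are convex: apply this first to balls around the vertices, then to the ball around
the image of `y`. -/
lemma dist_affMap_le {l N : ℕ} (w : Fin (l + 1) → TopSimplex N) {D : ℝ}
    (hw : ∀ i j, dist (w i) (w j) ≤ D) (x y : TopSimplex l) :
    dist (affMap w x) (affMap w y) ≤ D := by
  have h1 : ∀ (z : Fin (N + 1) → ℝ), (∀ i, dist (w i).1 z ≤ D) → ∀ x : TopSimplex l,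
      dist (affMap w x).1 z ≤ D := by
    intro z hz x
    change (affMap w x).1 ∈ Metric.closedBall z D
    change Fintype.linearCombination ℝ (fun i => (w i).1) x.1 ∈ _
    rw [Fintype.linearCombination_apply]
    exact (convex_closedBall z D).sum_mem (fun i _ => x.2.1 i) x.2.2 fun i _ => hz i
  refine h1 _ (fun i => ?_) x
  rw [dist_comm]
  exact h1 _ (fun j => hw j i) y

/-- Every affine map to a simplex with vertices of mutual distance at most `D` sends
`x` and `y` to points of distance at most `r D`. -/
def Contract {l : ℕ} (r : ℝ) (x y : TopSimplex l) : Prop :=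
  ∀ (N : ℕ) (w : Fin (l + 1) → TopSimplex N) (D : ℝ), (∀ i j, dist (w i) (w j) ≤ D) →
    dist (affMap w x) (affMap w y) ≤ r * D

namespace Contract

variable {l : ℕ} {r : ℝ} {x y : TopSimplex l}

lemma refl (hr : 0 ≤ r) (x : TopSimplex l) : Contract r x x := by
  intro N w D hw
  rw [dist_self]
  exact mul_nonneg hr (dist_nonneg.trans (hw 0 0))

lemma symm (h : Contract r x y) : Contract r y x := by
  intro N w D hw
  rw [dist_comm]
  exact h N w D hw

lemma mono (h : Contract r x y) {r' : ℝ} (hr : r ≤ r') : Contract r' x y := fun N w D hw =>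
  (h N w D hw).trans (mul_le_mul_of_nonneg_right hr (dist_nonneg.trans (hw 0 0)))

lemma map (h : Contract r x y) {m : ℕ} (θ : Fin (l + 1) → Fin (m + 1)) :
    Contract (l := m) r (stdSimplex.map θ x) (stdSimplex.map θ y) := by
  intro N w D hw
  rw [affMap_map, affMap_map]
  exact h N (w ∘ θ) D fun i j => hw _ _

/-- Since `b i ≥ c ≥ c * x i`, one can write `b = c x + (1 - c) u` with `u` in the simplex. Then `b
- x = (1 - c) (u - x)`, also after an affine map. -/
lemma of_le {c : ℝ} (hc0 : 0 ≤ c) (hc1 : c < 1) {b : TopSimplex l} (hb : ∀ i, c ≤ b i)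
    (x : TopSimplex l) : Contract (1 - c) b x := by
  intro N w D hw
  have h1c : 0 < 1 - c := sub_pos.2 hc1
  let u : TopSimplex l := ⟨fun i => (b i - c * x i) / (1 - c), fun i => by
      refine div_nonneg ?_ h1c.le
      have := mul_le_mul_of_nonneg_left (stdSimplex.le_one x i) hc0
      linarith [hb i], by
      rw [← Finset.sum_div, Finset.sum_sub_distrib, ← Finset.mul_sum, stdSimplex.sum_eq_one,
        stdSimplex.sum_eq_one, mul_one, div_self h1c.ne']⟩
  have hu : ∀ i, b i = c * x i + (1 - c) * u i := fun i => by
    change b i = c * x i + (1 - c) * ((b i - c * x i) / (1 - c))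
    field_simp
    ring
  have h2 := dist_affMap_le w hw u x
  have h3 : (affMap w b).1 - (affMap w x).1 = (1 - c) • ((affMap w u).1 - (affMap w x).1) := by
    funext j
    change affMap w b j - affMap w x j = (1 - c) * (affMap w u j - affMap w x j)
    simp only [affMap_apply_apply, hu, add_mul, Finset.sum_add_distrib, mul_assoc,
      ← Finset.mul_sum]
    ring
  rw [Subtype.dist_eq, dist_eq_norm] at h2 ⊢
  rw [h3, norm_smul, Real.norm_of_nonneg h1c.le]
  exact mul_le_mul_of_nonneg_left h2 h1c.le

end Contract

namespace Perversity

variable {X : Type u} [TopologicalSpace X] {n : ℕ} {F : Filtration X n} {p : Perversity F}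

/-! ### Generic subdivision -/

lemma exists_conePoint (hF : F.LocallyFiniteStratification) {l : ℕ}
    (σ : (p.gajer : SSet.{u}) _⦋l⦌) (Z : Finset (Σ k : ℕ, Fin (k + 1) → TopSimplex l)) :
    ∃ b : TopSimplex l, (∀ i, 1 / ((l : ℝ) + 2) ≤ b i) ∧
      ∀ z ∈ Z, z.2 ∈ p.fullTuples σ.1 z.1 → Fin.cons b z.2 ∈ p.fullTuples σ.1 (z.1 + 1) := by
  obtain ⟨b, hb, h⟩ := p.exists_cone_point hF σ.2
    (Z := {z | z ∈ Z ∧ z.2 ∈ p.fullTuples σ.1 z.1})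
    (Z.finite_toSet.subset fun z hz => hz.1) fun z hz => hz.2
  exact ⟨b, hb, fun z hz hz' => h z ⟨hz, hz'⟩⟩

/-- A point in general position with respect to the full members of `Z`. -/
noncomputable def conePoint (hF : F.LocallyFiniteStratification) {l : ℕ}
    (σ : (p.gajer : SSet.{u}) _⦋l⦌) (Z : Finset (Σ k : ℕ, Fin (k + 1) → TopSimplex l)) :
    TopSimplex l :=
  (exists_conePoint hF σ Z).choose

/-- The chain of tuples of `σ` formed from chains of tuples of its faces. -/
noncomputable def faceSum {l k : ℕ} (g : (p.gajer : SSet.{u}) _⦋l⦌ → TupleChains (TopSimplex l) k)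
    (σ : (p.gajer : SSet.{u}) _⦋l + 1⦌) : TupleChains (TopSimplex (l + 1)) k :=
  ∑ i : Fin (l + 2), (-1 : ℤ) ^ (i : ℕ) •
    TupleChains.push (stdSimplex.map (SimplexCategory.δ i).op.unop)
      (g ((p.gajer : SSet.{u}).map (SimplexCategory.δ i).op σ))

/-- The identity tuple of a simplex. -/
noncomputable def idChain (l : ℕ) : TupleChains (TopSimplex l) l :=
  Finsupp.single (fun i => stdSimplex.vertex i) 1

open Classical in
/-- The subdivision of a simplex with generic cone points, and the homotopy to it from the
identity. -/
noncomputable def subdivision (hF : F.LocallyFiniteStratification) (l : ℕ) :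
    (p.gajer : SSet.{u}) _⦋l⦌ → TupleChains (TopSimplex l) l × TupleChains (TopSimplex l) (l + 1) :=
  Nat.rec (motive := fun l => (p.gajer : SSet.{u}) _⦋l⦌ →
      TupleChains (TopSimplex l) l × TupleChains (TopSimplex l) (l + 1))
    -- Points are not subdivided, hence the homotopy vanishes in degree 0.
    (fun _ => (idChain 0, 0))
    (fun l ih σ =>
      let z := faceSum (fun τ => (ih τ).1) σ
      let y := idChain (l + 1) - faceSum (fun τ => (ih τ).2) σ
      -- The same apex serves for the subdivision and the homotopy. This makes the cone on the
      -- subdivided boundary, which appears in the boundary of the homotopy, equal to the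
      -- subdivision.
      let b := conePoint hF σ (z.support.image (fun v => ⟨l, v⟩) ∪
        y.support.image (fun v => ⟨l + 1, v⟩))
      (TupleChains.cone b z, TupleChains.cone b y)) l

/-- The recursion is stated before the tuples involved are known to be full, so fullness enters as
implications; `subdivision_mem_supported` discharges them by induction. -/
lemma subdivision_succ (hF : F.LocallyFiniteStratification) (l : ℕ)
    (σ : (p.gajer : SSet.{u}) _⦋l + 1⦌) :
    ∃ b : TopSimplex (l + 1), (∀ i, 1 / ((l : ℝ) + 3) ≤ b i) ∧
      (faceSum (fun τ => (subdivision hF l τ).1) σ ∈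
          Finsupp.supported ℤ ℤ (p.fullTuples σ.1 l) →
        (subdivision hF (l + 1) σ).1 ∈ Finsupp.supported ℤ ℤ (p.fullTuples σ.1 (l + 1))) ∧
      (idChain (l + 1) - faceSum (fun τ => (subdivision hF l τ).2) σ ∈
          Finsupp.supported ℤ ℤ (p.fullTuples σ.1 (l + 1)) →
        (subdivision hF (l + 1) σ).2 ∈ Finsupp.supported ℤ ℤ (p.fullTuples σ.1 (l + 2))) ∧
      (subdivision hF (l + 1) σ).1 =
        TupleChains.cone b (faceSum (fun τ => (subdivision hF l τ).1) σ) ∧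
      (subdivision hF (l + 1) σ).2 =
        TupleChains.cone b (idChain (l + 1) - faceSum (fun τ => (subdivision hF l τ).2) σ) := by
  classical
  have h := (exists_conePoint hF σ
    (((faceSum (fun τ => (subdivision hF l τ).1) σ).support.image (fun v => ⟨l, v⟩)) ∪
      ((idChain (l + 1) - faceSum (fun τ => (subdivision hF l τ).2) σ).support.image
        (fun v => ⟨l + 1, v⟩)))).choose_spec
  refine ⟨_, fun i => ?_, fun hz => ?_, fun hy => ?_, rfl, rfl⟩
  · refine le_trans (le_of_eq ?_) (h.1 i)
    push_cast
    ring
  -- The apex is generic only for the finitely many tuples in the support, not for all full tuples.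
  · refine TupleChains.cone_mem_supported (S := p.fullTuples σ.1 l ∩
      (faceSum (fun τ => (subdivision hF l τ).1) σ).support) (fun v hv => ?_) ?_
    · exact h.2 ⟨l, v⟩ (Finset.mem_union_left _ (Finset.mem_image_of_mem _ hv.2)) hv.1
    · exact fun v hv => ⟨hz hv, hv⟩
  · refine TupleChains.cone_mem_supported (S := p.fullTuples σ.1 (l + 1) ∩
      (idChain (l + 1) - faceSum (fun τ => (subdivision hF l τ).2) σ).support) (fun v hv => ?_) ?_
    · exact h.2 ⟨l + 1, v⟩ (Finset.mem_union_right _ (Finset.mem_image_of_mem _ hv.2)) hv.1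
    · exact fun v hv => ⟨hy hv, hv⟩

lemma d_faceSum {l k : ℕ} (g : (p.gajer : SSet.{u}) _⦋l⦌ → TupleChains (TopSimplex l) (k + 1))
    (σ : (p.gajer : SSet.{u}) _⦋l + 1⦌) :
    TupleChains.d k (faceSum g σ) = faceSum (fun τ => TupleChains.d k (g τ)) σ := by
  simp only [faceSum, map_sum, map_zsmul, TupleChains.d_push]

lemma faceSum_faceSum {l k : ℕ} (g : (p.gajer : SSet.{u}) _⦋l⦌ → TupleChains (TopSimplex l) k)
    (σ : (p.gajer : SSet.{u}) _⦋l + 2⦌) : faceSum (faceSum g) σ = 0 := by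
  have h := sum_sum_face_comp_eq_zero (m := l) fun θ =>
    TupleChains.push (k := k) (stdSimplex.map θ) (g ((p.gajer : SSet.{u}).map θ.op σ))
  rw [← h]
  simp only [faceSum, map_sum, map_zsmul, TupleChains.push_push]
  refine Finset.sum_congr rfl fun i _ => congrArg _ (Finset.sum_congr rfl fun j _ =>
    congrArg _ ?_)
  have e : (p.gajer : SSet.{u}).map (SimplexCategory.δ j ≫ SimplexCategory.δ i).op σ =
      (p.gajer : SSet.{u}).map (SimplexCategory.δ j).op
        ((p.gajer : SSet.{u}).map (SimplexCategory.δ i).op σ) := by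
    rw [op_comp, Functor.map_comp_apply]
  rw [e]
  congr 2
  funext x
  exact stdSimplex.map_comp_apply _ _ x

lemma faceSum_sub {l k : ℕ} (g g' : (p.gajer : SSet.{u}) _⦋l⦌ → TupleChains (TopSimplex l) k)
    (σ : (p.gajer : SSet.{u}) _⦋l + 1⦌) :
    faceSum (fun τ => g τ - g' τ) σ = faceSum g σ - faceSum g' σ := by
  rw [faceSum, faceSum, faceSum, ← Finset.sum_sub_distrib]
  refine Finset.sum_congr rfl fun i _ => ?_
  rw [← smul_sub]
  exact congrArg _ (LinearMap.map_sub _ _ _)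

lemma faceSum_idChain {l : ℕ} (σ : (p.gajer : SSet.{u}) _⦋l + 1⦌) :
    faceSum (fun _ => idChain l) σ = TupleChains.d l (idChain (l + 1)) := by
  simp only [faceSum, idChain, TupleChains.push_single, TupleChains.d_single]
  refine Finset.sum_congr rfl fun i _ => ?_
  congr 2
  funext j
  exact stdSimplex.map_vertex _ _

lemma faceSum_mem_supported {l k : ℕ}
    {g : (p.gajer : SSet.{u}) _⦋l⦌ → TupleChains (TopSimplex l) k}
    {S : (p.gajer : SSet.{u}) _⦋l⦌ → Set (Fin (k + 1) → TopSimplex l)}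
    {S' : Set (Fin (k + 1) → TopSimplex (l + 1))} (hg : ∀ τ, g τ ∈ Finsupp.supported ℤ ℤ (S τ))
    (σ : (p.gajer : SSet.{u}) _⦋l + 1⦌)
    (h : ∀ (i : Fin (l + 2)), ∀ v ∈ S ((p.gajer : SSet.{u}).map (SimplexCategory.δ i).op σ),
      stdSimplex.map (SimplexCategory.δ i).op.unop ∘ v ∈ S') :
    faceSum g σ ∈ Finsupp.supported ℤ ℤ S' :=
  Submodule.sum_mem _ fun i _ => Submodule.smul_of_tower_mem _ _
    (TupleChains.push_mem_supported (h i) (hg _))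

lemma map_comp_mem_fullTuples {l m : SimplexCategoryᵒᵖ} (θ : l ⟶ m)
    (σ : (p.gajer : SSet.{u}).obj l) {k : ℕ} {v : Fin (k + 1) → TopSimplex m.unop.len}
    (hv : v ∈ p.fullTuples ((p.gajer : SSet.{u}).map θ σ).1 k) :
    stdSimplex.map θ.unop ∘ v ∈ p.fullTuples σ.1 k := by
  have h : p.Full (sub ((p.gajer : SSet.{u}).map θ σ).1 (op ⦋k⦌) v) := hv
  rw [gajer_map_val, sub_map] at h
  exact h

lemma idChain_mem_supported {l : ℕ} (σ : (p.gajer : SSet.{u}) _⦋l⦌) :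
    idChain l ∈ Finsupp.supported ℤ ℤ (p.fullTuples σ.1 l) := by
  refine Finsupp.single_mem_supported ℤ _ ?_
  have h : p.Full σ.1 := σ.2
  rw [← sub_vertex σ.1] at h
  exact h

lemma subdivision_mem_supported (hF : F.LocallyFiniteStratification) (l : ℕ)
    (σ : (p.gajer : SSet.{u}) _⦋l⦌) :
    (subdivision hF l σ).1 ∈ Finsupp.supported ℤ ℤ (p.fullTuples σ.1 l) ∧
    (subdivision hF l σ).2 ∈ Finsupp.supported ℤ ℤ (p.fullTuples σ.1 (l + 1)) := by
  induction l with
  | zero => exact ⟨idChain_mem_supported σ, Submodule.zero_mem _⟩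
  | succ l ih =>
    obtain ⟨b, -, h1, h2, -, -⟩ := subdivision_succ hF l σ
    refine ⟨h1 ?_, h2 (Submodule.sub_mem _ (idChain_mem_supported σ) ?_)⟩
    · exact faceSum_mem_supported (fun τ => (ih τ).1) σ fun i v hv =>
        map_comp_mem_fullTuples (SimplexCategory.δ i).op σ hv
    · exact faceSum_mem_supported (fun τ => (ih τ).2) σ fun i v hv =>
        map_comp_mem_fullTuples (SimplexCategory.δ i).op σ hv

/-- In the boundary of a cone, the term besides the base is the cone on the boundary of the base.
Here it vanishes because the base is a subdivided boundary: by induction and `faceSum_faceSum`, or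
in the lowest degree because the augmentation is `1 - 1`. -/
lemma d_subdivision_fst (hF : F.LocallyFiniteStratification) (l : ℕ)
    (σ : (p.gajer : SSet.{u}) _⦋l + 1⦌) :
    TupleChains.d l (subdivision hF (l + 1) σ).1 =
      faceSum (fun τ => (subdivision hF l τ).1) σ := by
  induction l with
  | zero =>
    obtain ⟨b, -, -, -, h, -⟩ := subdivision_succ hF 0 σ
    rw [h, TupleChains.d_cone_zero]
    have : TupleChains.aug (faceSum (fun τ => (subdivision hF 0 τ).1) σ) = 0 := by
      have e : ∀ i : Fin 2, TupleChains.aug (TupleChains.push (stdSimplex.map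
          (SimplexCategory.δ (n := 0) i).op.unop) (idChain 0)) = 1 := fun i =>
        (TupleChains.aug_push _ _).trans (by simp [TupleChains.aug, idChain])
      simp only [faceSum, map_sum, map_zsmul]
      exact (Fin.sum_univ_two _).trans
        ((congrArg₂ (· + ·) (congrArg _ (e 0)) (congrArg _ (e 1))).trans (by norm_num))
    rw [this, zero_smul, sub_zero]
  | succ l ih =>
    obtain ⟨b, -, -, -, h, -⟩ := subdivision_succ hF (l + 1) σ
    rw [h, TupleChains.d_cone, d_faceSum]
    simp only [ih]
    rw [faceSum_faceSum, map_zero, sub_zero]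

lemma d_subdivision_snd_zero (hF : F.LocallyFiniteStratification)
    (σ : (p.gajer : SSet.{u}) _⦋0⦌) :
    TupleChains.d 0 (subdivision hF 0 σ).2 = idChain 0 - (subdivision hF 0 σ).1 := by
  simp [subdivision]

/-- By induction, the boundary of the base `y` is the subdivided boundary of the simplex; the cone
on it is the subdivision, since the apex is the same. -/
lemma d_subdivision_snd (hF : F.LocallyFiniteStratification) (l : ℕ)
    (σ : (p.gajer : SSet.{u}) _⦋l + 1⦌) :
    TupleChains.d (l + 1) (subdivision hF (l + 1) σ).2 = idChain (l + 1) -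
      (subdivision hF (l + 1) σ).1 - faceSum (fun τ => (subdivision hF l τ).2) σ := by
  induction l with
  | zero =>
    obtain ⟨b, -, -, -, h1, h2⟩ := subdivision_succ hF 0 σ
    rw [h2, h1, TupleChains.d_cone, map_sub, d_faceSum]
    simp only [d_subdivision_snd_zero]
    rw [faceSum_sub, faceSum_idChain, sub_sub_cancel]
    abel
  | succ l ih =>
    obtain ⟨b, -, -, -, h1, h2⟩ := subdivision_succ hF (l + 1) σ
    rw [h2, h1, TupleChains.d_cone, map_sub, d_faceSum]
    simp only [ih]
    rw [faceSum_sub, faceSum_sub, faceSum_faceSum, faceSum_idChain, sub_zero, sub_sub_cancel]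
    abel

/-- Pairs containing the apex contract by `Contract.of_le`. The other pairs come from faces, where
the factor is even smaller: it increases with the dimension. -/
lemma subdivision_contract (hF : F.LocallyFiniteStratification) (l : ℕ)
    (σ : (p.gajer : SSet.{u}) _⦋l⦌) :
    (subdivision hF l σ).1 ∈ Finsupp.supported ℤ ℤ
      {v | ∀ i j, Contract (1 - 1 / ((l : ℝ) + 2)) (v i) (v j)} := by
  induction l with
  | zero =>
    refine Finsupp.single_mem_supported ℤ _ fun i j => ?_
    rw [Subsingleton.elim (α := Fin 1) i j]
    exact Contract.refl (by norm_num) _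
  | succ l ih =>
    obtain ⟨b, hb, -, -, h, -⟩ := subdivision_succ hF l σ
    have hc : (1 : ℝ) / ((l : ℝ) + 3) < 1 := by
      rw [div_lt_one (by positivity)]
      linarith [(Nat.cast_nonneg l : (0 : ℝ) ≤ l)]
    have e : (((l + 1 : ℕ) : ℝ) + 2) = (l : ℝ) + 3 := by push_cast; ring
    rw [h, e]
    refine TupleChains.cone_mem_supported (S := {v | ∀ i j,
      Contract (1 - 1 / ((l : ℝ) + 3)) (v i) (v j)}) (fun v hv i j => ?_)
      (faceSum_mem_supported ih σ fun i v hv j k => ?_)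
    · have hbx : ∀ x, Contract (1 - 1 / ((l : ℝ) + 3)) b x :=
        Contract.of_le (by positivity) hc hb
      refine Fin.cases ?_ (fun i => ?_) i <;> refine Fin.cases ?_ (fun j => ?_) j
      · exact hbx _
      · exact hbx _
      · exact (hbx _).symm
      · exact hv i j
    · refine ((hv j k).mono ?_).map _
      gcongr
      norm_num

end Perversity
end PerverseSpace

namespace PerverseSpace
namespace Perversity

variable {X : Type u} [TopologicalSpace X] {n : ℕ} {F : Filtration X n} {p : Perversity F}

/-! ### The subdivision operator on chains -/

section

variable (hF : F.LocallyFiniteStratification) (E : LocalSystem.{u, w} (p.gajer : SSet.{u}))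

open Classical in
/-- The operator `a σ ↦ a g(σ)` on chains, given chains of affine simplices `g(σ)`. -/
noncomputable def chainExtend {k m : ℕ}
    (g : (p.gajer : SSet.{u}) _⦋k⦌ → TupleChains (TopSimplex k) m) :
    GajerChainGroup E k →+ GajerChainGroup E m :=
  DirectSum.toAddMonoid fun σ => affChains hF E σ.1 m (g σ.1)

lemma chainExtend_single_subtype {k m : ℕ}
    (g : (p.gajer : SSet.{u}) _⦋k⦌ → TupleChains (TopSimplex k) m)
    (σ : (p.gajerIn Set.univ).obj (op ⦋k⦌)) (a : E.at (vertex σ.1 0)) :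
    chainExtend hF E g (single E _ σ a) = affChains hF E σ.1 m (g σ.1) a := by
  classical
  simp only [chainExtend, single]
  convert DirectSum.toAddMonoid_of
    (fun σ : (p.gajerIn Set.univ).obj (op ⦋k⦌) => affChains hF E σ.1 m (g σ.1)) σ a

lemma chainExtend_single {k m : ℕ}
    (g : (p.gajer : SSet.{u}) _⦋k⦌ → TupleChains (TopSimplex k) m)
    (σ : (p.gajer : SSet.{u}) _⦋k⦌) (a : E.at (vertex σ 0)) :
    chainExtend hF E g (single E _ (toUniv σ) a) = affChains hF E σ m (g σ) a :=
  chainExtend_single_subtype hF E g (toUniv σ) a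

variable {E} in
lemma gajerChainGroup_hom_ext {k : ℕ} {G : Type*} [AddCommGroup G]
    {f g : GajerChainGroup E k →+ G}
    (h : ∀ (σ : (p.gajer : SSet.{u}) _⦋k⦌) (a : E.at (vertex σ 0)),
      f (single E _ (toUniv σ) a) = g (single E _ (toUniv σ) a)) : f = g :=
  chainGroup_hom_ext fun σ a => h σ.1 a

lemma boundary_chainExtend {k m : ℕ}
    {g : (p.gajer : SSet.{u}) _⦋k⦌ → TupleChains (TopSimplex k) (m + 1)}
    (hg : ∀ σ : (p.gajer : SSet.{u}) _⦋k⦌, g σ ∈ Finsupp.supported ℤ ℤ (p.fullTuples σ.1 (m + 1)))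
    (c : GajerChainGroup E k) :
    boundary E m (chainExtend hF E g c) =
      chainExtend hF E (fun σ => TupleChains.d m (g σ)) c := by
  revert c
  refine DFunLike.congr_fun (f := (boundary E m).comp (chainExtend hF E g))
    (gajerChainGroup_hom_ext fun σ a => ?_)
  rw [AddMonoidHom.comp_apply, chainExtend_single, chainExtend_single,
    boundary_affChains hF E σ m (hg σ)]

/-- The transport of the coefficient in the face opposite to the first vertex is absorbed by
`affChains_face`. So all chain identities reduce to identities between tuples. -/
lemma chainExtend_boundary {k m : ℕ}
    (g : (p.gajer : SSet.{u}) _⦋k⦌ → TupleChains (TopSimplex k) m)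
    (c : GajerChainGroup E (k + 1)) :
    chainExtend hF E g (boundary E k c) = chainExtend hF E (faceSum g) c := by
  revert c
  refine DFunLike.congr_fun (f := (chainExtend hF E g).comp (boundary E k))
    (gajerChainGroup_hom_ext fun σ a => ?_)
  rw [AddMonoidHom.comp_apply, chainExtend_single, boundary_single, map_sum, faceSum, map_sum,
    AddMonoidHom.finsetSum_apply]
  refine Finset.sum_congr rfl fun i _ => ?_
  rw [map_zsmul, chainExtend_single, map_zsmul, AddMonoidHom.zsmul_apply]
  exact congrArg _ (affChains_face hF E σ (SimplexCategory.δ i).op m _ a)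

lemma chainExtend_idChain {k : ℕ} (c : GajerChainGroup E k) :
    chainExtend hF E (fun _ => idChain k) c = c := by
  revert c
  refine DFunLike.congr_fun (g := AddMonoidHom.id _) (gajerChainGroup_hom_ext fun σ a => ?_)
  rw [chainExtend_single]
  exact affChains_vertex hF E σ a

lemma chainExtend_sub {k m : ℕ}
    (g g' : (p.gajer : SSet.{u}) _⦋k⦌ → TupleChains (TopSimplex k) m) (c : GajerChainGroup E k) :
    chainExtend hF E (fun σ => g σ - g' σ) c = chainExtend hF E g c - chainExtend hF E g' c := by
  revert c
  refine DFunLike.congr_fun (g := chainExtend hF E g - chainExtend hF E g')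
    (gajerChainGroup_hom_ext fun σ a => ?_)
  rw [AddMonoidHom.sub_apply, chainExtend_single, chainExtend_single, chainExtend_single, map_sub,
    AddMonoidHom.sub_apply]

/-- The subdivision operator. -/
noncomputable def sdOp (k : ℕ) : GajerChainGroup E k →+ GajerChainGroup E k :=
  chainExtend hF E fun σ => (subdivision hF k σ).1

/-- The homotopy between the identity and the subdivision operator. -/
noncomputable def sdHomotopy (k : ℕ) : GajerChainGroup E k →+ GajerChainGroup E (k + 1) :=
  chainExtend hF E fun σ => (subdivision hF k σ).2

lemma boundary_sdOp (k : ℕ) (c : GajerChainGroup E (k + 1)) :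
    boundary E k (sdOp hF E (k + 1) c) = sdOp hF E k (boundary E k c) := by
  rw [sdOp, sdOp, boundary_chainExtend hF E fun σ => (subdivision_mem_supported hF _ σ).1,
    chainExtend_boundary]
  simp only [d_subdivision_fst]

lemma boundary_sdHomotopy_zero (c : GajerChainGroup E 0) :
    boundary E 0 (sdHomotopy hF E 0 c) = c - sdOp hF E 0 c := by
  rw [sdHomotopy, boundary_chainExtend hF E fun σ => (subdivision_mem_supported hF _ σ).2]
  simp only [d_subdivision_snd_zero]
  rw [chainExtend_sub, chainExtend_idChain, sdOp]

lemma boundary_sdHomotopy (k : ℕ) (c : GajerChainGroup E (k + 1)) :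
    boundary E (k + 1) (sdHomotopy hF E (k + 1) c) =
      c - sdOp hF E (k + 1) c - sdHomotopy hF E k (boundary E k c) := by
  rw [sdHomotopy, boundary_chainExtend hF E fun σ => (subdivision_mem_supported hF _ σ).2]
  simp only [d_subdivision_snd]
  rw [chainExtend_sub, chainExtend_sub, chainExtend_idChain, sdHomotopy, chainExtend_boundary, sdOp]

/-! ### Supports of chains, and smallness of iterated subdivisions -/

/-- The chains supported on a set of simplices. -/
noncomputable def chainsOn {k : ℕ} (S : Set ((p.gajer : SSet.{u}) _⦋k⦌)) :
    AddSubgroup (GajerChainGroup E k) :=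
  AddSubgroup.closure {x | ∃ σ ∈ S, ∃ a : E.at (vertex σ 0), x = single E _ (toUniv σ) a}

lemma single_mem_chainsOn {k : ℕ} {S : Set ((p.gajer : SSet.{u}) _⦋k⦌)}
    {σ : (p.gajer : SSet.{u}) _⦋k⦌} (hσ : σ ∈ S) (a : E.at (vertex σ 0)) :
    single E _ (toUniv σ) a ∈ chainsOn E S :=
  AddSubgroup.subset_closure ⟨σ, hσ, a, rfl⟩

lemma chainsOn_mono {k : ℕ} {S S' : Set ((p.gajer : SSet.{u}) _⦋k⦌)} (h : S ⊆ S') :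
    chainsOn E S ≤ chainsOn E S' :=
  AddSubgroup.closure_mono fun _ ⟨σ, hσ, a, e⟩ => ⟨σ, h hσ, a, e⟩

lemma map_mem_chainsOn {k : ℕ} {G : Type*} [AddCommGroup G] {S : Set ((p.gajer : SSet.{u}) _⦋k⦌)}
    {f : GajerChainGroup E k →+ G} {H : AddSubgroup G}
    (h : ∀ σ ∈ S, ∀ a : E.at (vertex σ 0), f (single E _ (toUniv σ) a) ∈ H)
    {c : GajerChainGroup E k} (hc : c ∈ chainsOn E S) : f c ∈ H := by
  have : chainsOn E S ≤ H.comap f := by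
    refine (AddSubgroup.closure_le _).2 ?_
    rintro _ ⟨σ, hσ, a, rfl⟩
    exact h σ hσ a
  exact this hc

lemma chainsOn_univ {k : ℕ} (c : GajerChainGroup E k) :
    c ∈ chainsOn E (Set.univ : Set ((p.gajer : SSet.{u}) _⦋k⦌)) := by
  have h : (QuotientAddGroup.mk' (chainsOn E (Set.univ : Set ((p.gajer : SSet.{u}) _⦋k⦌)))) =
      0 := gajerChainGroup_hom_ext fun σ a =>
    (QuotientAddGroup.eq_zero_iff _).2 (single_mem_chainsOn E (Set.mem_univ σ) a)
  exact (QuotientAddGroup.eq_zero_iff _).1 (DFunLike.congr_fun h c)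

lemma chainExtend_mem_chainsOn {k m : ℕ}
    {g : (p.gajer : SSet.{u}) _⦋k⦌ → TupleChains (TopSimplex k) m}
    {S : Set ((p.gajer : SSet.{u}) _⦋k⦌)} {S' : Set ((p.gajer : SSet.{u}) _⦋m⦌)}
    (h : ∀ σ ∈ S, ∀ v ∈ (g σ).support, ∀ hv : p.Full (sub σ.1 (op ⦋m⦌) v),
      subGajer σ.1 (op ⦋m⦌) v hv ∈ S')
    {c : GajerChainGroup E k} (hc : c ∈ chainsOn E S) : chainExtend hF E g c ∈ chainsOn E S' := by
  refine map_mem_chainsOn E (fun σ hσ a => ?_) hc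
  rw [chainExtend_single, affChains, Finsupp.linearCombination_apply, Finsupp.sum,
    AddMonoidHom.finsetSum_apply]
  refine AddSubgroup.sum_mem _ fun v hv => ?_
  rw [AddMonoidHom.zsmul_apply]
  refine AddSubgroup.zsmul_mem _ ?_ _
  by_cases hf : p.Full (sub σ.1 (op ⦋m⦌) v)
  · rw [affChain, dif_pos hf]
    exact single_mem_chainsOn E (h σ hσ v hv hf) _
  · rw [affChain, dif_neg hf]
    exact zero_mem _

/-- The simplices with image in a member of `𝒰`. -/
def smallSimplices (p : Perversity F) (𝒰 : Set (Set X)) (k : ℕ) :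
    Set ((p.gajer : SSet.{u}) _⦋k⦌) :=
  {σ | σ ∈ (p.gajerSmall 𝒰).obj (op ⦋k⦌)}

/-- An affine simplex of `σ` has image in the image of `σ`; nothing about `g` matters. -/
lemma chainExtend_mem_small {𝒰 : Set (Set X)} {k m : ℕ}
    (g : (p.gajer : SSet.{u}) _⦋k⦌ → TupleChains (TopSimplex k) m)
    {c : GajerChainGroup E k} (hc : c ∈ chainsOn E (p.smallSimplices 𝒰 k)) :
    chainExtend hF E g c ∈ chainsOn E (p.smallSimplices 𝒰 m) := by
  refine chainExtend_mem_chainsOn hF E (fun σ hσ v _ hv => ?_) hc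
  obtain ⟨U, hU, h⟩ := hσ
  refine ⟨U, hU, fun x => ?_⟩
  have e : singMap (sub σ.1 (op ⦋m⦌) v) x = singMap σ.1 (affMap v x) := singMap_sub_apply _ _ _ _
  exact e.symm ▸ h _

/-- The affine simplices of `σ` with vertices of mutual distance at most `D`. -/
def fineSimplices {l : ℕ} (σ : (p.gajer : SSet.{u}) _⦋l⦌) (k : ℕ) (D : ℝ) :
    Set ((p.gajer : SSet.{u}) _⦋k⦌) :=
  {τ | ∃ w : Fin (k + 1) → TopSimplex l, τ.1 = sub σ.1 (op ⦋k⦌) w ∧ ∀ i j, dist (w i) (w j) ≤ D}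

lemma sub_mem_fineSimplices {l k : ℕ} {σ : (p.gajer : SSet.{u}) _⦋l⦌} {D D' : ℝ}
    {τ : (p.gajer : SSet.{u}) _⦋k⦌} (hτ : τ ∈ fineSimplices σ k D) {v : Fin (k + 1) → TopSimplex k}
    (hv : ∀ (l : ℕ) (w : Fin (k + 1) → TopSimplex l), (∀ i j, dist (w i) (w j) ≤ D) →
      ∀ i j, dist (affMap w (v i)) (affMap w (v j)) ≤ D')
    (hf : p.Full (sub τ.1 (op ⦋k⦌) v)) :
    subGajer τ.1 (op ⦋k⦌) v hf ∈ fineSimplices σ k D' := by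
  obtain ⟨τ, hτ'⟩ := τ
  obtain ⟨w, hw, hD⟩ := hτ
  dsimp only at hw
  subst hw
  exact ⟨_, sub_sub (l := op ⦋l⦌) (m := op ⦋k⦌) (k := op ⦋k⦌) σ.1 w v, hv l w hD⟩

lemma sdOp_mem_fine {l k : ℕ} (σ : (p.gajer : SSet.{u}) _⦋l⦌) {D : ℝ} {c : GajerChainGroup E k}
    (hc : c ∈ chainsOn E (fineSimplices σ k D)) :
    sdOp hF E k c ∈ chainsOn E (fineSimplices σ k ((1 - 1 / ((k : ℝ) + 2)) * D)) := by
  refine chainExtend_mem_chainsOn hF E (fun τ hτ v hv hf => ?_) hc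
  have h : ∀ i j, Contract (1 - 1 / ((k : ℝ) + 2)) (v i) (v j) :=
    subdivision_contract hF k τ hv
  exact sub_mem_fineSimplices hτ (fun l w hD i j => h i j l w D hD) hf

lemma dist_topSimplex_le_one {l : ℕ} (x y : TopSimplex l) : dist x y ≤ 1 :=
  (Metric.dist_le_diam_of_mem (bounded_stdSimplex _) x.2 y.2).trans diam_stdSimplex_le

lemma iterate_sdOp_mem_fine {k : ℕ} (σ : (p.gajer : SSet.{u}) _⦋k⦌) (a : E.at (vertex σ 0))
    (m : ℕ) : (sdOp hF E k)^[m] (single E _ (toUniv σ) a) ∈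
      chainsOn E (fineSimplices σ k ((1 - 1 / ((k : ℝ) + 2)) ^ m)) := by
  induction m with
  | zero =>
    refine single_mem_chainsOn E (S := fineSimplices σ k _)
      ⟨fun i => stdSimplex.vertex i, (sub_vertex σ.1).symm, fun i j => ?_⟩ a
    exact (dist_topSimplex_le_one _ _).trans (by simp)
  | succ m ih =>
    rw [Function.iterate_succ_apply', pow_succ']
    exact sdOp_mem_fine hF E σ ih

/-- A Lebesgue number of the covering of the simplex by the preimages of the interiors. Members of
`𝒰` need not be open, which is what excision requires. -/
lemma exists_fine_subset_small {𝒰 : Set (Set X)} (h𝒰 : ∀ x, ∃ U ∈ 𝒰, x ∈ interior U) {l : ℕ}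
    (σ : (p.gajer : SSet.{u}) _⦋l⦌) (k : ℕ) :
    ∃ δ > 0, ∀ D < δ, fineSimplices σ k D ⊆ p.smallSimplices 𝒰 k := by
  obtain ⟨δ, hδ, h⟩ := lebesgue_number_lemma_of_metric (s := (Set.univ : Set (TopSimplex l)))
    isCompact_univ (c := fun U : 𝒰 => singMap σ.1 ⁻¹' interior U.1)
    (fun U => isOpen_interior.preimage (singMap σ.1).continuous) fun x _ => by
      obtain ⟨U, hU, hx⟩ := h𝒰 (singMap σ.1 x)
      exact Set.mem_iUnion.2 ⟨⟨U, hU⟩, hx⟩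
  refine ⟨δ, hδ, fun D hD τ hτ => ?_⟩
  obtain ⟨w, hw, hwD⟩ := hτ
  obtain ⟨U, hU⟩ := h (w 0) (Set.mem_univ _)
  refine ⟨U.1, U.2, fun x => ?_⟩
  rw [hw]
  have e : singMap (sub σ.1 (op ⦋k⦌) w) x = singMap σ.1 (affMap w x) := singMap_sub_apply _ _ _ _
  refine e.symm ▸ interior_subset (hU ?_)
  rw [Metric.mem_ball, ← affMap_vertex w 0]
  exact (dist_affMap_le w hwD _ _).trans_lt hD

/-- The number of iterations depends on the simplices of the chain; asking for all `m ≥ M` allows a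
common choice for a sum. -/
lemma exists_iterate_sdOp_mem_small {𝒰 : Set (Set X)} (h𝒰 : ∀ x, ∃ U ∈ 𝒰, x ∈ interior U) {k : ℕ}
    (c : GajerChainGroup E k) :
    ∃ M, ∀ m ≥ M, (sdOp hF E k)^[m] c ∈ chainsOn E (p.smallSimplices 𝒰 k) := by
  have h := chainsOn_univ E c
  induction h using AddSubgroup.closure_induction with
  | mem x hx =>
    obtain ⟨σ, -, a, rfl⟩ := hx
    obtain ⟨δ, hδ, h⟩ := exists_fine_subset_small h𝒰 σ k
    have hr0 : (0 : ℝ) ≤ 1 - 1 / ((k : ℝ) + 2) := by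
      rw [sub_nonneg, div_le_one (by positivity)]
      linarith [(Nat.cast_nonneg k : (0 : ℝ) ≤ k)]
    have hr1 : 1 - 1 / ((k : ℝ) + 2) < 1 := sub_lt_self _ (by positivity)
    obtain ⟨M, hM⟩ := exists_pow_lt_of_lt_one hδ hr1
    exact ⟨M, fun m hm => chainsOn_mono E (h _ ((pow_le_pow_of_le_one hr0 hr1.le hm).trans_lt hM))
      (iterate_sdOp_mem_fine hF E σ a m)⟩
  | zero =>
    refine ⟨0, fun m _ => ?_⟩
    rw [iterate_map_zero]
    exact zero_mem _
  | add x y _ _ hx hy =>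
    obtain ⟨M, hM⟩ := hx
    obtain ⟨M', hM'⟩ := hy
    refine ⟨max M M', fun m hm => ?_⟩
    rw [iterate_map_add]
    exact add_mem (hM m (le_of_max_le_left hm)) (hM' m (le_of_max_le_right hm))
  | neg x _ hx =>
    obtain ⟨M, hM⟩ := hx
    refine ⟨M, fun m hm => ?_⟩
    rw [iterate_map_neg]
    exact neg_mem (hM m hm)

/-- A telescoping sum of the differences for one subdivision. The set `Q` stands for all chains in
degree 0 and for the chains with small boundary in positive degrees. -/
lemma sub_iterate_sdOp_mem {𝒰 : Set (Set X)} {k : ℕ} {Q : Set (GajerChainGroup E k)}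
    (hQ : ∀ c ∈ Q, sdOp hF E k c ∈ Q)
    (hstep : ∀ c ∈ Q, ∃ e, c - sdOp hF E k c - boundary E k e ∈
      chainsOn E (p.smallSimplices 𝒰 k)) (m : ℕ) :
    ∀ c ∈ Q, ∃ e, c - (sdOp hF E k)^[m] c - boundary E k e ∈
      chainsOn E (p.smallSimplices 𝒰 k) := by
  induction m with
  | zero =>
    refine fun c _ => ⟨0, ?_⟩
    rw [Function.iterate_zero, id_eq, sub_self, map_zero, sub_zero]
    exact zero_mem _
  | succ m ih =>
    intro c hc
    obtain ⟨e, he⟩ := hstep c hc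
    obtain ⟨e', he'⟩ := ih _ (hQ c hc)
    refine ⟨e + e', ?_⟩
    rw [Function.iterate_succ_apply, map_add]
    convert add_mem he he' using 1
    abel

lemma exists_small_homologous_of_step {𝒰 : Set (Set X)} (h𝒰 : ∀ x, ∃ U ∈ 𝒰, x ∈ interior U)
    {k : ℕ} {Q : Set (GajerChainGroup E k)} (hQ : ∀ c ∈ Q, sdOp hF E k c ∈ Q)
    (hstep : ∀ c ∈ Q, ∃ e, c - sdOp hF E k c - boundary E k e ∈
      chainsOn E (p.smallSimplices 𝒰 k)) {c : GajerChainGroup E k} (hc : c ∈ Q) :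
    ∃ e, c - boundary E k e ∈ chainsOn E (p.smallSimplices 𝒰 k) := by
  obtain ⟨M, hM⟩ := exists_iterate_sdOp_mem_small hF E h𝒰 c
  obtain ⟨e, he⟩ := sub_iterate_sdOp_mem hF E hQ hstep M c hc
  refine ⟨e, ?_⟩
  convert add_mem he (hM M le_rfl) using 1
  abel

lemma exists_small_homologous_zero (hF : F.LocallyFiniteStratification)
    {𝒰 : Set (Set X)} (h𝒰 : ∀ x, ∃ U ∈ 𝒰, x ∈ interior U)
    (c : GajerChainGroup E 0) :
    ∃ e, c - boundary E 0 e ∈ chainsOn E (p.smallSimplices 𝒰 0) := by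
  refine exists_small_homologous_of_step hF E h𝒰 (Q := Set.univ) (fun _ _ => Set.mem_univ _)
    (fun c _ => ⟨sdHomotopy hF E 0 c, ?_⟩) (Set.mem_univ c)
  rw [boundary_sdHomotopy_zero, sub_self]
  exact zero_mem _

/-- With `T` the homotopy, `c - sd c - ∂ T c = T ∂ c`, and this is small because `T` maps small
chains to small chains. -/
lemma exists_small_homologous_succ (hF : F.LocallyFiniteStratification)
    {𝒰 : Set (Set X)} (h𝒰 : ∀ x, ∃ U ∈ 𝒰, x ∈ interior U) {k : ℕ}
    {c : GajerChainGroup E (k + 1)}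
    (hc : boundary E k c ∈ chainsOn E (p.smallSimplices 𝒰 k)) :
    ∃ e, c - boundary E (k + 1) e ∈ chainsOn E (p.smallSimplices 𝒰 (k + 1)) := by
  refine exists_small_homologous_of_step hF E h𝒰
    (Q := {c | boundary E k c ∈ chainsOn E (p.smallSimplices 𝒰 k)}) (fun c hc => ?_)
    (fun c hc => ⟨sdHomotopy hF E (k + 1) c, ?_⟩) hc
  · have h := boundary_sdOp hF E k c
    change boundary E k (sdOp hF E (k + 1) c) ∈ chainsOn E (p.smallSimplices 𝒰 k)
    rw [h]
    exact chainExtend_mem_small hF E _ hc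
  · rw [boundary_sdHomotopy, sub_sub_cancel]
    exact chainExtend_mem_small hF E _ hc

end

end Perversity
end PerverseSpace

namespace PerverseSpace

/-! ### Homology classes in complexes of abelian groups -/

section

variable {C D : ChainComplex AddCommGrpCat.{w} ℕ}

lemma exists_isClassOf {j : ℕ} (c : C.homology j) : ∃ z, IsClassOf C c z := by
  obtain ⟨y, hy⟩ := (AddCommGrpCat.epi_iff_surjective (C.homologyπ j)).1 inferInstance c
  exact ⟨_, y, rfl, hy⟩

lemma exists_cycles_of_d_eq_zero {j : ℕ} {z : C.X j} (hz : ∀ i, (C.d j i).hom z = 0) :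
    ∃ y : C.cycles j, (C.iCycles j).hom y = z :=
  (ShortComplex.ab_exact_iff _).1 (ShortComplex.exact_of_f_is_kernel
    (ShortComplex.mk (C.iCycles j) (C.d j ((ComplexShape.down ℕ).next j)) (C.iCycles_d _ _))
    (C.cyclesIsKernel j _ rfl)) z (hz _)

lemma exists_homology_of_d_eq_zero {j : ℕ} {z : C.X j} (hz : ∀ i, (C.d j i).hom z = 0) :
    ∃ c, IsClassOf C c z := by
  obtain ⟨y, hy⟩ := exists_cycles_of_d_eq_zero hz
  exact ⟨_, y, hy, rfl⟩

lemma iCycles_injective (j : ℕ) : Function.Injective (C.iCycles j).hom :=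
  (AddCommGrpCat.mono_iff_injective (C.iCycles j)).1 inferInstance

namespace IsClassOf

lemma d_eq_zero {j : ℕ} {c : C.homology j} {z : C.X j} (h : IsClassOf C c z) (i : ℕ) :
    (C.d j i).hom z = 0 := by
  obtain ⟨y, rfl, -⟩ := h
  exact ConcreteCategory.congr_hom (C.iCycles_d j i) y

lemma eq {j : ℕ} {c c' : C.homology j} {z : C.X j} (h : IsClassOf C c z)
    (h' : IsClassOf C c' z) : c = c' := by
  obtain ⟨y, hy, rfl⟩ := h
  obtain ⟨y', hy', rfl⟩ := h'
  rw [iCycles_injective j (hy.trans hy'.symm)]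

lemma add {j : ℕ} {c c' : C.homology j} {z z' : C.X j} (h : IsClassOf C c z)
    (h' : IsClassOf C c' z') : IsClassOf C (c + c') (z + z') := by
  obtain ⟨y, rfl, rfl⟩ := h
  obtain ⟨y', rfl, rfl⟩ := h'
  exact ⟨y + y', map_add _ _ _, map_add _ _ _⟩

lemma sub {j : ℕ} {c c' : C.homology j} {z z' : C.X j} (h : IsClassOf C c z)
    (h' : IsClassOf C c' z') : IsClassOf C (c - c') (z - z') := by
  obtain ⟨y, rfl, rfl⟩ := h
  obtain ⟨y', rfl, rfl⟩ := h'
  exact ⟨y - y', map_sub _ _ _, map_sub _ _ _⟩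

lemma map {j : ℕ} {c : C.homology j} {z : C.X j} (h : IsClassOf C c z) (f : C ⟶ D) :
    IsClassOf D ((HomologicalComplex.homologyMap f j).hom c) ((f.f j).hom z) := by
  obtain ⟨y, rfl, rfl⟩ := h
  refine ⟨(HomologicalComplex.cyclesMap f j).hom y, ?_, ?_⟩
  · exact ConcreteCategory.congr_hom (HomologicalComplex.cyclesMap_i f j) y
  · exact (ConcreteCategory.congr_hom (HomologicalComplex.homologyπ_naturality f j) y).symm

lemma of_d (j : ℕ) (w : C.X (j + 1)) : IsClassOf C 0 ((C.d (j + 1) j).hom w) := by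
  refine ⟨(C.toCycles (j + 1) j).hom w, ConcreteCategory.congr_hom (C.toCycles_i (j + 1) j) w, ?_⟩
  exact ConcreteCategory.congr_hom (C.toCycles_comp_homologyπ (j + 1) j) w

lemma exists_d_eq {j : ℕ} {z : C.X j} (h : IsClassOf C 0 z) :
    ∃ w, (C.d (j + 1) j).hom w = z := by
  obtain ⟨y, rfl, hy⟩ := h
  obtain ⟨w, rfl⟩ := (ShortComplex.ab_exact_iff _).1 (ShortComplex.exact_of_g_is_cokernel
    (ShortComplex.mk (C.toCycles (j + 1) j) (C.homologyπ j) (C.toCycles_comp_homologyπ _ _))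
    (C.homologyIsCokernel (j + 1) j (ChainComplex.prev ℕ j))) y hy
  exact ⟨w, (ConcreteCategory.congr_hom (C.toCycles_i (j + 1) j) w).symm⟩

lemma eq_zero {j : ℕ} {c : C.homology j} {w : C.X (j + 1)}
    (h : IsClassOf C c ((C.d (j + 1) j).hom w)) : c = 0 :=
  h.eq (of_d j w)

lemma sub_d {j : ℕ} {c : C.homology j} {z : C.X j} (h : IsClassOf C c z) (w : C.X (j + 1)) :
    IsClassOf C c (z - (C.d (j + 1) j).hom w) := by
  have := h.sub (of_d j w)
  rwa [sub_zero] at this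

end IsClassOf

lemma hom_comm_apply (f : C ⟶ D) (i j : ℕ) (x : C.X i) :
    (D.d i j).hom ((f.f i).hom x) = (f.f j).hom ((C.d i j).hom x) :=
  ConcreteCategory.congr_hom (f.comm i j) x

lemma d_d_apply (C : ChainComplex AddCommGrpCat.{w} ℕ) (i j k : ℕ) (x : C.X i) :
    (C.d j k).hom ((C.d i j).hom x) = 0 :=
  ConcreteCategory.congr_hom (C.d_comp_d i j k) x

lemma d_apply_eq_zero (C : ChainComplex AddCommGrpCat.{w} ℕ) {i j : ℕ} (h : i ≠ j + 1)
    (x : C.X i) : (C.d i j).hom x = 0 :=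
  ConcreteCategory.congr_hom (C.shape i j (fun e => h e.symm)) x

/-- A degreewise injective chain map induces an isomorphism in homology if every chain with
boundary in the image is homologous to a chain in the image. -/
lemma isIso_homologyMap_of_injective (f : C ⟶ D) (hf : ∀ i, Function.Injective (f.f i).hom)
    (h : ∀ (j : ℕ) (q : D.X j), (∀ i, ∃ x, (f.f i).hom x = (D.d j i).hom q) →
      ∃ x e, q = (f.f j).hom x + (D.d (j + 1) j).hom e) (j : ℕ) :
    IsIso (HomologicalComplex.homologyMap f j) := by
  rw [ConcreteCategory.isIso_iff_bijective]
  constructor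
  · refine (injective_iff_map_eq_zero (HomologicalComplex.homologyMap f j).hom).2 fun c hc => ?_
    obtain ⟨z, hz⟩ := exists_isClassOf c
    have hz' := hz.map f
    rw [hc] at hz'
    obtain ⟨w, hw⟩ := hz'.exists_d_eq
    -- A chain `w` bounding the image of `z` has boundary in the image of `f`; replacing it by a
    -- chain from `C` exhibits `z` itself as a boundary, by injectivity.
    obtain ⟨x, e, rfl⟩ := h (j + 1) w fun i => by
      rcases eq_or_ne i j with rfl | hi
      · exact ⟨z, hw.symm⟩
      · exact ⟨0, (map_zero _).trans (d_apply_eq_zero D (by omega) w).symm⟩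
    rw [map_add, d_d_apply, add_zero, hom_comm_apply] at hw
    rw [← hf j hw] at hz
    exact hz.eq_zero
  · intro c
    obtain ⟨z, hz⟩ := exists_isClassOf c
    obtain ⟨x, e, rfl⟩ := h j z fun i => ⟨0, (map_zero _).trans (hz.d_eq_zero i).symm⟩
    obtain ⟨c', hc'⟩ := exists_homology_of_d_eq_zero (C := C) (z := x) fun i => hf i (by
      have h0 := hz.d_eq_zero i
      rw [map_add, d_d_apply, add_zero, hom_comm_apply] at h0
      rw [h0, map_zero])
    refine ⟨c', (hc'.map f).eq ?_⟩
    have := hz.sub_d e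
    rwa [add_sub_cancel_right] at this

end

end PerverseSpace

namespace PerverseSpace

/-! ### The Mayer-Vietoris sequence of a square of chain complexes -/

/-- A commutative square of complexes of abelian groups with `P ⟶ A` and `B ⟶ X` injective, where
`P` is the intersection of `A` and `B` in `X`, and chains of `X` with boundary in `A + B` are
homologous to chains in `A + B`. -/
structure ExcisiveSquare (P A B X : ChainComplex AddCommGrpCat.{w} ℕ) where
  /-- the left map -/
  f : P ⟶ A
  /-- the upper map -/
  g : P ⟶ B
  /-- the lower map -/
  h : A ⟶ X
  /-- the right map -/
  k : B ⟶ X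
  comm : f ≫ h = g ≫ k
  injective_f : ∀ i, Function.Injective (f.f i).hom
  injective_k : ∀ i, Function.Injective (k.f i).hom
  exists_of_eq : ∀ i (a : A.X i) (b : B.X i), (h.f i).hom a = (k.f i).hom b →
    ∃ x, (f.f i).hom x = a
  exists_homologous : ∀ (j : ℕ) (q : X.X j),
    (∀ i, ∃ a b, (X.d j i).hom q = (h.f i).hom a - (k.f i).hom b) →
      ∃ a b e, q = (h.f j).hom a - (k.f j).hom b + (X.d (j + 1) j).hom e

namespace ExcisiveSquare

variable {P A B X : ChainComplex AddCommGrpCat.{w} ℕ} (S : ExcisiveSquare P A B X)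

lemma comm_apply (i : ℕ) (x : P.X i) :
    (S.h.f i).hom ((S.f.f i).hom x) = (S.k.f i).hom ((S.g.f i).hom x) :=
  ConcreteCategory.congr_hom (HomologicalComplex.congr_hom S.comm i) x

lemma exists_of_eq' {i : ℕ} {a : A.X i} {b : B.X i} (e : (S.h.f i).hom a = (S.k.f i).hom b) :
    ∃ x, (S.f.f i).hom x = a ∧ (S.g.f i).hom x = b := by
  obtain ⟨x, rfl⟩ := S.exists_of_eq i a b e
  exact ⟨x, rfl, S.injective_k i ((S.comm_apply i x).symm.trans e)⟩

/-- The difference of the images in `X` of chains in `A` and `B`. -/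
def diff (i : ℕ) (a : A.X i) (b : B.X i) : X.X i := (S.h.f i).hom a - (S.k.f i).hom b

lemma diff_sub (i : ℕ) (a a' : A.X i) (b b' : B.X i) :
    S.diff i (a - a') (b - b') = S.diff i a b - S.diff i a' b' := by
  simp only [diff, map_sub]
  abel

lemma diff_add (i : ℕ) (a a' : A.X i) (b b' : B.X i) :
    S.diff i (a + a') (b + b') = S.diff i a b + S.diff i a' b' := by
  simp only [diff, map_add]
  abel

lemma d_diff (i j : ℕ) (a : A.X i) (b : B.X i) :
    (X.d i j).hom (S.diff i a b) = S.diff j ((A.d i j).hom a) ((B.d i j).hom b) := by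
  rw [diff, map_sub, hom_comm_apply, hom_comm_apply]
  rfl

lemma exists_of_diff_eq_zero {i : ℕ} {a : A.X i} {b : B.X i} (e : S.diff i a b = 0) :
    ∃ x, (S.f.f i).hom x = a ∧ (S.g.f i).hom x = b :=
  S.exists_of_eq' (sub_eq_zero.1 e)

/-- A chain with boundary in the image of `A ⊕ B` can be changed by a boundary
to lie in this image. -/
lemma exists_diff_add_d {j : ℕ} {q : X.X (j + 1)} {a : A.X j} {b : B.X j}
    (hq : (X.d (j + 1) j).hom q = S.diff j a b) :
    ∃ a b e, q = S.diff (j + 1) a b + (X.d (j + 2) (j + 1)).hom e := by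
  refine S.exists_homologous (j + 1) q fun i => ?_
  rcases eq_or_ne i j with rfl | hi
  · exact ⟨a, b, hq⟩
  · exact ⟨0, 0, by rw [map_zero, map_zero, sub_zero]; exact d_apply_eq_zero X (by omega) q⟩

lemma exists_diff_add_d_of_cycle {j : ℕ} {q : X.X j} (hq : ∀ i, (X.d j i).hom q = 0) :
    ∃ a b e, q = S.diff j a b + (X.d (j + 1) j).hom e :=
  S.exists_homologous j q fun i => ⟨0, 0, by rw [hq, map_zero, map_zero, sub_zero]⟩

/-- If the difference of two chains is a boundary in `X`, then up to boundaries in `A` and `B`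
they come from `P`. -/
lemma exists_of_diff_eq_d {j : ℕ} {a : A.X j} {b : B.X j} {q : X.X (j + 1)}
    (hq : (X.d (j + 1) j).hom q = S.diff j a b) :
    ∃ x a' b', a = (S.f.f j).hom x + (A.d (j + 1) j).hom a' ∧
      b = (S.g.f j).hom x + (B.d (j + 1) j).hom b' := by
  obtain ⟨a', b', e, rfl⟩ := S.exists_diff_add_d hq
  -- After replacing `q` by the difference of `a'` and `b'`, the chains `a - d a'` and `b - d b'`
  -- have equal images in `X`, hence come from `P`.
  rw [map_add, d_d_apply, add_zero, d_diff, eq_comm, ← sub_eq_zero, ← diff_sub] at hq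
  obtain ⟨x, hx, hx'⟩ := S.exists_of_diff_eq_zero hq
  exact ⟨x, a', b', by rw [hx, sub_add_cancel], by rw [hx', sub_add_cancel]⟩

lemma d_eq_zero_of_f {j i : ℕ} {x : P.X j} (hx : (A.d j i).hom ((S.f.f j).hom x) = 0) :
    (P.d j i).hom x = 0 :=
  S.injective_f i (by rw [← hom_comm_apply, hx, map_zero])

/-- The graph of the connecting homomorphism. -/
def Rel (j : ℕ) (α : X.homology (j + 1)) (β : P.homology j) : Prop :=
  ∃ (x : A.X (j + 1)) (y : B.X (j + 1)) (z : P.X j),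
    (A.d (j + 1) j).hom x = (S.f.f j).hom z ∧ (B.d (j + 1) j).hom y = (S.g.f j).hom z ∧
      IsClassOf X α (S.diff (j + 1) x y) ∧ IsClassOf P β z

lemma Rel.add {j : ℕ} {α α' : X.homology (j + 1)} {β β' : P.homology j} (r : S.Rel j α β)
    (r' : S.Rel j α' β') : S.Rel j (α + α') (β + β') := by
  obtain ⟨x, y, z, hx, hy, hα, hβ⟩ := r
  obtain ⟨x', y', z', hx', hy', hα', hβ'⟩ := r'
  refine ⟨x + x', y + y', z + z', ?_, ?_, ?_, hβ.add hβ'⟩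
  · rw [map_add, map_add, hx, hx']
  · rw [map_add, map_add, hy, hy']
  · rw [diff_add]
    exact hα.add hα'

lemma Rel.sub {j : ℕ} {α α' : X.homology (j + 1)} {β β' : P.homology j} (r : S.Rel j α β)
    (r' : S.Rel j α' β') : S.Rel j (α - α') (β - β') := by
  obtain ⟨x, y, z, hx, hy, hα, hβ⟩ := r
  obtain ⟨x', y', z', hx', hy', hα', hβ'⟩ := r'
  refine ⟨x - x', y - y', z - z', ?_, ?_, ?_, hβ.sub hβ'⟩
  · rw [map_sub, map_sub, hx, hx']
  · rw [map_sub, map_sub, hy, hy']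
  · rw [diff_sub]
    exact hα.sub hα'

lemma exists_rel (j : ℕ) (α : X.homology (j + 1)) : ∃ β, S.Rel j α β := by
  obtain ⟨q, hq⟩ := exists_isClassOf α
  obtain ⟨a, b, e, rfl⟩ := S.exists_diff_add_d_of_cycle hq.d_eq_zero
  have hq' := hq.sub_d e
  rw [add_sub_cancel_right] at hq'
  have hd := hq'.d_eq_zero j
  rw [d_diff] at hd
  obtain ⟨z, hz, hz'⟩ := S.exists_of_diff_eq_zero hd
  obtain ⟨β, hβ⟩ := exists_homology_of_d_eq_zero (C := P) (z := z) fun i =>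
    S.d_eq_zero_of_f (by rw [hz, d_d_apply])
  exact ⟨β, a, b, z, hz.symm, hz'.symm, hq', hβ⟩

/-- The relation is additive, so this case is all that is needed for the connecting homomorphism to
be well defined and additive. If the difference of `x` and `y` bounds, then up to boundaries both
come from one chain of `P`, and that chain bounds `z`. -/
lemma Rel.eq_zero {j : ℕ} {β : P.homology j} (r : S.Rel j 0 β) : β = 0 := by
  obtain ⟨x, y, z, hx, hy, hα, hβ⟩ := r
  obtain ⟨w, hw⟩ := hα.exists_d_eq
  obtain ⟨t, a, b, rfl, rfl⟩ := S.exists_of_diff_eq_d hw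
  rw [map_add, d_d_apply, add_zero, hom_comm_apply] at hx
  rw [← S.injective_f j hx] at hβ
  exact hβ.eq_zero

lemma Rel.unique {j : ℕ} {α : X.homology (j + 1)} {β β' : P.homology j} (r : S.Rel j α β)
    (r' : S.Rel j α β') : β = β' := by
  have := r.sub S r'
  rw [sub_self] at this
  exact sub_eq_zero.1 (this.eq_zero S)

/-- The connecting homomorphism. -/
noncomputable def δ (j : ℕ) : X.homology (j + 1) ⟶ P.homology j :=
  AddCommGrpCat.ofHom (AddMonoidHom.mk' (fun α => (S.exists_rel j α).choose) fun α α' =>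
    Rel.unique S (S.exists_rel j _).choose_spec
      (((S.exists_rel j α).choose_spec).add S (S.exists_rel j α').choose_spec))

lemma rel_iff {j : ℕ} {α : X.homology (j + 1)} {β : P.homology j} :
    S.Rel j α β ↔ (S.δ j).hom α = β :=
  ⟨fun r => Rel.unique S (S.exists_rel j α).choose_spec r,
    fun e => e ▸ (S.exists_rel j α).choose_spec⟩

/-- The map on homology induced by `f`. -/
noncomputable abbrev Hf (j : ℕ) : P.homology j →+ A.homology j :=
  (HomologicalComplex.homologyMap S.f j).hom
/-- The map on homology induced by `g`. -/
noncomputable abbrev Hg (j : ℕ) : P.homology j →+ B.homology j :=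
  (HomologicalComplex.homologyMap S.g j).hom
/-- The map on homology induced by `h`. -/
noncomputable abbrev Hh (j : ℕ) : A.homology j →+ X.homology j :=
  (HomologicalComplex.homologyMap S.h j).hom
/-- The map on homology induced by `k`. -/
noncomputable abbrev Hk (j : ℕ) : B.homology j →+ X.homology j :=
  (HomologicalComplex.homologyMap S.k j).hom

lemma Hh_Hf (j : ℕ) (β : P.homology j) : S.Hh j (S.Hf j β) = S.Hk j (S.Hg j β) := by
  have e : HomologicalComplex.homologyMap S.f j ≫ HomologicalComplex.homologyMap S.h j =
      HomologicalComplex.homologyMap S.g j ≫ HomologicalComplex.homologyMap S.k j := by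
    rw [← HomologicalComplex.homologyMap_comp, S.comm, HomologicalComplex.homologyMap_comp]
  exact ConcreteCategory.congr_hom e β

lemma isClassOf_diff {j : ℕ} {a : A.homology j} {b : B.homology j} {x : A.X j} {y : B.X j}
    (ha : IsClassOf A a x) (hb : IsClassOf B b y) :
    IsClassOf X (S.Hh j a - S.Hk j b) (S.diff j x y) :=
  (ha.map S.h).sub (hb.map S.k)

lemma exact_middle (j : ℕ) : Function.Exact (fun c : P.homology j => (S.Hf j c, S.Hg j c))
    (fun c : A.homology j × B.homology j => S.Hh j c.1 - S.Hk j c.2) := by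
  rintro ⟨a, b⟩
  constructor
  · intro e
    obtain ⟨x, hx⟩ := exists_isClassOf a
    obtain ⟨y, hy⟩ := exists_isClassOf b
    have h0 := S.isClassOf_diff hx hy
    dsimp only at e
    rw [e] at h0
    obtain ⟨w, hw⟩ := h0.exists_d_eq
    obtain ⟨t, a', b', rfl, rfl⟩ := S.exists_of_diff_eq_d hw
    have hx' := hx.sub_d a'
    have hy' := hy.sub_d b'
    rw [add_sub_cancel_right] at hx' hy'
    obtain ⟨β, hβ⟩ := exists_homology_of_d_eq_zero (C := P) (z := t) fun i =>
      S.d_eq_zero_of_f (hx'.d_eq_zero i)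
    exact ⟨β, Prod.ext ((hβ.map S.f).eq hx') ((hβ.map S.g).eq hy')⟩
  · rintro ⟨β, e⟩
    obtain ⟨rfl, rfl⟩ := Prod.mk.inj e
    exact sub_eq_zero.2 (S.Hh_Hf j β)

lemma exact_right (j : ℕ) : Function.Exact
    (fun c : A.homology (j + 1) × B.homology (j + 1) => S.Hh (j + 1) c.1 - S.Hk (j + 1) c.2)
    (S.δ j) := by
  intro α
  constructor
  · intro e
    obtain ⟨x, y, z, hx, hy, hα, hβ⟩ := S.rel_iff.2 e
    obtain ⟨w, rfl⟩ := hβ.exists_d_eq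
    -- Since `z = d w`, subtracting `w` from both `x` and `y` makes them cycles without changing
    -- their difference in `X`.
    obtain ⟨a, ha⟩ := exists_homology_of_d_eq_zero (C := A) (z := x - (S.f.f (j + 1)).hom w)
      fun i => by
        rcases eq_or_ne i j with rfl | hi
        · rw [map_sub, hx, hom_comm_apply, sub_self]
        · exact d_apply_eq_zero A (by omega) _
    obtain ⟨b, hb⟩ := exists_homology_of_d_eq_zero (C := B) (z := y - (S.g.f (j + 1)).hom w)
      fun i => by
        rcases eq_or_ne i j with rfl | hi
        · rw [map_sub, hy, hom_comm_apply, sub_self]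
        · exact d_apply_eq_zero B (by omega) _
    refine ⟨(a, b), (S.isClassOf_diff ha hb).eq ?_⟩
    have e : S.diff (j + 1) ((S.f.f (j + 1)).hom w) ((S.g.f (j + 1)).hom w) = 0 :=
      sub_eq_zero.2 (S.comm_apply _ w)
    rw [diff_sub, e, sub_zero]
    exact hα
  · rintro ⟨⟨a, b⟩, rfl⟩
    obtain ⟨x, hx⟩ := exists_isClassOf a
    obtain ⟨y, hy⟩ := exists_isClassOf b
    refine S.rel_iff.1 ⟨x, y, 0, ?_, ?_, S.isClassOf_diff hx hy, ⟨0, map_zero _, map_zero _⟩⟩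
    · rw [hx.d_eq_zero, map_zero]
    · rw [hy.d_eq_zero, map_zero]

lemma exact_left (j : ℕ) : Function.Exact (S.δ j)
    (fun c : P.homology j => (S.Hf j c, S.Hg j c)) := by
  intro β
  constructor
  · intro e
    obtain ⟨e₁, e₂⟩ := Prod.mk.inj e
    obtain ⟨z, hz⟩ := exists_isClassOf β
    have h₁ := hz.map S.f
    have h₂ := hz.map S.g
    rw [show (HomologicalComplex.homologyMap S.f j).hom β = 0 from e₁] at h₁
    rw [show (HomologicalComplex.homologyMap S.g j).hom β = 0 from e₂] at h₂
    obtain ⟨x, hx⟩ := h₁.exists_d_eq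
    obtain ⟨y, hy⟩ := h₂.exists_d_eq
    obtain ⟨α, hα⟩ := exists_homology_of_d_eq_zero (C := X) (z := S.diff (j + 1) x y) fun i => by
      rcases eq_or_ne i j with rfl | hi
      · rw [d_diff, hx, hy]
        exact sub_eq_zero.2 (S.comm_apply _ z)
      · exact d_apply_eq_zero X (by omega) _
    exact ⟨α, S.rel_iff.1 ⟨x, y, z, hx, hy, hα, hz⟩⟩
  · rintro ⟨α, rfl⟩
    obtain ⟨x, y, z, hx, hy, -, hβ⟩ := S.rel_iff.2 (rfl : (S.δ j).hom α = (S.δ j).hom α)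
    have h₁ := hβ.map S.f
    have h₂ := hβ.map S.g
    rw [← hx] at h₁
    rw [← hy] at h₂
    exact Prod.ext h₁.eq_zero h₂.eq_zero

lemma surjective_zero : Function.Surjective
    (fun c : A.homology 0 × B.homology 0 => S.Hh 0 c.1 - S.Hk 0 c.2) := by
  intro α
  obtain ⟨q, hq⟩ := exists_isClassOf α
  obtain ⟨x, y, e, rfl⟩ := S.exists_diff_add_d_of_cycle hq.d_eq_zero
  obtain ⟨a, ha⟩ := exists_homology_of_d_eq_zero (C := A) (z := x) fun i =>
    d_apply_eq_zero A (by omega) x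
  obtain ⟨b, hb⟩ := exists_homology_of_d_eq_zero (C := B) (z := y) fun i =>
    d_apply_eq_zero B (by omega) y
  have hq' := hq.sub_d e
  rw [add_sub_cancel_right] at hq'
  exact ⟨(a, b), (S.isClassOf_diff ha hb).eq hq'⟩

end ExcisiveSquare

/-! ### Excision for cokernels of chain maps -/

section

variable {A B A' B' : ChainComplex AddCommGrpCat.{w} ℕ}

lemma cokernel_π_surjective (f : A ⟶ B) (i : ℕ) :
    Function.Surjective ((Limits.cokernel.π f).f i).hom :=
  (AddCommGrpCat.epi_iff_surjective _).1
    (inferInstanceAs (Epi ((HomologicalComplex.eval _ _ i).map (Limits.cokernel.π f))))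

/-- Exactness of complexes is degreewise. With surjectivity of the projection, this replaces the
abstract cokernel by computations with representatives. -/
lemma cokernel_π_eq_zero_iff (f : A ⟶ B) (i : ℕ) (b : B.X i) :
    ((Limits.cokernel.π f).f i).hom b = 0 ↔ ∃ a, (f.f i).hom a = b := by
  constructor
  · exact (ShortComplex.ab_exact_iff _).1 (((HomologicalComplex.exact_iff_degreewise_exact _).1
      (ShortComplex.exact_cokernel f)) i) b
  · rintro ⟨a, rfl⟩
    exact ConcreteCategory.congr_hom
      (HomologicalComplex.congr_hom (Limits.cokernel.condition f) i) a

/-- A map of pairs induces isomorphisms on relative homology if it is injective with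
`A` the intersection of `A'` and `B`, and every chain with boundary in `A' + B` is homologous to
a chain in `A' + B`. -/
lemma isIso_homologyMap_cokernel_map (f : A ⟶ B) (f' : A' ⟶ B') (u : A ⟶ A') (v : B ⟶ B')
    (comm : f ≫ v = u ≫ f')
    (h₁ : ∀ i (b : B.X i) (a : A'.X i), (v.f i).hom b = (f'.f i).hom a → ∃ x, (f.f i).hom x = b)
    (h₂ : ∀ (j : ℕ) (q : B'.X j), (∀ i, ∃ b a, (B'.d j i).hom q = (v.f i).hom b + (f'.f i).hom a) →
      ∃ b a e, q = (v.f j).hom b + (f'.f j).hom a + (B'.d (j + 1) j).hom e) (j : ℕ) :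
    IsIso (HomologicalComplex.homologyMap (Limits.cokernel.map f f' u v comm) j) := by
  have hmap : ∀ i (b : B.X i), ((Limits.cokernel.map f f' u v comm).f i).hom
      (((Limits.cokernel.π f).f i).hom b) = ((Limits.cokernel.π f').f i).hom ((v.f i).hom b) :=
    fun i b => ConcreteCategory.congr_hom
      (HomologicalComplex.congr_hom (Limits.cokernel.π_desc f (v ≫ Limits.cokernel.π f') _) i) b
  refine isIso_homologyMap_of_injective _ (fun i => ?_) (fun j q hq => ?_) j
  · refine (injective_iff_map_eq_zero _).2 fun c hc => ?_
    obtain ⟨b, rfl⟩ := cokernel_π_surjective f i c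
    rw [hmap, cokernel_π_eq_zero_iff] at hc
    obtain ⟨a, ha⟩ := hc
    exact (cokernel_π_eq_zero_iff f i b).2 (h₁ i b a ha.symm)
  · obtain ⟨q, rfl⟩ := cokernel_π_surjective f' j q
    -- A relative chain with boundary in the image lifts to a chain with boundary in `A' + B`; the
    -- part of the resulting decomposition that comes from `A'` dies in the quotient.
    obtain ⟨b, a, e, rfl⟩ := h₂ j q fun i => by
      obtain ⟨c, hc⟩ := hq i
      obtain ⟨b, rfl⟩ := cokernel_π_surjective f i c
      rw [hmap, hom_comm_apply, eq_comm, ← sub_eq_zero, ← map_sub, cokernel_π_eq_zero_iff] at hc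
      obtain ⟨a, ha⟩ := hc
      exact ⟨b, a, by rw [ha, add_sub_cancel]⟩
    refine ⟨((Limits.cokernel.π f).f j).hom b, ((Limits.cokernel.π f').f (j + 1)).hom e, ?_⟩
    rw [map_add, map_add, (cokernel_π_eq_zero_iff f' j _).2 ⟨a, rfl⟩, add_zero, hmap,
      hom_comm_apply]

end

end PerverseSpace

/-! ### Chains of subspaces inside the chains of the whole space, and the three statements -/

namespace PerverseSpace

section

variable {K : SSet.{u}} (E : LocalSystem.{u, w} K) {A B : K.Subcomplex}

open Classical in
/-- The retraction of the chains of `B` to those of `A ≤ B` that drops the other simplices. -/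
noncomputable def chainGroupRetraction (A B : K.Subcomplex) (l : SimplexCategoryᵒᵖ) :
    ChainGroup E B l →+ ChainGroup E A l :=
  DirectSum.toAddMonoid fun σ : B.obj l =>
    if h : σ.1 ∈ A.obj l then single E A ⟨σ.1, h⟩ else 0

lemma chainGroupRetraction_single {l : SimplexCategoryᵒᵖ} (σ : B.obj l) (h : σ.1 ∈ A.obj l)
    (a : E.at (vertex σ.1 0)) :
    chainGroupRetraction E A B l (single E B σ a) = single E A ⟨σ.1, h⟩ a := by
  classical
  simp only [chainGroupRetraction, single]
  rw [DirectSum.toAddMonoid_of, dif_pos h]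

lemma chainGroupRetraction_single_of_notMem {l : SimplexCategoryᵒᵖ} (σ : B.obj l)
    (h : σ.1 ∉ A.obj l) (a : E.at (vertex σ.1 0)) :
    chainGroupRetraction E A B l (single E B σ a) = 0 := by
  classical
  simp only [chainGroupRetraction, single]
  rw [DirectSum.toAddMonoid_of, dif_neg h]
  rfl

lemma chainGroupRetraction_chainGroupIncl (h : A ≤ B) (l : SimplexCategoryᵒᵖ)
    (c : ChainGroup E A l) : chainGroupRetraction E A B l (chainGroupIncl E h l c) = c := by
  revert c
  refine DFunLike.congr_fun (f := (chainGroupRetraction E A B l).comp (chainGroupIncl E h l))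
    (g := AddMonoidHom.id _) (chainGroup_hom_ext fun σ a => ?_)
  rw [AddMonoidHom.comp_apply, chainGroupIncl_single]
  exact chainGroupRetraction_single E (A := A) (B := B) ⟨σ.1, h l σ.2⟩ σ.2 a

lemma chainsMap_injective (h : A ≤ B) (j : ℕ) :
    Function.Injective ((chainsMap E h).f j).hom :=
  Function.LeftInverse.injective (g := chainGroupRetraction E A B (op ⦋j⦌))
    (chainGroupRetraction_chainGroupIncl E h (op ⦋j⦌))

end

namespace Perversity

variable {X : Type u} [TopologicalSpace X] {n : ℕ} {F : Filtration X n} {p : Perversity F}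
  (E : LocalSystem.{u, w} (p.gajer : SSet.{u}))

lemma chainsMap_mem_chainsOn {A : (p.gajer : SSet.{u}).Subcomplex} (h : A ≤ p.gajerIn Set.univ)
    (j : ℕ) (c : ChainGroup E A (op ⦋j⦌)) :
    chainGroupIncl E h (op ⦋j⦌) c ∈ chainsOn E (A.obj (op ⦋j⦌)) := by
  have e : (QuotientAddGroup.mk' (chainsOn E (A.obj (op ⦋j⦌)))).comp
      (chainGroupIncl E h (op ⦋j⦌)) = 0 := chainGroup_hom_ext fun σ a => by
    rw [AddMonoidHom.comp_apply, chainGroupIncl_single]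
    exact (QuotientAddGroup.eq_zero_iff _).2 (single_mem_chainsOn E σ.2 a)
  exact (QuotientAddGroup.eq_zero_iff _).1 (DFunLike.congr_fun e c)

/-- Translates between supports, used for subdivision, and images of chain maps, used in the
homological algebra. -/
lemma mem_chainsOn_iff {A : (p.gajer : SSet.{u}).Subcomplex} (h : A ≤ p.gajerIn Set.univ)
    {j : ℕ} {c : GajerChainGroup E j} :
    c ∈ chainsOn E (A.obj (op ⦋j⦌)) ↔ ∃ x, ((chainsMap E h).f j).hom x = c := by
  constructor
  · refine fun hc => map_mem_chainsOn E (f := AddMonoidHom.id _)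
      (H := (chainGroupIncl E h (op ⦋j⦌)).range) (fun σ hσ a => ?_) hc
    exact ⟨single E A ⟨σ, hσ⟩ a, chainGroupIncl_single E h ⟨σ, hσ⟩ a⟩
  · rintro ⟨x, rfl⟩
    exact chainsMap_mem_chainsOn E h j x

/-- The retraction onto the chains of `A` fixes `c`, and it sends each generator on a simplex of
`A'` either to itself, on a simplex of both, or to 0. -/
lemma mem_chainsOn_inter {A A' : (p.gajer : SSet.{u}).Subcomplex} (h : A ≤ p.gajerIn Set.univ)
    {j : ℕ} {c : GajerChainGroup E j} (hc : c ∈ chainsOn E (A.obj (op ⦋j⦌)))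
    (hc' : c ∈ chainsOn E (A'.obj (op ⦋j⦌))) :
    c ∈ chainsOn E (A.obj (op ⦋j⦌) ∩ A'.obj (op ⦋j⦌)) := by
  obtain ⟨x, rfl⟩ := (mem_chainsOn_iff E h).1 hc
  have e : chainGroupIncl E h (op ⦋j⦌) (chainGroupRetraction E A _ (op ⦋j⦌)
      (chainGroupIncl E h (op ⦋j⦌) x)) = chainGroupIncl E h (op ⦋j⦌) x :=
    congrArg _ (chainGroupRetraction_chainGroupIncl E h _ x)
  refine e ▸ map_mem_chainsOn E (f := (chainGroupIncl E h (op ⦋j⦌)).comp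
    (chainGroupRetraction E A _ (op ⦋j⦌))) (fun σ hσ a => ?_) hc'
  by_cases hA : σ ∈ A.obj (op ⦋j⦌)
  · have e' := (congrArg (chainGroupIncl E h (op ⦋j⦌)) (chainGroupRetraction_single E (A := A)
      (toUniv σ) hA a)).trans (chainGroupIncl_single E h ⟨σ, hA⟩ a)
    exact (congrArg (· ∈ chainsOn E (A.obj (op ⦋j⦌) ∩ A'.obj (op ⦋j⦌))) e').mpr
      (single_mem_chainsOn E (S := A.obj (op ⦋j⦌) ∩ A'.obj (op ⦋j⦌)) ⟨hA, hσ⟩ a)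
  · have e' := (congrArg (chainGroupIncl E h (op ⦋j⦌)) (chainGroupRetraction_single_of_notMem E
      (A := A) (toUniv σ) hA a)).trans (map_zero _)
    exact (congrArg (· ∈ chainsOn E (A.obj (op ⦋j⦌) ∩ A'.obj (op ⦋j⦌))) e').mpr (zero_mem _)

lemma exists_add_of_mem_chainsOn_union {k : ℕ} {S S' : Set ((p.gajer : SSet.{u}) _⦋k⦌)}
    {c : GajerChainGroup E k} (hc : c ∈ chainsOn E (S ∪ S')) :
    ∃ a ∈ chainsOn E S, ∃ b ∈ chainsOn E S', a + b = c := by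
  have h : c ∈ chainsOn E S ⊔ chainsOn E S' := by
    refine map_mem_chainsOn E (f := AddMonoidHom.id _) (fun σ hσ a => ?_) hc
    rcases hσ with hσ | hσ
    · exact AddSubgroup.mem_sup_left (single_mem_chainsOn E hσ a)
    · exact AddSubgroup.mem_sup_right (single_mem_chainsOn E hσ a)
  exact AddSubgroup.mem_sup.1 h

/-- Every chain with boundary a sum of small chains is homologous to a sum of small chains. -/
lemma exists_small_homologous (hF : F.LocallyFiniteStratification)
    {𝒰 : Set (Set X)} (h𝒰 : ∀ x, ∃ U ∈ 𝒰, x ∈ interior U) (j : ℕ)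
    (q : (p.gajerChains E Set.univ).X j)
    (hq : ∀ i, ((p.gajerChains E Set.univ).d j i).hom q ∈ chainsOn E (p.smallSimplices 𝒰 i)) :
    ∃ c : (p.gajerChains E Set.univ).X j, c ∈ chainsOn E (p.smallSimplices 𝒰 j) ∧ ∃ e,
      q = c + ((p.gajerChains E Set.univ).d (j + 1) j).hom e := by
  cases j with
  | zero =>
    obtain ⟨e, he⟩ := exists_small_homologous_zero E hF h𝒰 q
    exact ⟨_, he, e, (sub_add_cancel _ _).symm⟩
  | succ j =>
    obtain ⟨e, he⟩ := exists_small_homologous_succ E hF h𝒰 (hq j)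
    exact ⟨_, he, e, (sub_add_cancel _ _).symm⟩

lemma smallSimplices_pair (W W' : Set X) (j : ℕ) :
    p.smallSimplices {W, W'} j = (p.gajerIn W).obj (op ⦋j⦌) ∪ (p.gajerIn W').obj (op ⦋j⦌) := by
  ext σ
  constructor
  · rintro ⟨U, rfl | rfl, h⟩
    · exact Or.inl h
    · exact Or.inr h
  · rintro (h | h)
    · exact ⟨W, Or.inl rfl, h⟩
    · exact ⟨W', Or.inr rfl, h⟩

/-- Every chain whose boundary is a sum of chains of `W` and `W'` is homologous to such a sum if
the interiors of `W` and `W'` cover the space. -/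
lemma exists_add_homologous (hF : F.LocallyFiniteStratification) {W W' : Set X}
    (h : ∀ x, x ∈ interior W ∨ x ∈ interior W') (j : ℕ) (q : (p.gajerChains E Set.univ).X j)
    (hq : ∀ i, ∃ a b, ((p.gajerChains E Set.univ).d j i).hom q =
      ((p.gajerChainsMap E (Set.subset_univ W)).f i).hom a +
        ((p.gajerChainsMap E (Set.subset_univ W')).f i).hom b) :
    ∃ a b e, q = ((p.gajerChainsMap E (Set.subset_univ W)).f j).hom a +
        ((p.gajerChainsMap E (Set.subset_univ W')).f j).hom b +
      ((p.gajerChains E Set.univ).d (j + 1) j).hom e := by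
  obtain ⟨c, hc, e, rfl⟩ := exists_small_homologous E hF (𝒰 := {W, W'}) (fun x => by
    rcases h x with hx | hx
    · exact ⟨W, Or.inl rfl, hx⟩
    · exact ⟨W', Or.inr rfl, hx⟩) j q fun i => by
      obtain ⟨a, b, hab⟩ := hq i
      rw [hab, smallSimplices_pair]
      exact add_mem
        (chainsOn_mono E Set.subset_union_left ((mem_chainsOn_iff E _).2 ⟨a, rfl⟩))
        (chainsOn_mono E Set.subset_union_right ((mem_chainsOn_iff E _).2 ⟨b, rfl⟩))
  rw [smallSimplices_pair] at hc
  obtain ⟨a, ha, b, hb, rfl⟩ := exists_add_of_mem_chainsOn_union E hc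
  obtain ⟨a, rfl⟩ := (mem_chainsOn_iff E (p.gajerIn_mono (Set.subset_univ W))).1 ha
  obtain ⟨b, rfl⟩ := (mem_chainsOn_iff E (p.gajerIn_mono (Set.subset_univ W'))).1 hb
  exact ⟨a, b, e, rfl⟩

/-- A chain of `W` that is a chain of `W'` is a chain of `W ∩ W'`. -/
lemma exists_of_chainsMap_eq {W W' W'' : Set X} (h : W'' ⊆ W) (hW : W ∩ W' ⊆ W'') (j : ℕ)
    (a : (p.gajerChains E W).X j) (b : (p.gajerChains E W').X j)
    (e : ((p.gajerChainsMap E (Set.subset_univ W)).f j).hom a =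
      ((p.gajerChainsMap E (Set.subset_univ W')).f j).hom b) :
    ∃ x, ((p.gajerChainsMap E h).f j).hom x = a := by
  have hc := mem_chainsOn_inter E (p.gajerIn_mono (Set.subset_univ W))
    ((mem_chainsOn_iff E _).2 ⟨a, rfl⟩) ((mem_chainsOn_iff E _).2 ⟨b, e.symm⟩)
  have hs : (p.gajerIn W).obj (op ⦋j⦌) ∩ (p.gajerIn W').obj (op ⦋j⦌) ⊆
      (p.gajerIn W'').obj (op ⦋j⦌) := fun σ hσ x => hW ⟨hσ.1 x, hσ.2 x⟩
  obtain ⟨x, hx⟩ := (mem_chainsOn_iff E (p.gajerIn_mono (Set.subset_univ W''))).1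
    (chainsOn_mono E hs hc)
  -- The preimage was found inside the chains of the whole space; injectivity brings the equation
  -- back to `W`.
  refine ⟨x, chainsMap_injective E (p.gajerIn_mono (Set.subset_univ W)) j (Eq.trans ?_ hx)⟩
  exact ConcreteCategory.congr_hom (HomologicalComplex.congr_hom
    (chainsMap_comp E (p.gajerIn_mono h) (p.gajerIn_mono (Set.subset_univ W))) j) x

/-- The chain complexes of an open covering by two sets. -/
noncomputable def excisiveSquare (hF : F.LocallyFiniteStratification) {U V : Set X}
    (hU : IsOpen U) (hV : IsOpen V) (hUV : U ∪ V = Set.univ) :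
    ExcisiveSquare (p.gajerChains E (U ∩ V)) (p.gajerChains E U) (p.gajerChains E V)
      (p.gajerChains E Set.univ) where
  f := p.gajerChainsMap E Set.inter_subset_left
  g := p.gajerChainsMap E Set.inter_subset_right
  h := p.gajerChainsMap E (Set.subset_univ U)
  k := p.gajerChainsMap E (Set.subset_univ V)
  comm := (chainsMap_comp E _ _).trans (chainsMap_comp E _ _).symm
  injective_f := chainsMap_injective E _
  injective_k := chainsMap_injective E _
  exists_of_eq := exists_of_chainsMap_eq E _ subset_rfl
  exists_homologous j q hq := by
    obtain ⟨a, b, e, he⟩ := exists_add_homologous E hF (W := U) (W' := V) (fun x => by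
      rw [hU.interior_eq, hV.interior_eq]
      exact hUV.ge (Set.mem_univ x)) j q fun i => by
        obtain ⟨a, b, hab⟩ := hq i
        exact ⟨a, -b, by rw [hab, map_neg, sub_eq_add_neg]⟩
    -- The sign passes from the sums of small chains to the differences of the Mayer-Vietoris
    -- convention.
    exact ⟨a, -b, e, by rw [he, map_neg, sub_neg_eq_add]⟩

lemma isIso_homologyMap_small (hF : F.LocallyFiniteStratification) {𝒰 : Set (Set X)}
    (hopen : ∀ U ∈ 𝒰, IsOpen U) (hcover : ⋃₀ 𝒰 = Set.univ) (j : ℕ) :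
    IsIso (HomologicalComplex.homologyMap (chainsMap E (p.gajerSmall_le 𝒰)) j) := by
  refine isIso_homologyMap_of_injective _ (chainsMap_injective E _) (fun j q hq => ?_) j
  obtain ⟨c, hc, e, he⟩ := exists_small_homologous E hF (𝒰 := 𝒰) (fun x => by
    obtain ⟨U, hU, hx⟩ := hcover.ge (Set.mem_univ x)
    exact ⟨U, hU, (hopen U hU).interior_eq.symm ▸ hx⟩) j q fun i =>
      (mem_chainsOn_iff E (p.gajerSmall_le 𝒰)).2 (hq i)
  obtain ⟨x, rfl⟩ := (mem_chainsOn_iff E (p.gajerSmall_le 𝒰)).1 hc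
  exact ⟨x, e, he⟩

/-- The interiors of `X \ Z` and `A` cover `X`: a point outside the closure of `Z` is interior to `X
\ Z`, and the closure of `Z` lies in the interior of `A`. Their intersection is `A \ Z`, so the
quotient criterion applies to this pair. -/
lemma isIso_gajerRelHomologyMap (hF : F.LocallyFiniteStratification) {Z A : Set X}
    (h : closure Z ⊆ interior A) (j : ℕ) :
    IsIso (p.gajerRelHomologyMap E
      (Set.sdiff_subset_sdiff_left (Set.subset_univ A) : A \ Z ⊆ Set.univ \ Z)
      (Set.subset_univ A) Set.sdiff_subset Set.sdiff_subset j) := by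
  refine isIso_homologyMap_cokernel_map
    (p.gajerChainsMap E (Set.sdiff_subset_sdiff_left (Set.subset_univ A))) _
    (p.gajerChainsMap E Set.sdiff_subset) _
    ((chainsMap_comp E _ _).trans (chainsMap_comp E _ _).symm)
    (exists_of_chainsMap_eq E _ fun x hx => ?_)
    (exists_add_homologous E hF fun x => ?_) j
  · exact ⟨hx.2, hx.1.2⟩
  · by_cases hx : x ∈ closure Z
    · exact Or.inr (h hx)
    · refine Or.inl (interior_mono (s := (closure Z)ᶜ) (t := Set.univ \ Z)
        (fun y hy => ⟨Set.mem_univ y, fun hyZ => hy (subset_closure hyZ)⟩) ?_)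
      rw [(isClosed_closure (s := Z)).isOpen_compl.interior_eq]
      exact hx

end Perversity

end PerverseSpace

theorem theorem2 {X : Type u} [TopologicalSpace X] {n : ℕ}
    (F : PerverseSpace.Filtration X n) (p : PerverseSpace.Perversity F)
    (hF : F.LocallyFiniteStratification)
    (E : PerverseSpace.LocalSystem.{u, w} (p.gajer : SSet.{u})) :
    -- small chains
    (∀ 𝒰 : Set (Set X), (∀ U ∈ 𝒰, IsOpen U) → ⋃₀ 𝒰 = Set.univ →
      ∀ j : ℕ, IsIso (HomologicalComplex.homologyMap
        (PerverseSpace.chainsMap E (p.gajerSmall_le 𝒰)) j)) ∧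
    -- the Mayer-Vietoris long exact sequence
    (∀ U V : Set X, IsOpen U → IsOpen V → U ∪ V = Set.univ →
      ∃ δ : ∀ j : ℕ, p.gajerHomology E Set.univ (j + 1) ⟶ p.gajerHomology E (U ∩ V) j,
        (∀ j : ℕ, Function.Exact
          (fun c : p.gajerHomology E (U ∩ V) j =>
            (p.gajerHomologyMap E (Set.inter_subset_left : U ∩ V ⊆ U) j c,
              p.gajerHomologyMap E (Set.inter_subset_right : U ∩ V ⊆ V) j c))
          (fun c : p.gajerHomology E U j × p.gajerHomology E V j =>
            p.gajerHomologyMap E (Set.subset_univ U) j c.1 -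
              p.gajerHomologyMap E (Set.subset_univ V) j c.2)) ∧
        (∀ j : ℕ, Function.Exact
          (fun c : p.gajerHomology E U (j + 1) × p.gajerHomology E V (j + 1) =>
            p.gajerHomologyMap E (Set.subset_univ U) (j + 1) c.1 -
              p.gajerHomologyMap E (Set.subset_univ V) (j + 1) c.2)
          (δ j)) ∧
        (∀ j : ℕ, Function.Exact (δ j)
          (fun c : p.gajerHomology E (U ∩ V) j =>
            (p.gajerHomologyMap E (Set.inter_subset_left : U ∩ V ⊆ U) j c,
              p.gajerHomologyMap E (Set.inter_subset_right : U ∩ V ⊆ V) j c))) ∧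
        Function.Surjective
          (fun c : p.gajerHomology E U 0 × p.gajerHomology E V 0 =>
            p.gajerHomologyMap E (Set.subset_univ U) 0 c.1 -
              p.gajerHomologyMap E (Set.subset_univ V) 0 c.2) ∧
        -- description of the connecting homomorphism
        (∀ (j : ℕ) (x : (p.gajerChains E U).X (j + 1)) (y : (p.gajerChains E V).X (j + 1))
          (z : (p.gajerChains E (U ∩ V)).X j)
          (a : p.gajerHomology E Set.univ (j + 1)) (b : p.gajerHomology E (U ∩ V) j),
          (p.gajerChains E U).d (j + 1) j x =
            (p.gajerChainsMap E (Set.inter_subset_left : U ∩ V ⊆ U)).f j z →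
          (p.gajerChains E V).d (j + 1) j y =
            (p.gajerChainsMap E (Set.inter_subset_right : U ∩ V ⊆ V)).f j z →
          PerverseSpace.IsClassOf (p.gajerChains E Set.univ) a
            ((p.gajerChainsMap E (Set.subset_univ U)).f (j + 1) x -
              (p.gajerChainsMap E (Set.subset_univ V)).f (j + 1) y) →
          PerverseSpace.IsClassOf (p.gajerChains E (U ∩ V)) b z →
          δ j a = b)) ∧
    -- excision
    (∀ (Z A : Set X) (_ : Z ⊆ A), closure Z ⊆ interior A →
      ∀ j : ℕ, IsIso (p.gajerRelHomologyMap E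
        (Set.sdiff_subset_sdiff_left (Set.subset_univ A) : A \ Z ⊆ Set.univ \ Z)
        (Set.subset_univ A) Set.sdiff_subset Set.sdiff_subset j)) := by
  refine ⟨fun 𝒰 => PerverseSpace.Perversity.isIso_homologyMap_small E hF, fun U V hU hV hUV => ?_,
    fun Z A _ => PerverseSpace.Perversity.isIso_gajerRelHomologyMap E hF⟩
  let S := PerverseSpace.Perversity.excisiveSquare E hF hU hV hUV
  exact ⟨S.δ, S.exact_middle, S.exact_right, S.exact_left, S.surjective_zero,
    fun j x y z a b hx hy ha hb => S.rel_iff.1 ⟨x, y, z, hx, hy, ha, hb⟩⟩
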